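/- Let $\Gamma=SL_2(\mathbb Z)$, let $\mathfrak H$ be the upper half-plane and $P\subset\Gamma$ the subgroup of upper triangular matrices. Let $E_s(z)$ be the meromorphic continuation in $s$ of $\sum_{\gamma\in P\backslash\Gamma}\operatorname{Im}(\gamma z)^s$ ($\operatorname{Re}s>1$), and let $E_1^*(z)$ be the constant term of its Laurent expansion at $s=1$; below, $E_1$ is read as $E_1^*$. Put $\xi(s)=\pi^{-s/2}\Gamma(s/2)\zeta(s)$, $c_s=\xi(2-2s)/\xi(2s)$ (as a meromorphic function), $C_\alpha=\frac{d}{ds}c_s\big|_{s=\alpha}$, and for $y>0$ $$W_s(y)=\frac{\pi^s}{\Gamma(s)}\sqrt y\int_0^\infty t^{s-1/2}e^{-(t+1/t)\pi y}\,\frac{dt}{t},\qquad \varphi(n,s)=\frac{\sigma_{2s-1}(|n|)}{|n|^{s}\,\zeta(2s)}\quad(n\ne0),$$ where $\sigma_w(m)=\sum_{d\mid m}d^w$ and $\varphi(n,1/2)=0$. Let $f\neq0$ be a Maass cusp form for $\Gamma$: a smooth $\Gamma$-invariant function on $\mathfrak H$ in $L^2(\Gamma\backslash\mathfrak H)$ with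 $\int_0^1f(x+iy)\,dx=0$ for all $y>0$ and $y^2(\partial_x^2+\partial_y^2)f=s(s-1)f$. Let $\alpha,\beta\in\mathbb C\setminus\{1\}$ with $\operatorname{Re}\alpha,\operatorname{Re}\beta\ge\frac12$, $\operatorname{Re}(\alpha+\beta)\neq\frac32$ and $\operatorname{Re}\beta\ne\operatorname{Re}\alpha\pm\frac12$. If $\operatorname{Re}\alpha\le\operatorname{Re}\beta$, put $$S=\begin{cases} E_\alpha E_\beta-E_{\alpha+\beta}-c_\alpha E_{1-\alpha+\beta}, & \operatorname{Re}\alpha+\frac12<\operatorname{Re}\beta,\\ E_\alpha E_\beta-E_{\alpha+\beta}-c_\beta E_{1+\alpha-\beta}-c_\alpha E_{1-\alpha+\beta}, & \operatorname{Re}\beta<\operatorname{Re}\alpha+\frac12,\ \alpha\ne\beta,\ \operatorname{Re}(\alpha+\beta)>\frac32,\\ E_\alpha E_\beta-E_{\alpha+\beta}-c_\beta E_{1+\alpha-\beta}-c_\alpha E_{1-\alpha+\beta}-c_\alpha c_\beta E_{2-\alpha-\beta}, & \operatorname{Re}\beta<\operatorname{Re}\alpha+\frac12,\ \alpha\ne\beta,\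 \operatorname{Re}(\alpha+\beta)<\frac32,\\ E_\alpha^2-E_{2\alpha}-2c_\alpha E_1^*+\frac\pi3C_\alpha, & \alpha=\beta,\ \operatorname{Re}\alpha>\frac34,\\ E_\alpha^2-E_{2\alpha}-2c_\alpha E_1^*-c_\alpha^2E_{2-2\alpha}+\frac\pi3C_\alpha, & \alpha=\beta,\ \operatorname{Re}\alpha<\frac34, \end{cases}$$ and if $\operatorname{Re}\alpha>\operatorname{Re}\beta$ use the same formulas with $\alpha$ and $\beta$ interchanged. Then $f$ has a Fourier–Whittaker expansion $f(x+iy)=\sum_{n\ne0}c_nW_s(|n|y)e^{2\pi inx}$. The Dirichlet series $$L(w,\overline f\times E_\beta)=\sum_{n\neq0}\frac{\varphi(n,\beta)\,\overline{c_n}}{|n|^{w-1}}$$ converges absolutely in some right half-plane and has a meromorphic continuation to $w\in\mathbb C$. Put $$G(w)=\frac{\pi^{\beta+\overline s-w}}{2\,\Gamma(\beta)\Gamma(\overline s)}\cdot\frac{\Gamma(\frac{w+\beta-\overline s}2)\Gamma(\frac{w-\beta+\overline s}2)\Gamma(\frac{w+1-\beta-\overline s}2)\Gamma(\frac{w-1+\beta+\overline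 s}2)}{\Gamma(w)}$$ and let $\Lambda(w,\overline f\times E_\beta)$ be the meromorphic function $L(w,\overline f\times E_\beta)\,G(w)$ of $w$. Both $L(w,\overline f\times E_\beta)$ and $\Lambda(w,\overline f\times E_\beta)$ are holomorphic at $w=\alpha$, the function $S\overline f$ is integrable on $\Gamma\backslash\mathfrak H$ with respect to $dx\,dy/y^2$, and $$\langle S,f\rangle_{L^2}=\int_{\Gamma\backslash\mathfrak H}S\,\overline f\,\frac{dx\,dy}{y^2}=\Lambda(\alpha,\overline f\times E_\beta).$$ If moreover neither $\frac{\alpha-\beta+\overline s}2$ nor $\frac{\alpha+1-\beta-\overline s}2$ is a non-positive integer, so that $G$ has no pole at $\alpha$, then $\langle S,f\rangle_{L^2}=L(\alpha,\overline f\times E_\beta)\,G(\alpha)$. -/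

import Mathlib

open MeasureTheory Filter Topology
open UpperHalfPlane hiding I
open scoped MatrixGroups Modular ComplexConjugate ContDiff

noncomputable section

/-! ### Meromorphic continuation -/

/-- `g` is the meromorphic continuation to `ℂ` of a function `F` that is given on some right
half-plane. The normal form fixes the values of `g` at removable singularities (the limit)
and at poles (`0`). -/
def IsMeromorphicContinuation (F g : ℂ → ℂ) : Prop :=
  MeromorphicNFOn g Set.univ ∧ ∃ σ : ℝ, ∀ s : ℂ, σ < s.re → g s = F s

theorem IsMeromorphicContinuation.unique {F g h : ℂ → ℂ}
    (hg : IsMeromorphicContinuation F g) (hh : IsMeromorphicContinuation F h) : g = h := by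
  obtain ⟨hg, σ, hσ⟩ := hg
  obtain ⟨hh, τ, hτ⟩ := hh
  have hd : MeromorphicOn (g - h) Set.univ := hg.meromorphicOn.sub hh.meromorphicOn
  have htop : ∀ z, meromorphicOrderAt (g - h) z = ⊤ := by
    intro z
    by_contra hz
    have hp : ((max σ τ + 1 : ℝ) : ℂ).re = max σ τ + 1 := Complex.ofReal_re _
    have h1 := hd.meromorphicOrderAt_ne_top_of_isPreconnected
      (x := z) (y := ((max σ τ + 1 : ℝ) : ℂ)) isPreconnected_univ trivial trivial hz
    apply h1
    rw [meromorphicOrderAt_eq_top_iff]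
    apply Filter.Eventually.filter_mono nhdsWithin_le_nhds
    have : {w : ℂ | max σ τ < w.re} ∈ 𝓝 ((max σ τ + 1 : ℝ) : ℂ) :=
      (isOpen_lt continuous_const Complex.continuous_re).mem_nhds (by
        show max σ τ < _
        rw [hp]; linarith)
    filter_upwards [this] with w hw
    have hw' : max σ τ < w.re := hw
    simp [hσ w (lt_of_le_of_lt (le_max_left _ _) hw'),
      hτ w (lt_of_le_of_lt (le_max_right _ _) hw')]
  funext z
  have h2 : g =ᶠ[𝓝[≠] z] h := by
    filter_upwards [meromorphicOrderAt_eq_top_iff.1 (htop z)] with w hw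
    exact sub_eq_zero.1 hw
  exact (((hg (Set.mem_univ z)).eventuallyEq_nhdsNE_iff_eventuallyEq_nhds
    (hh (Set.mem_univ z))).1 h2).eq_of_nhds

open Classical in
/-- The meromorphic continuation to `ℂ` of a function given on some right half-plane (and the
zero function when there is none). -/
def meromorphicContinuation (F : ℂ → ℂ) : ℂ → ℂ :=
  if h : ∃ g, IsMeromorphicContinuation F g then h.choose else 0

theorem IsMeromorphicContinuation.eq {F g : ℂ → ℂ} (hg : IsMeromorphicContinuation F g) :
    meromorphicContinuation F = g := by
  have h : ∃ g, IsMeromorphicContinuation F g := ⟨g, hg⟩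
  rw [meromorphicContinuation, dif_pos h]
  exact h.choose_spec.unique hg

/-! ### Eisenstein series for `SL(2, ℤ)` -/

/-- The subgroup `P` of upper triangular matrices in `SL(2, ℤ)`. -/
def parabolicSubgroup : Subgroup SL(2, ℤ) where
  carrier := {γ | γ 1 0 = 0}
  one_mem' := by simp
  mul_mem' := by
    intro a b ha hb
    simp only [Set.mem_ofPred_eq] at ha hb ⊢
    simp [Matrix.mul_apply, Fin.sum_univ_two, ha, hb]
  inv_mem' := by
    intro a ha
    simp only [Set.mem_ofPred_eq] at ha ⊢
    simp [Matrix.SpecialLinearGroup.SL2_inv_expl, ha]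

/-- `∑_{γ ∈ P \ Γ} Im(γ z) ^ s`, absolutely convergent for `Re s > 1`. The summand does not depend
on the chosen representative of the coset `P γ`. -/
def eisensteinSum (s : ℂ) (z : ℍ) : ℂ :=
  ∑' q : Quotient (QuotientGroup.rightRel parabolicSubgroup), (((q.out • z).im : ℝ) : ℂ) ^ s

/-- The constant term `E₁*` of the Laurent expansion of `E_s(z)` at its simple pole `s = 1`,
that is, the derivative of `(s - 1) E_s(z)` at `s = 1`. -/
def eisensteinStar (z : ℍ) : ℂ :=
  deriv (meromorphicContinuation fun s => (s - 1) * eisensteinSum s z) 1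

open Classical in
/-- The Eisenstein series `E_s(z)`, continued meromorphically in `s`. At the pole `s = 1` the
symbol stands for `E₁*`. -/
def eisenstein (s : ℂ) (z : ℍ) : ℂ :=
  if s = 1 then eisensteinStar z
  else meromorphicContinuation (fun w => eisensteinSum w z) s

/-- `c_s = ξ(2 - 2 s) / ξ(2 s)` as a meromorphic function, `ξ(s) = π^(-s/2) Γ(s/2) ζ(s)`. -/
def scatteringCoeff : ℂ → ℂ :=
  toMeromorphicNFOn
    (fun s => completedRiemannZeta (2 - 2 * s) / completedRiemannZeta (2 * s)) Set.univ

/-! ### Fourier-Whittaker expansions and cusp forms -/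

/-- `W_s(y) = π^s / Γ(s) * √y * ∫_0^∞ t^(s - 1/2) exp(-(t + 1/t) π y) dt / t`. -/
def maassWhittaker (s : ℂ) (y : ℝ) : ℂ :=
  (Real.pi : ℂ) ^ s / Complex.Gamma s * (Real.sqrt y : ℂ) *
    ∫ t in Set.Ioi (0 : ℝ),
      (t : ℂ) ^ (s - 1 / 2) * (Real.exp (-(t + 1 / t) * Real.pi * y) : ℂ) / (t : ℂ)

/-- The character `x ↦ exp(2 π i n x)`. -/
def fourierExp (n : ℤ) (x : ℝ) : ℂ :=
  Complex.exp (2 * Real.pi * Complex.I * n * x)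

/-- The Fourier coefficient `∫_0^1 f(x + i y) exp(-2 π i n x) dx`. -/
def fourierCoeffAt (f : ℍ → ℂ) (n : ℤ) (y : ℝ) : ℂ :=
  ∫ x in (0 : ℝ)..1, f (ofComplex (x + y * Complex.I)) * fourierExp (-n) x

open Classical in
/-- The constant `c_n` with `∫_0^1 f(x + i y) exp(-2 π i n x) dx = c_n W_s(|n| y)` for all
`y > 0`. -/
def whittakerCoeff (s : ℂ) (f : ℍ → ℂ) (n : ℤ) : ℂ :=
  if h : ∃ c : ℂ, ∀ y : ℝ, 0 < y → fourierCoeffAt f n y = c * maassWhittaker s (|(n : ℝ)| * y)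
  then h.choose else 0

/-- The coefficient `φ(n, s) = σ_{2s-1}(|n|) / (|n|^s ζ(2s))` of `W_s(|n| y) exp(2 π i n x)` in
the Fourier-Whittaker expansion of `E_s`, as a meromorphic function of `s` (it vanishes at
`s = 1/2`, where `ζ(2s)` has its pole). -/
def eisensteinCoeff (n : ℤ) : ℂ → ℂ :=
  toMeromorphicNFOn
    (fun s => (∑ d ∈ n.natAbs.divisors, (d : ℂ) ^ (2 * s - 1)) /
      ((n.natAbs : ℂ) ^ s * riemannZeta (2 * s))) Set.univ

/-- Maass cusp forms for `SL(2, ℤ)` with eigenvalue `s (s - 1)` of the invariant Laplacian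
`y² (∂²/∂x² + ∂²/∂y²)`. -/
structure IsMaassCuspForm (s : ℂ) (f : ℍ → ℂ) : Prop where
  smooth : ContDiffOn ℝ ∞ (f ∘ ofComplex) {z : ℂ | 0 < z.im}
  invariant : ∀ (γ : SL(2, ℤ)) (z : ℍ), f (γ • z) = f z
  eigen : ∀ z : ℍ, ((z.im : ℝ) : ℂ) ^ 2 * Laplacian.laplacian (f ∘ ofComplex) (z : ℂ)
    = s * (s - 1) * f z
  memLp : MemLp f 2 (volume.restrict 𝒟)
  cuspidal : ∀ y : ℝ, 0 < y → ∫ x in (0 : ℝ)..1, f (ofComplex (x + y * Complex.I)) = 0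
  ne_zero : f ≠ 0

/-! ### The Rankin-Selberg `L`-function of `f̄` and `E_β` -/

/-- The term `φ(n, β) * conj c_n / |n|^(w - 1)` of the Dirichlet series. -/
def rankinSelbergTerm (s : ℂ) (f : ℍ → ℂ) (β w : ℂ) (n : {n : ℤ // n ≠ 0}) : ℂ :=
  eisensteinCoeff n β * conj (whittakerCoeff s f n) / ((n : ℤ).natAbs : ℂ) ^ (w - 1)

/-- The Dirichlet series `∑_{n ≠ 0} φ(n, β) * conj c_n / |n|^(w - 1)`. -/
def rankinSelbergSeries (s : ℂ) (f : ℍ → ℂ) (β w : ℂ) : ℂ :=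
  ∑' n : {n : ℤ // n ≠ 0}, rankinSelbergTerm s f β w n

/-- `w ↦ L(w, f̄ × E_β)`. -/
def rankinSelbergL (s : ℂ) (f : ℍ → ℂ) (β : ℂ) : ℂ → ℂ :=
  meromorphicContinuation (rankinSelbergSeries s f β)

/-- The ratio of Gamma factors. -/
def gammaRatio (s β w : ℂ) : ℂ :=
  (Real.pi : ℂ) ^ (β + conj s - w) / (2 * Complex.Gamma β * Complex.Gamma (conj s)) *
    (Complex.Gamma ((w + β - conj s) / 2) * Complex.Gamma ((w - β + conj s) / 2) *
      Complex.Gamma ((w + 1 - β - conj s) / 2) * Complex.Gamma ((w - 1 + β + conj s) / 2) /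
      Complex.Gamma w)

/-- The completed `L`-function `w ↦ Λ(w, f̄ × E_β)`: the product of the `L`-function and the ratio
of Gamma factors, as a meromorphic function of `w`. -/
def completedRankinSelbergL (s : ℂ) (f : ℍ → ℂ) (β : ℂ) : ℂ → ℂ :=
  meromorphicContinuation fun w => rankinSelbergSeries s f β w * gammaRatio s β w

/-! ### The functions `S` -/

/-- The set `𝒞` of admissible pairs `(α, β)`. -/
def admissiblePairs : Set (ℂ × ℂ) :=
  {p | p.1 ≠ 1 ∧ p.2 ≠ 1 ∧ 1 / 2 ≤ p.1.re ∧ 1 / 2 ≤ p.2.re ∧ (p.1 + p.2).re ≠ 3 / 2 ∧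
    p.2.re ≠ p.1.re + 1 / 2 ∧ p.2.re ≠ p.1.re - 1 / 2}

open Classical in
/-- The linear combination `∑ c_i E_{s_i}` that is subtracted from `E_α E_β`, in the regimes
(III) `α = β`, (I) `Re α + 1/2 < Re β`, (II) `Re β < Re α + 1/2`, for `Re α ≤ Re β`. -/
def subtractedSumOfLe (α β : ℂ) (z : ℍ) : ℂ :=
  if α = β then
    eisenstein (2 * α) z + 2 * scatteringCoeff α * eisensteinStar z
      + (if α.re < 3 / 4 then scatteringCoeff α ^ 2 * eisenstein (2 - 2 * α) z else 0)
      - (Real.pi : ℂ) / 3 * deriv scatteringCoeff α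
  else if α.re + 1 / 2 < β.re then
    eisenstein (α + β) z + scatteringCoeff α * eisenstein (1 - α + β) z
  else
    eisenstein (α + β) z + scatteringCoeff β * eisenstein (1 + α - β) z
      + scatteringCoeff α * eisenstein (1 - α + β) z
      + (if (α + β).re < 3 / 2 then
          scatteringCoeff α * scatteringCoeff β * eisenstein (2 - α - β) z else 0)

open Classical in
/-- The linear combination of Eisenstein series for arbitrary order of `Re α`, `Re β`. -/
def subtractedSum (α β : ℂ) (z : ℍ) : ℂ :=
  if α.re ≤ β.re then subtractedSumOfLe α β z else subtractedSumOfLe β α z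

/-- `S = E_α E_β - ∑ c_i E_{s_i}`. -/
def regularizedProduct (α β : ℂ) (z : ℍ) : ℂ :=
  eisenstein α z * eisenstein β z - subtractedSum α β z

end

/-! Everything subtracted from `E_α E_β` in `S` is a combination of Eisenstein series `E_w` with `Re
w ≥ 1/2` (read as `E₁*` at `w = 1`) and constants, and a cusp form is orthogonal to all of these.
Hence `⟨S, f⟩` is the integral of `E_α · h` over the fundamental domain, where `h = E_β f̄`. This
`h` is invariant and decays exponentially at the cusp, so the integral converges without truncation,
and `w ↦ ∫ E_w h` (`eisensteinPairing`) is a meromorphic function that can be computed from the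
Fourier expansion of `E_w`. In `Re w ≥ 1/2` its only possible pole is `w = 1`.

For `Re w > 1` the sum over `P \ Γ` unfolds this integral into a Mellin transform of the zeroth
Fourier coefficient of `h`. For `Re w` large, Parseval turns that coefficient into a sum over `n ≠
0` of products of two `K`-Bessel functions; integrating termwise gives the Dirichlet series times
the Mellin transform of a product of two Bessel functions, which is the Gamma ratio `G`. So the
pairing is the continuation `Λ` of `L · G`, and its value at `w = α` is `⟨S, f⟩`. Multiplying the
pairing by the reciprocal of `G` continues `L`; since `1/Γ` is entire, that reciprocal is
holomorphic for `Re w > 0`.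

The ingredients are as follows. `mellin_besselK_mul_besselK` evaluates the Mellin transform. The
Fourier coefficients of `f` solve a linear second order equation in `y`; square integrability forces
decay (`le_exp_of_convex`), and a Wronskian argument (`exists_eq_mul_of_deriv_eq`) makes them
multiples of the Bessel solution. This yields exponential decay of `f` and the bound `O(√|n|)` for
its coefficients (`exists_besselCoeff`). The expansion of `E_s` comes from writing it as a lattice
sum and applying Poisson summation to each row (`completedRiemannZeta_mul_eisensteinSum`);
non-vanishing of `ζ` on `Re ≥ 1` locates its poles (`xiEntire_ne_zero`). Unfolding is
`integral_eisensteinSum_mul`.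

One further fact is needed: `W_s` contains `1/Γ(s)`, so the coefficients `c_n` are meaningful only
if `Γ(s) ≠ 0`. This follows from `0 < Re s < 1` (`IsMaassCuspForm.re_lt_one`), which is proved by
applying Landau's lemma to the Rankin-Selberg series of `|f|²`: if `Re s ≥ 1`, a zero of the
continued series would kill all coefficients. -/

noncomputable section

/-! ### The Bessel function `K` -/

/-- `∫ exp(ν x) (cosh x)^k exp(-2 π y cosh x) dx`; for `k = 0` this is `2 K_ν(2 π y)`. -/
def besselMoment (k : ℕ) (ν : ℂ) (y : ℝ) : ℂ :=
  ∫ x : ℝ, Complex.exp (ν * x) * ((Real.cosh x ^ k * Real.exp (-(2 * Real.pi * y * Real.cosh x)) : ℝ) : ℂ)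

/-- `2 K_ν(2 π y)`. -/
abbrev besselK (ν : ℂ) (y : ℝ) : ℂ := besselMoment 0 ν y

theorem sq_div_four_le_cosh (x : ℝ) : x ^ 2 / 4 ≤ Real.cosh x := by
  have h := Real.quadratic_le_exp_of_nonneg (abs_nonneg x)
  rw [sq_abs] at h
  have h2 : Real.exp |x| / 2 ≤ Real.cosh |x| := by
    rw [Real.cosh_eq]; have := Real.exp_pos (-|x|); linarith
  rw [Real.cosh_abs] at h2
  have := abs_nonneg x
  linarith

theorem cosh_le_exp_abs (x : ℝ) : Real.cosh x ≤ Real.exp |x| := by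
  rw [← Real.cosh_abs, Real.cosh_eq]
  have : Real.exp (-|x|) ≤ Real.exp |x| := Real.exp_le_exp.2 (by linarith [abs_nonneg x])
  linarith

theorem integrable_exp_abs_mul_exp_cosh (A : ℝ) {y : ℝ} (hy : 0 < y) :
    Integrable fun x : ℝ => Real.exp (A * |x|) * Real.exp (-(y * Real.cosh x)) := by
  have h := (integrable_exp_neg_mul_sq (b := y / 8) (by positivity)).const_mul
    (Real.exp (2 * A ^ 2 / y))
  refine h.mono' (by fun_prop) (Eventually.of_forall fun x => ?_)
  rw [Real.norm_of_nonneg (by positivity), ← Real.exp_add, ← Real.exp_add]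
  apply Real.exp_le_exp.2
  have h1 := mul_le_mul_of_nonneg_left (sq_div_four_le_cosh x) hy.le
  -- Completing the square: half of the Gaussian exponent `y x² / 4` absorbs `A |x|` at the cost of
  -- the constant `2 A² / y`.
  have h2 : 0 ≤ (y * |x| / 4 - A) ^ 2 * (2 / y) := by positivity
  have h3 : (y * |x| / 4 - A) ^ 2 * (2 / y) = y * |x| ^ 2 / 8 - A * |x| + 2 * A ^ 2 / y := by
    field_simp; ring
  rw [h3, sq_abs] at h2
  linarith

theorem norm_besselMoment_integrand_le (k : ℕ) (ν : ℂ) (y x : ℝ) :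
    ‖Complex.exp (ν * x) * ((Real.cosh x ^ k * Real.exp (-(2 * Real.pi * y * Real.cosh x)) : ℝ) : ℂ)‖
      ≤ Real.exp ((|ν.re| + k) * |x|) * Real.exp (-(2 * Real.pi * y * Real.cosh x)) := by
  rw [norm_mul, Complex.norm_real, Complex.norm_exp,
    Real.norm_of_nonneg (by positivity), ← mul_assoc]
  gcongr
  rw [add_mul, Real.exp_add]
  gcongr
  · simp only [Complex.mul_re, Complex.ofReal_re, Complex.ofReal_im, mul_zero, sub_zero]
    rw [← abs_mul]; exact le_abs_self _
  · rw [Real.exp_nat_mul]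
    gcongr
    exact cosh_le_exp_abs x

theorem integrable_besselMoment (k : ℕ) (ν : ℂ) {y : ℝ} (hy : 0 < y) :
    Integrable fun x : ℝ => Complex.exp (ν * x) *
      ((Real.cosh x ^ k * Real.exp (-(2 * Real.pi * y * Real.cosh x)) : ℝ) : ℂ) := by
  refine (integrable_exp_abs_mul_exp_cosh (|ν.re| + k) (y := 2 * Real.pi * y)
    (by positivity)).mono' (by fun_prop) (Eventually.of_forall fun x => ?_)
  exact norm_besselMoment_integrand_le k ν y x

/-- Half of the exponent `2πy cosh x` is at least `πy` because `cosh x ≥ 1` and gives the decay; the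
other half is at least `(π/2) cosh x` and leaves an integrable majorant free of `ν` and `y`. -/
theorem norm_besselMoment_le (k : ℕ) (A : ℝ) : ∃ C : ℝ, 0 ≤ C ∧ ∀ (ν : ℂ) (y : ℝ), |ν.re| ≤ A →
    1 / 2 ≤ y → ‖besselMoment k ν y‖ ≤ C * Real.exp (-(Real.pi * y)) := by
  refine ⟨∫ x : ℝ, Real.exp ((A + k) * |x|) * Real.exp (-(Real.pi / 2 * Real.cosh x)),
    integral_nonneg fun x => by positivity, fun ν y hν hy => ?_⟩
  rw [← integral_mul_const]
  refine norm_integral_le_of_norm_le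
    ((integrable_exp_abs_mul_exp_cosh (A + k) (by positivity)).mul_const _)
    (Eventually.of_forall fun x => (norm_besselMoment_integrand_le k ν y x).trans ?_)
  rw [mul_assoc (Real.exp ((A + k) * |x|)), ← Real.exp_add (-(Real.pi / 2 * Real.cosh x))]
  gcongr
  have := Real.one_le_cosh x
  have hp := Real.pi_pos
  have h1 : Real.pi * y ≤ Real.pi * y * Real.cosh x := le_mul_of_one_le_right (by positivity) this
  have h2 : Real.pi / 2 * Real.cosh x ≤ Real.pi * y * Real.cosh x := by
    apply mul_le_mul_of_nonneg_right _ (by linarith); nlinarith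
  linarith

theorem hasDerivAt_besselMoment (k : ℕ) (ν : ℂ) {y : ℝ} (hy : 0 < y) :
    HasDerivAt (besselMoment k ν) (-(2 * Real.pi) * besselMoment (k + 1) ν y) y := by
  have key := hasDerivAt_integral_of_dominated_loc_of_deriv_le (μ := (volume : Measure ℝ))
    (F := fun (y x : ℝ) => Complex.exp (ν * x) *
      ((Real.cosh x ^ k * Real.exp (-(2 * Real.pi * y * Real.cosh x)) : ℝ) : ℂ))
    (F' := fun (y x : ℝ) => -(2 * Real.pi) * (Complex.exp (ν * x) *
      ((Real.cosh x ^ (k + 1) * Real.exp (-(2 * Real.pi * y * Real.cosh x)) : ℝ) : ℂ)))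
    (s := Set.Ioi (y / 2)) (x₀ := y)
    (bound := fun x => (2 * Real.pi) * (Real.exp ((|ν.re| + (k + 1 : ℕ)) * |x|) *
      Real.exp (-(Real.pi * y * Real.cosh x))))
    (Ioi_mem_nhds (by linarith)) (Eventually.of_forall fun _ => by fun_prop)
    (integrable_besselMoment k ν hy)
    (((integrable_besselMoment (k + 1) ν hy).const_mul _).aestronglyMeasurable)
    (Eventually.of_forall fun x t ht => ?_)
    ((integrable_exp_abs_mul_exp_cosh _ (by positivity)).const_mul _)
    (Eventually.of_forall fun x t ht => ?_)
  · have h := key.2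
    rw [integral_const_mul] at h
    exact h
  · rw [norm_mul]
    have h1 : ‖(-(2 * Real.pi) : ℂ)‖ = 2 * Real.pi := by
      rw [norm_neg, norm_mul, Complex.norm_real, Real.norm_of_nonneg Real.pi_pos.le]; simp
    rw [h1]
    have h2 := norm_besselMoment_integrand_le (k + 1) ν t x
    refine mul_le_mul_of_nonneg_left (h2.trans ?_) (by positivity)
    refine mul_le_mul_of_nonneg_left (Real.exp_le_exp.2 ?_) (Real.exp_pos _).le
    have : y / 2 < t := ht
    nlinarith [mul_pos (Real.pi_pos) (Real.cosh_pos x)]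
  · have h1 : HasDerivAt (fun t : ℝ => Real.cosh x ^ k * Real.exp (-(2 * Real.pi * t * Real.cosh x)))
        (Real.cosh x ^ k * (Real.exp (-(2 * Real.pi * t * Real.cosh x)) *
          (-(2 * Real.pi * Real.cosh x)))) t := by
      refine (HasDerivAt.exp ?_).const_mul _
      have := (((hasDerivAt_id t).const_mul (2 * Real.pi)).mul_const (Real.cosh x)).fun_neg
      simpa using this
    convert! (h1.ofReal_comp).const_mul (Complex.exp (ν * x)) using 1
    push_cast
    ring

theorem conj_besselMoment (k : ℕ) (ν : ℂ) (y : ℝ) :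
    conj (besselMoment k ν y) = besselMoment k (conj ν) y := by
  rw [besselMoment, ← integral_conj, besselMoment]
  congr 1; ext x
  simp only [map_mul, Complex.conj_ofReal, ← Complex.exp_conj]

/-- The modified Bessel equation. -/
theorem besselMoment_two (ν : ℂ) {y : ℝ} (hy : 0 < y) :
    4 * (Real.pi : ℂ) ^ 2 * y ^ 2 * (besselMoment 2 ν y - besselMoment 0 ν y)
      - 2 * Real.pi * y * besselMoment 1 ν y = ν ^ 2 * besselMoment 0 ν y := by
  set e : ℝ → ℝ := fun x => Real.exp (-(2 * Real.pi * y * Real.cosh x)) with he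
  have hi := fun k => integrable_besselMoment k ν hy
  have hde : ∀ x, HasDerivAt e (-(2 * Real.pi * y) * Real.sinh x * e x) x := fun x => by
    have h1 := (((Real.hasDerivAt_cosh x).const_mul (2 * Real.pi * y)).fun_neg).exp
    convert! h1 using 1
    simp only [he]; ring
  have hde2 : ∀ x, HasDerivAt (fun x => -(2 * Real.pi * y) * Real.sinh x * e x)
      (-(2 * Real.pi * y) * Real.cosh x * e x +
        (2 * Real.pi * y) ^ 2 * (Real.cosh x ^ 2 - 1) * e x) x := fun x => by
    have h1 := ((Real.hasDerivAt_sinh x).const_mul (-(2 * Real.pi * y))).mul (hde x)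
    convert! h1 using 1
    rw [← Real.cosh_sq' x |> fun h => (by rw [h]; ring : Real.sinh x ^ 2 = Real.cosh x ^ 2 - 1)]
    ring
  have hexp : ∀ x : ℝ, HasDerivAt (fun x : ℝ => Complex.exp (ν * x)) (ν * Complex.exp (ν * x)) x := by
    intro x
    have h1 : HasDerivAt (fun x : ℝ => ν * (x : ℂ)) (ν * 1) x :=
      ((hasDerivAt_id x).ofReal_comp).const_mul ν
    convert! h1.cexp using 1; ring
  -- integrability of `exp(νx) sinh x e(x)`
  have hs : Integrable fun x : ℝ => Complex.exp (ν * x) * ((-(2 * Real.pi * y) * Real.sinh x * e x : ℝ) : ℂ) := by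
    refine ((hi 1).norm.const_mul (2 * Real.pi * y)).mono' ?_ (Eventually.of_forall fun x => ?_)
    · simp only [he]; fun_prop
    · have hsc : |Real.sinh x| ≤ Real.cosh x :=
        abs_le_of_sq_le_sq (by nlinarith [Real.cosh_sq x]) (Real.cosh_pos x).le
      rw [norm_mul, norm_mul, Complex.norm_real, Complex.norm_real, Real.norm_eq_abs,
        Real.norm_eq_abs, abs_mul, abs_mul, abs_neg, abs_of_pos (Real.exp_pos _),
        abs_of_pos (show 0 < 2 * Real.pi * y by positivity), pow_one, abs_mul,
        abs_of_pos (Real.cosh_pos x), abs_of_pos (Real.exp_pos _)]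
      calc _ = (‖Complex.exp (ν * x)‖ * (2 * Real.pi * y) * e x) * |Real.sinh x| := by
            simp only [he]; ring
        _ ≤ (‖Complex.exp (ν * x)‖ * (2 * Real.pi * y) * e x) * Real.cosh x := by gcongr
        _ = _ := by simp only [he]; ring
  have h0 : Integrable fun x : ℝ => Complex.exp (ν * x) * ((e x : ℝ) : ℂ) := by
    simpa [he] using hi 0
  have h2 : Integrable fun x : ℝ => Complex.exp (ν * x) * (((-(2 * Real.pi * y) * Real.cosh x * e x +
        (2 * Real.pi * y) ^ 2 * (Real.cosh x ^ 2 - 1) * e x) : ℝ) : ℂ) := by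
    have := (((hi 2).sub (hi 0)).const_mul ((2 * Real.pi * y : ℝ) ^ 2 : ℂ)).sub
      ((hi 1).const_mul (2 * Real.pi * y : ℝ))
    refine this.congr (Eventually.of_forall fun x => ?_)
    simp only [he, Pi.sub_apply]; push_cast; ring
  -- With `e(x) = exp(-2πy cosh x)` one has `e'' = ((2πy)² sinh² x - 2πy cosh x) e`. Integrating
  -- `exp(νx) e''` by parts twice produces the factor `ν²`, and `sinh² = cosh² - 1` expresses the
  -- left side through the moments.
  have p1 := integral_mul_deriv_eq_deriv_mul_of_integrable
    (u := fun x : ℝ => Complex.exp (ν * x)) (u' := fun x : ℝ => ν * Complex.exp (ν * x))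
    (v := fun x : ℝ => ((-(2 * Real.pi * y) * Real.sinh x * e x : ℝ) : ℂ))
    (v' := fun x : ℝ => (((-(2 * Real.pi * y) * Real.cosh x * e x +
        (2 * Real.pi * y) ^ 2 * (Real.cosh x ^ 2 - 1) * e x) : ℝ) : ℂ))
    (fun x _ => hexp x) (fun x _ => (hde2 x).ofReal_comp) h2
    ((hs.const_mul ν).congr (Eventually.of_forall fun x => by simp [mul_assoc])) hs
  have p2 := integral_mul_deriv_eq_deriv_mul_of_integrable
    (u := fun x : ℝ => Complex.exp (ν * x)) (u' := fun x : ℝ => ν * Complex.exp (ν * x))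
    (v := fun x : ℝ => ((e x : ℝ) : ℂ))
    (v' := fun x : ℝ => ((-(2 * Real.pi * y) * Real.sinh x * e x : ℝ) : ℂ))
    (fun x _ => hexp x) (fun x _ => (hde x).ofReal_comp) hs
    ((h0.const_mul ν).congr (Eventually.of_forall fun x => by simp [mul_assoc])) h0
  simp only [mul_assoc ν] at p1 p2
  rw [integral_const_mul] at p1 p2
  rw [p2] at p1
  have q0 : besselMoment 0 ν y = ∫ x : ℝ, Complex.exp (ν * x) * ((e x : ℝ) : ℂ) := by
    simp [besselMoment, he]
  have q : ∫ x : ℝ, Complex.exp (ν * x) * (((-(2 * Real.pi * y) * Real.cosh x * e x +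
        (2 * Real.pi * y) ^ 2 * (Real.cosh x ^ 2 - 1) * e x) : ℝ) : ℂ) =
      (2 * Real.pi * y : ℝ) ^ 2 * (besselMoment 2 ν y - besselMoment 0 ν y)
        - (2 * Real.pi * y : ℝ) * besselMoment 1 ν y := by
    simp only [besselMoment]
    rw [← integral_sub (hi 2) (hi 0), ← integral_const_mul, ← integral_const_mul,
      ← integral_sub]
    rotate_left
    · exact ((hi 2).sub (hi 0)).const_mul _
    · exact (hi 1).const_mul _
    congr 1; ext x
    simp only [he]; push_cast; ring
  rw [q, ← q0] at p1
  push_cast at p1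
  linear_combination p1

/-- Substitution `t = exp x`, under which `t + 1/t = 2 cosh x`. -/
theorem maassWhittaker_eq (s : ℂ) (y : ℝ) : maassWhittaker s y =
    (Real.pi : ℂ) ^ s / Complex.Gamma s * ((Real.sqrt y : ℂ) * besselK (s - 1 / 2) y) := by
  rw [maassWhittaker, mul_assoc]
  congr 2
  have h := integral_image_eq_integral_abs_deriv_smul (MeasurableSet.univ (α := ℝ))
    (fun x _ => (Real.hasDerivAt_exp x).hasDerivWithinAt) (Real.exp_injective.injOn)
    (fun t : ℝ => (t : ℂ) ^ (s - 1 / 2) * (Real.exp (-(t + 1 / t) * Real.pi * y) : ℂ) / (t : ℂ))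
  rw [Set.image_univ, Real.range_exp] at h
  rw [h, setIntegral_univ]
  unfold besselK besselMoment
  congr 1; ext x
  have hx : (Real.exp x : ℂ) ≠ 0 := by exact_mod_cast (Real.exp_pos x).ne'
  rw [abs_of_pos (Real.exp_pos x), Complex.real_smul, Complex.cpow_def_of_ne_zero hx,
    ← Complex.ofReal_log (Real.exp_pos x).le, Real.log_exp, pow_zero, one_mul,
    mul_div_cancel₀ _ hx]
  rw [mul_comm (x : ℂ)]
  congr 3
  rw [Real.cosh_eq, Real.exp_neg]; ring

/-! ### Integrals depending holomorphically on a parameter -/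

/-- Cauchy's estimate on unit circles turns a locally uniform bound for `F` into the same bound for
its derivative, so dominated differentiation needs no separate estimate of the derivative. -/
theorem hasDerivAt_integral_of_differentiable {α : Type*} [MeasurableSpace α] {μ : Measure α}
    {F : ℂ → α → ℂ} (hd : ∀ a, Differentiable ℂ fun w => F w a)
    (hm : ∀ w, AEStronglyMeasurable (F w) μ)
    (hb : ∀ R : ℝ, ∃ g : α → ℝ, Integrable g μ ∧ ∀ᵐ a ∂μ, ∀ w : ℂ, ‖w‖ ≤ R → ‖F w a‖ ≤ g a)
    (w : ℂ) :
    Integrable (fun a => deriv (fun w => F w a) w) μ ∧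
    HasDerivAt (fun w => ∫ a, F w a ∂μ) (∫ a, deriv (fun w => F w a) w ∂μ) w := by
  -- The radius covers a unit circle around any point of the unit ball about `w`.
  obtain ⟨g, hg, hbd⟩ := hb (‖w‖ + 2)
  refine hasDerivAt_integral_of_dominated_loc_of_deriv_le (bound := g)
    (Metric.ball_mem_nhds w one_pos) (Eventually.of_forall hm) ?_ ?_ ?_ hg
    (Eventually.of_forall fun a x _ => (hd a x).hasDerivAt)
  · refine hg.mono' (hm w) ?_
    filter_upwards [hbd] with a ha using ha w (by linarith)
  -- The derivative is measurable as a pointwise limit of the difference quotients with increments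
  -- `1/(n+1)`.
  · refine aestronglyMeasurable_of_tendsto_ae (atTop : Filter ℕ)
      (f := fun n a => ((1 / ((n : ℂ) + 1))⁻¹ : ℂ) • (F (w + 1 / ((n : ℂ) + 1)) a - F w a))
      (fun n => ((hm _).sub (hm w)).const_smul ((1 / ((n : ℂ) + 1))⁻¹ : ℂ)) (Eventually.of_forall fun a => ?_)
    have h1 := (hd a w).hasDerivAt.tendsto_slope_zero
    have h2 : Tendsto (fun n : ℕ => (1 / ((n : ℂ) + 1))) atTop (𝓝[≠] 0) := by
      rw [tendsto_nhdsWithin_iff]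
      refine ⟨tendsto_one_div_add_atTop_nhds_zero_nat, Eventually.of_forall fun n => ?_⟩
      simp only [Set.mem_compl_iff, Set.mem_singleton_iff]
      exact one_div_ne_zero (Nat.cast_add_one_ne_zero n)
    exact h1.comp h2
  · filter_upwards [hbd] with a ha x hx
    have := Complex.norm_deriv_le_of_forall_mem_sphere_norm_le (c := x) (R := 1) (C := g a)
      (f := fun w => F w a) one_pos (hd a).diffContOnCl fun z hz => ha z ?_
    · simpa using this
    · have h1 : ‖z - x‖ = 1 := by simpa using hz
      have h2 : ‖x - w‖ < 1 := by simpa [dist_eq_norm] using hx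
      calc ‖z‖ = ‖(z - x) + (x - w) + w‖ := by congr 1; ring
        _ ≤ ‖z - x‖ + ‖x - w‖ + ‖w‖ := norm_add₃_le
        _ ≤ _ := by linarith

theorem differentiable_integral_of_differentiable {α : Type*} [MeasurableSpace α] {μ : Measure α}
    {F : ℂ → α → ℂ} (hd : ∀ a, Differentiable ℂ fun w => F w a)
    (hm : ∀ w, AEStronglyMeasurable (F w) μ)
    (hb : ∀ R : ℝ, ∃ g : α → ℝ, Integrable g μ ∧ ∀ᵐ a ∂μ, ∀ w : ℂ, ‖w‖ ≤ R → ‖F w a‖ ≤ g a) :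
    Differentiable ℂ fun w => ∫ a, F w a ∂μ :=
  fun w => (hasDerivAt_integral_of_differentiable hd hm hb w).2.differentiableAt

theorem differentiable_besselK {y : ℝ} (hy : 0 < y) : Differentiable ℂ fun ν => besselK ν y := by
  refine differentiable_integral_of_differentiable (fun a => by fun_prop)
    (fun w => (integrable_besselMoment 0 w hy).aestronglyMeasurable) fun R => ?_
  refine ⟨_, integrable_exp_abs_mul_exp_cosh (R + (0 : ℕ)) (y := 2 * Real.pi * y) (by positivity),
    Eventually.of_forall fun x w hw => (norm_besselMoment_integrand_le 0 w y x).trans ?_⟩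
  gcongr
  exact (Complex.abs_re_le_norm w).trans hw

/-! ### The Mellin transform of a product of two Bessel functions -/

/-- The substitution `u = exp x / (2 cosh x)`, with `1 - u = exp(-x) / (2 cosh x)`, turns the
integral into half the beta integral at `(w + c)/2` and `(w - c)/2`. This `u` is the sigmoid of
`2x`. -/
theorem integral_exp_mul_two_cosh_cpow {c w : ℂ} (h1 : 0 < (w + c).re) (h2 : 0 < (w - c).re) :
    Integrable (fun x : ℝ => Complex.exp (c * x) * ((2 * Real.cosh x : ℝ) : ℂ) ^ (-w)) ∧
    ∫ x : ℝ, Complex.exp (c * x) * ((2 * Real.cosh x : ℝ) : ℂ) ^ (-w) =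
      1 / 2 * (Complex.Gamma ((w + c) / 2) * Complex.Gamma ((w - c) / 2) / Complex.Gamma w) := by
  set F : ℝ → ℂ := fun u => (u : ℂ) ^ ((w + c) / 2 - 1) * (1 - (u : ℂ)) ^ ((w - c) / 2 - 1) with hF
  set σ : ℝ → ℝ := fun x => Real.sigmoid (2 * x) with hσ
  have hd : ∀ x ∈ Set.univ, HasDerivWithinAt σ (2 * (σ x * (1 - σ x))) Set.univ x := fun x _ => by
    have h := (Real.hasDerivAt_sigmoid (2 * x)).comp x ((hasDerivAt_id x).const_mul 2)
    exact (h.congr_deriv (by simp [hσ]; ring)).hasDerivWithinAt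
  have hinj : Set.InjOn σ Set.univ := by
    intro a _ b _ hab
    have := Real.sigmoid_injective hab
    linarith
  have himg : σ '' Set.univ = Set.Ioo 0 1 := by
    rw [← Real.range_sigmoid, Set.image_univ]
    exact (mul_left_surjective₀ (two_ne_zero' ℝ)).range_comp Real.sigmoid
  have hpt : ∀ x : ℝ, |2 * (σ x * (1 - σ x))| • F (σ x) =
      2 * (Complex.exp (c * x) * ((2 * Real.cosh x : ℝ) : ℂ) ^ (-w)) := by
    intro x
    have hs0 : 0 < σ x := Real.sigmoid_pos _
    have hs1 : 0 < 1 - σ x := sub_pos.2 (Real.sigmoid_lt_one _)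
    have hc : 0 < 2 * Real.cosh x := by positivity [Real.cosh_pos x]
    have e1 : σ x = Real.exp x / (2 * Real.cosh x) := by
      simp only [hσ, Real.sigmoid_def]
      rw [Real.cosh_eq, show -(2 * x) = -x + -x by ring, Real.exp_add, Real.exp_neg]
      have := Real.exp_pos x
      field_simp
    have e2 : 1 - σ x = Real.exp (-x) / (2 * Real.cosh x) := by
      rw [e1, Real.cosh_eq]
      have := Real.exp_pos x
      have := Real.exp_pos (-x)
      field_simp; ring
    have l1 : Real.log (σ x) = x - Real.log (2 * Real.cosh x) := by
      rw [e1, Real.log_div (Real.exp_pos _).ne' hc.ne', Real.log_exp]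
    have l2 : Real.log (1 - σ x) = -x - Real.log (2 * Real.cosh x) := by
      rw [e2, Real.log_div (Real.exp_pos _).ne' hc.ne', Real.log_exp]
    have n1 : ((σ x : ℝ) : ℂ) ≠ 0 := by exact_mod_cast hs0.ne'
    have n2 : (((1 - σ x : ℝ)) : ℂ) ≠ 0 := by exact_mod_cast hs1.ne'
    have n3 : ((2 * Real.cosh x : ℝ) : ℂ) ≠ 0 := by exact_mod_cast hc.ne'
    rw [abs_of_pos (by positivity), Complex.real_smul, hF]
    simp only
    rw [← Complex.ofReal_one, ← Complex.ofReal_sub, Complex.cpow_sub _ _ n1, Complex.cpow_sub _ _ n2,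
      Complex.ofReal_one, Complex.cpow_one, Complex.cpow_one, Complex.ofReal_mul, Complex.ofReal_mul]
    have : ∀ A B : ℂ, ((2 : ℝ) : ℂ) * ((σ x : ℂ) * ((1 - σ x : ℝ) : ℂ)) *
        (A / (σ x : ℂ) * (B / ((1 - σ x : ℝ) : ℂ))) = 2 * (A * B) := by
      intro A B; field_simp; push_cast; ring
    rw [this, Complex.cpow_def_of_ne_zero n1, Complex.cpow_def_of_ne_zero n2,
      Complex.cpow_def_of_ne_zero n3, ← Complex.ofReal_log hs0.le, ← Complex.ofReal_log hs1.le,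
      ← Complex.ofReal_log hc.le, l1, l2, ← Complex.exp_add, ← Complex.exp_add]
    congr 2
    push_cast; ring
  have hu : 0 < ((w + c) / 2).re := by
    rw [show (w + c) / 2 = (w + c) / (2 : ℝ) by push_cast; rfl, Complex.div_ofReal_re]; linarith
  have hv : 0 < ((w - c) / 2).re := by
    rw [show (w - c) / 2 = (w - c) / (2 : ℝ) by push_cast; rfl, Complex.div_ofReal_re]; linarith
  have hint := Complex.betaIntegral_convergent hu hv
  rw [intervalIntegrable_iff_integrableOn_Ioo_of_le zero_le_one] at hint
  constructor
  · rw [← himg, integrableOn_image_iff_integrableOn_abs_deriv_smul MeasurableSet.univ hd hinj,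
      integrableOn_univ] at hint
    have := (hint.congr (Eventually.of_forall hpt)).const_mul (1 / 2)
    refine this.congr (Eventually.of_forall fun x => ?_)
    simp only; ring
  · have h := Complex.Gamma_mul_Gamma_eq_betaIntegral hu hv
    rw [show (w + c) / 2 + (w - c) / 2 = w by ring] at h
    have hw : Complex.Gamma w ≠ 0 := Complex.Gamma_ne_zero_of_re_pos (by
      rw [Complex.add_re] at h1; rw [Complex.sub_re] at h2; linarith)
    rw [h, mul_div_cancel_left₀ _ hw, Complex.betaIntegral,
      intervalIntegral.integral_of_le zero_le_one, ← integral_Ioc_eq_integral_Ioo.symm, ← himg]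
    have := integral_image_eq_integral_abs_deriv_smul MeasurableSet.univ hd hinj F
    rw [this, setIntegral_univ, integral_congr_ae (Eventually.of_forall hpt), integral_const_mul]
    ring

theorem integral_Ioi_cpow_mul_exp {w : ℂ} (hw : 0 < w.re) {r : ℝ} (hr : 0 < r) :
    IntegrableOn (fun t : ℝ => (t : ℂ) ^ (w - 1) * (Real.exp (-(t * r)) : ℂ)) (Set.Ioi 0) ∧
    ∫ t in Set.Ioi (0 : ℝ), (t : ℂ) ^ (w - 1) * (Real.exp (-(t * r)) : ℂ) =
      Complex.Gamma w * (r : ℂ) ^ (-w) := by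
  have h := Complex.integral_cpow_mul_exp_neg_mul_Ioi hw hr
  have e : ∀ t : ℝ, (t : ℂ) ^ (w - 1) * (Real.exp (-(t * r)) : ℂ) =
      (t : ℂ) ^ (w - 1) * Complex.exp (-(r * t)) := fun t => by push_cast; ring_nf
  simp only [e]
  constructor
  -- A non-integrable function has Bochner integral `0`, while the known value of the integral is
  -- non-zero; so the value itself proves integrability.
  · by_contra hc
    rw [integral_undef hc] at h
    have hr' : (1 / (r : ℂ)) ≠ 0 := one_div_ne_zero (by exact_mod_cast hr.ne')
    exact mul_ne_zero ((Complex.cpow_ne_zero_iff_of_exponent_ne_zero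
      (fun h0 => by simp [h0] at hw)).2 hr') (Complex.Gamma_ne_zero_of_re_pos hw) h.symm
  · rw [h, one_div, Complex.inv_cpow, Complex.cpow_neg]
    · ring
    · rw [Complex.arg_ofReal_of_nonneg hr.le]; exact Real.pi_pos.ne

/-- The change of variables `(P, Q) ↦ (P + Q, P - Q)`. -/
def addSubEquiv : (ℝ × ℝ) ≃ₗ[ℝ] (ℝ × ℝ) where
  toFun p := (p.1 + p.2, p.1 - p.2)
  invFun p := ((p.1 + p.2) / 2, (p.1 - p.2) / 2)
  map_add' p q := by ext <;> simp <;> ring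
  map_smul' c p := by ext <;> simp [mul_add, mul_sub]
  left_inv p := by ext <;> simp
  right_inv p := by ext <;> simp <;> ring

theorem map_addSubEquiv_volume :
    Measure.map addSubEquiv (volume : Measure (ℝ × ℝ)) = ENNReal.ofReal (1 / 2) • volume := by
  have hdet : LinearMap.det (addSubEquiv : (ℝ × ℝ) →ₗ[ℝ] (ℝ × ℝ)) = -2 := by
    rw [← LinearMap.det_toMatrix (Module.Basis.finTwoProd ℝ), Matrix.det_fin_two]
    simp [LinearMap.toMatrix_apply, addSubEquiv]
    norm_num
  have h := Measure.map_linearMap_addHaar_eq_smul_addHaar (volume : Measure (ℝ × ℝ))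
    (f := (addSubEquiv : (ℝ × ℝ) →ₗ[ℝ] (ℝ × ℝ))) (by rw [hdet]; norm_num)
  rw [hdet] at h
  convert! h using 2
  norm_num

theorem measurableEmbedding_addSubEquiv : MeasurableEmbedding addSubEquiv :=
  addSubEquiv.toContinuousLinearEquiv.toHomeomorph.measurableEmbedding

theorem integrable_comp_addSubEquiv_iff {F : ℝ × ℝ → ℂ} :
    Integrable (fun p => F (addSubEquiv p)) ↔ Integrable F := by
  have h := measurableEmbedding_addSubEquiv.integrable_map_iff (μ := volume) (g := F)
  rw [map_addSubEquiv_volume, integrable_smul_measure (by simp) (by simp)] at h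
  exact h.symm

theorem integral_comp_addSubEquiv (F : ℝ × ℝ → ℂ) :
    ∫ p, F p = 2 * ∫ p, F (addSubEquiv p) := by
  have h := measurableEmbedding_addSubEquiv.integral_map (μ := volume) F
  rw [map_addSubEquiv_volume, integral_smul_measure, ENNReal.toReal_ofReal (by norm_num),
    Complex.real_smul] at h
  rw [← h]; push_cast; ring

/-- In the triple integral over `(y, x, x')` the `y`-integration gives `Γ(w) (2π (cosh x + cosh
x'))^(-w)`. In the coordinates `x = P + Q`, `x' = P - Q` one has `cosh x + cosh x' = 2 cosh P cosh
Q`, so the remaining double integral splits into two integrals of beta type. Fubini is justified by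
running the same computation on absolute values. -/
theorem mellin_besselK_mul_besselK {a b w : ℂ} (hw : |a.re| + |b.re| < w.re) :
    IntegrableOn (fun y : ℝ => (y : ℂ) ^ (w - 1) * (besselK a y * besselK b y)) (Set.Ioi 0) ∧
    ∫ y in Set.Ioi (0 : ℝ), (y : ℂ) ^ (w - 1) * (besselK a y * besselK b y) =
      (Real.pi : ℂ) ^ (-w) / 2 * (Complex.Gamma ((w + (a + b)) / 2) *
        Complex.Gamma ((w - (a + b)) / 2) * Complex.Gamma ((w + (a - b)) / 2) *
        Complex.Gamma ((w - (a - b)) / 2) / Complex.Gamma w) := by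
  have ha := abs_le.1 (le_refl |a.re|)
  have hb := abs_le.1 (le_refl |b.re|)
  have hw0 : 0 < w.re := by linarith [abs_nonneg a.re, abs_nonneg b.re]
  have hΓ : Complex.Gamma w ≠ 0 := Complex.Gamma_ne_zero_of_re_pos hw0
  obtain ⟨i1, v1⟩ := integral_exp_mul_two_cosh_cpow (w := w) (c := a + b)
    (by simp only [Complex.add_re]; linarith) (by simp only [Complex.add_re, Complex.sub_re]; linarith)
  obtain ⟨i2, v2⟩ := integral_exp_mul_two_cosh_cpow (w := w) (c := a - b)
    (by simp only [Complex.add_re, Complex.sub_re]; linarith) (by simp only [Complex.sub_re]; linarith)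
  -- the function of `(x, x')` obtained by integrating over `y`
  set G : ℝ × ℝ → ℂ := fun p => Complex.exp (a * p.1 + b * p.2) *
    ((2 * Real.pi * (Real.cosh p.1 + Real.cosh p.2) : ℝ) : ℂ) ^ (-w) with hG
  have hGL : ∀ p : ℝ × ℝ, G (addSubEquiv p) = (Real.pi : ℂ) ^ (-w) *
      ((Complex.exp ((a + b) * p.1) * ((2 * Real.cosh p.1 : ℝ) : ℂ) ^ (-w)) *
       (Complex.exp ((a - b) * p.2) * ((2 * Real.cosh p.2 : ℝ) : ℂ) ^ (-w))) := by
    intro p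
    have e : 2 * Real.pi * (Real.cosh (p.1 + p.2) + Real.cosh (p.1 - p.2)) =
        Real.pi * ((2 * Real.cosh p.1) * (2 * Real.cosh p.2)) := by
      rw [Real.cosh_add, Real.cosh_sub]; ring
    have c1 := Real.cosh_pos p.1
    have c2 := Real.cosh_pos p.2
    simp only [hG, addSubEquiv, LinearEquiv.coe_mk, LinearMap.coe_mk, AddHom.coe_mk]
    rw [e, Complex.ofReal_mul, Complex.mul_cpow_ofReal_nonneg Real.pi_pos.le (by positivity),
      Complex.ofReal_mul (2 * Real.cosh p.1),
      Complex.mul_cpow_ofReal_nonneg (by positivity) (by positivity)]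
    have : Complex.exp (a * ((p.1 + p.2 : ℝ) : ℂ) + b * ((p.1 - p.2 : ℝ) : ℂ)) =
        Complex.exp ((a + b) * p.1) * Complex.exp ((a - b) * p.2) := by
      rw [← Complex.exp_add]; congr 1; push_cast; ring
    rw [this]; ring
  have hGi : Integrable G := by
    rw [← integrable_comp_addSubEquiv_iff]
    exact ((i1.mul_prod i2).const_mul _).congr (Eventually.of_forall fun p => (hGL p).symm)
  have hGv : ∫ p, G p = 2 * ((Real.pi : ℂ) ^ (-w) *
      ((1 / 2 * (Complex.Gamma ((w + (a + b)) / 2) * Complex.Gamma ((w - (a + b)) / 2) /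
        Complex.Gamma w)) * (1 / 2 * (Complex.Gamma ((w + (a - b)) / 2) *
        Complex.Gamma ((w - (a - b)) / 2) / Complex.Gamma w)))) := by
    rw [integral_comp_addSubEquiv, integral_congr_ae (Eventually.of_forall hGL),
      integral_const_mul, ← v1, ← v2]
    congr 2
    exact integral_prod_mul (fun x : ℝ => Complex.exp ((a + b) * x) * ((2 * Real.cosh x : ℝ) : ℂ) ^ (-w))
      (fun x : ℝ => Complex.exp ((a - b) * x) * ((2 * Real.cosh x : ℝ) : ℂ) ^ (-w))
  -- the function of three variables
  set Φ : ℝ × (ℝ × ℝ) → ℂ := fun q => (q.1 : ℂ) ^ (w - 1) * (Complex.exp (a * q.2.1 + b * q.2.2) *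
    (Real.exp (-(q.1 * (2 * Real.pi * (Real.cosh q.2.1 + Real.cosh q.2.2)))) : ℂ)) with hΦ
  have hr : ∀ p : ℝ × ℝ, 0 < 2 * Real.pi * (Real.cosh p.1 + Real.cosh p.2) := fun p => by
    have c1 := Real.cosh_pos p.1
    have c2 := Real.cosh_pos p.2
    positivity
  have hΦm : AEStronglyMeasurable Φ ((volume.restrict (Set.Ioi 0)).prod volume) := by
    apply Measurable.aestronglyMeasurable
    simp only [hΦ]
    fun_prop
  have hΦ1 : ∀ p : ℝ × ℝ, IntegrableOn (fun y => Φ (y, p)) (Set.Ioi 0) ∧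
      ∫ y in Set.Ioi (0 : ℝ), Φ (y, p) = Complex.Gamma w * G p := by
    intro p
    obtain ⟨h1, h2⟩ := integral_Ioi_cpow_mul_exp hw0 (hr p)
    have e : ∀ y : ℝ, Φ (y, p) = Complex.exp (a * p.1 + b * p.2) * ((y : ℂ) ^ (w - 1) *
      (Real.exp (-(y * (2 * Real.pi * (Real.cosh p.1 + Real.cosh p.2)))) : ℂ)) := fun y => by
      simp only [hΦ]; ring
    simp only [e]
    refine ⟨h1.const_mul _, ?_⟩
    rw [integral_const_mul, h2]; simp only [hG]; ring
  have hΦn : ∀ p : ℝ × ℝ, ∫ y in Set.Ioi (0 : ℝ), ‖Φ (y, p)‖ = Real.Gamma w.re * ‖G p‖ := by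
    intro p
    have h2 := (integral_Ioi_cpow_mul_exp (w := (w.re : ℂ)) (by simpa using hw0) (hr p)).2
    have e : ∀ y ∈ Set.Ioi (0 : ℝ), ‖Φ (y, p)‖ = Real.exp (a * p.1 + b * p.2).re *
      (y ^ (w.re - 1) * Real.exp (-(y * (2 * Real.pi * (Real.cosh p.1 + Real.cosh p.2))))) := by
      intro y hy
      simp only [hΦ, norm_mul, Complex.norm_exp, Complex.norm_real,
        Complex.norm_cpow_eq_rpow_re_of_pos hy, Complex.sub_re, Complex.one_re,
        Real.norm_of_nonneg (Real.exp_pos _).le]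
      ring
    rw [setIntegral_congr_fun measurableSet_Ioi e, integral_const_mul]
    have h3 : ((∫ y in Set.Ioi (0 : ℝ), y ^ (w.re - 1) *
        Real.exp (-(y * (2 * Real.pi * (Real.cosh p.1 + Real.cosh p.2)))) : ℝ) : ℂ) =
        ((Real.Gamma w.re * (2 * Real.pi * (Real.cosh p.1 + Real.cosh p.2)) ^ (-w.re) : ℝ) : ℂ) := by
      rw [Complex.ofReal_mul, Complex.ofReal_cpow (hr p).le, ← Complex.Gamma_ofReal, Complex.ofReal_neg,
        ← h2, ← integral_complex_ofReal]
      refine setIntegral_congr_fun measurableSet_Ioi fun y hy => ?_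
      rw [Complex.ofReal_mul, Complex.ofReal_cpow (le_of_lt hy)]; simp
    rw [Complex.ofReal_injective h3]
    simp only [hG, norm_mul, Complex.norm_exp, Complex.norm_cpow_eq_rpow_re_of_pos (hr p),
      Complex.neg_re]
    ring
  have hΦi : Integrable Φ ((volume.restrict (Set.Ioi 0)).prod volume) := by
    rw [integrable_prod_iff' hΦm]
    refine ⟨Eventually.of_forall fun p => (hΦ1 p).1, ?_⟩
    exact (hGi.norm.const_mul _).congr (Eventually.of_forall fun p => (hΦn p).symm)
  have hK : ∀ y ∈ Set.Ioi (0 : ℝ), ∫ p, Φ (y, p) = (y : ℂ) ^ (w - 1) * (besselK a y * besselK b y) := by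
    intro y hy
    simp only [hΦ]
    rw [integral_const_mul]
    congr 1
    unfold besselK besselMoment
    rw [← integral_prod_mul]
    congr 1; ext p
    rw [Complex.exp_add]
    have : Real.exp (-(y * (2 * Real.pi * (Real.cosh p.1 + Real.cosh p.2)))) =
        Real.exp (-(2 * Real.pi * y * Real.cosh p.1)) * Real.exp (-(2 * Real.pi * y * Real.cosh p.2)) := by
      rw [← Real.exp_add]; congr 1; ring
    rw [this]
    push_cast
    ring
  constructor
  · exact (IntegrableOn.congr_fun hΦi.integral_prod_left hK measurableSet_Ioi)
  · rw [← setIntegral_congr_fun measurableSet_Ioi hK, integral_integral_swap hΦi]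
    simp only [(hΦ1 _).2]
    rw [integral_const_mul, hGv]
    field_simp

/-- Otherwise the Mellin transform of the square of the Bessel function would vanish, but at a large
real `w` it is a quotient of non-zero Gamma values. -/
theorem exists_besselK_ne_zero (ν : ℂ) : ∃ y : ℝ, 0 < y ∧ besselK ν y ≠ 0 := by
  by_contra! hc
  set w : ℂ := ((2 * |ν.re| + 1 : ℝ) : ℂ) with hw
  have hre : w.re = 2 * |ν.re| + 1 := Complex.ofReal_re _
  have h := (mellin_besselK_mul_besselK (a := ν) (b := ν) (w := w) (by rw [hre]; linarith)).2
  rw [setIntegral_congr_fun (g := 0) measurableSet_Ioi (fun y hy => by simp [hc y hy])] at h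
  have ha := abs_le.1 (le_refl |ν.re|)
  have hd : ∀ z : ℂ, 0 < z.re → Complex.Gamma (z / 2) ≠ 0 := fun z hz =>
    Complex.Gamma_ne_zero_of_re_pos (by
      rw [show z / 2 = z / (2 : ℝ) by push_cast; rfl, Complex.div_ofReal_re]; linarith)
  have hp : (Real.pi : ℂ) ^ (-w) ≠ 0 := by
    simp [Complex.cpow_eq_zero_iff, Real.pi_ne_zero]
  simp only [Pi.zero_apply, integral_zero] at h
  refine absurd h.symm (mul_ne_zero (div_ne_zero hp two_ne_zero)
    (div_ne_zero (mul_ne_zero (mul_ne_zero (mul_ne_zero (hd _ ?_) (hd _ ?_)) (hd _ ?_)) (hd _ ?_))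
      (Complex.Gamma_ne_zero_of_re_pos ?_))) <;>
  simp only [Complex.add_re, Complex.sub_re, hre] <;> linarith

/-! ### Second order linear differential equations on a half-line -/

/-- `g` is convex. A positive slope anywhere would force linear growth, against integrability of `g
/ y²`; so `g` is non-increasing. Then `(g' + k g) exp(-ky)` is non-decreasing, since its derivative
is `(g'' - k² g) exp(-ky)`, and is bounded above by a quantity tending to zero. Hence `g' ≤ -k g`.
-/
theorem le_exp_of_convex {g g' g'' : ℝ → ℝ} {y₀ k : ℝ} (hy₀ : 0 < y₀) (hk : 0 < k)
    (hg : ∀ y, y₀ ≤ y → HasDerivAt g (g' y) y) (hg' : ∀ y, y₀ ≤ y → HasDerivAt g' (g'' y) y)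
    (h0 : ∀ y, 0 ≤ g y) (h2 : ∀ y, y₀ ≤ y → k ^ 2 * g y ≤ g'' y)
    (hint : IntegrableOn (fun y => g y / y ^ 2) (Set.Ioi y₀)) {y : ℝ} (hy : y₀ ≤ y) :
    g y ≤ g y₀ * Real.exp (-(k * (y - y₀))) := by
  have hmono : MonotoneOn g' (Set.Ici y₀) :=
    monotoneOn_of_hasDerivWithinAt_nonneg (convex_Ici y₀)
      (fun y hy => (hg' y hy).continuousAt.continuousWithinAt)
      (fun y hy => (hg' y (interior_subset hy)).hasDerivWithinAt)
      (fun y hy => (mul_nonneg (sq_nonneg k) (h0 y)).trans (h2 y (interior_subset hy)))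
  have step1 : ∀ y, y₀ ≤ y → g' y ≤ 0 := by
    intro y₂ hy₂
    by_contra! hc
    have hy₂0 : 0 < y₂ := hy₀.trans_le hy₂
    have hgrow : ∀ y, y₂ ≤ y → g' y₂ * (y - y₂) ≤ g y := by
      intro y hy
      have hm : MonotoneOn (fun y => g y - g' y₂ * (y - y₂)) (Set.Ici y₂) := by
        refine monotoneOn_of_hasDerivWithinAt_nonneg (f' := fun y => g' y - g' y₂) (convex_Ici y₂)
          (fun y hy => ?_) (fun y hy => ?_) (fun y hy => ?_)
        · exact ((hg y (hy₂.trans hy)).continuousAt.sub (by fun_prop)).continuousWithinAt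
        · have h1 := (hg y (hy₂.trans (interior_subset hy))).sub
            (((hasDerivAt_id y).sub_const y₂).const_mul (g' y₂))
          exact (h1.congr_deriv (by simp)).hasDerivWithinAt
        · exact sub_nonneg.2 (hmono (Set.mem_Ici.2 hy₂)
            (Set.mem_Ici.2 (hy₂.trans (interior_subset hy))) (interior_subset hy))
      have h1 := hm (Set.mem_Ici.2 le_rfl) (Set.mem_Ici.2 hy) hy
      simp only [sub_self, mul_zero, sub_zero] at h1
      linarith [h0 y₂]
    have hI : IntegrableOn (fun y => (2 / g' y₂) * (g y / y ^ 2)) (Set.Ioi (2 * y₂)) :=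
      (hint.mono_set (Set.Ioi_subset_Ioi (by linarith))).const_mul _
    refine (not_integrableOn_Ioi_inv (a := 2 * y₂)) (Integrable.mono' hI (by fun_prop) ?_)
    filter_upwards [ae_restrict_mem measurableSet_Ioi] with y hy
    have hy : 2 * y₂ < y := hy
    have hy0 : 0 < y := by linarith
    rw [Real.norm_of_nonneg (by positivity), inv_eq_one_div, div_mul_div_comm,
      div_le_div_iff₀ hy0 (by positivity)]
    have := hgrow y (by linarith)
    have h3 : g' y₂ * (y / 2) ≤ g y := le_trans (by apply mul_le_mul_of_nonneg_left _ hc.le; linarith) this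
    nlinarith
  have hanti : AntitoneOn g (Set.Ici y₀) :=
    antitoneOn_of_hasDerivWithinAt_nonpos (convex_Ici y₀)
      (fun y hy => (hg y hy).continuousAt.continuousWithinAt)
      (fun y hy => (hg y (interior_subset hy)).hasDerivWithinAt)
      (fun y hy => step1 y (interior_subset hy))
  have step2 : ∀ y, y₀ ≤ y → g' y + k * g y ≤ 0 := by
    intro y₂ hy₂
    have hm : MonotoneOn (fun y => (g' y + k * g y) * Real.exp (-(k * y))) (Set.Ici y₀) := by
      have hder : ∀ y, y₀ ≤ y → HasDerivAt (fun y => (g' y + k * g y) * Real.exp (-(k * y)))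
          ((g'' y - k ^ 2 * g y) * Real.exp (-(k * y))) y := by
        intro y hy
        have h1 : HasDerivAt (fun y => Real.exp (-(k * y))) (Real.exp (-(k * y)) * (-(k * 1))) y :=
          (((hasDerivAt_id y).const_mul k).fun_neg).exp
        have h2 := ((hg' y hy).add ((hg y hy).const_mul k)).mul h1
        refine h2.congr_deriv ?_
        simp only [Pi.add_apply]
        ring
      exact monotoneOn_of_hasDerivWithinAt_nonneg (convex_Ici y₀)
        (fun y hy => (hder y hy).continuousAt.continuousWithinAt)
        (fun y hy => (hder y (interior_subset hy)).hasDerivWithinAt)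
        (fun y hy => mul_nonneg (sub_nonneg.2 (h2 y (interior_subset hy))) (Real.exp_pos _).le)
    have hlim : Tendsto (fun y => k * g y₀ * Real.exp (-(k * y))) atTop (𝓝 0) := by
      rw [show (0 : ℝ) = k * g y₀ * 0 by ring]
      exact (Real.tendsto_exp_neg_atTop_nhds_zero.comp (tendsto_id.const_mul_atTop hk)).const_mul _
    have hle : (g' y₂ + k * g y₂) * Real.exp (-(k * y₂)) ≤ 0 := by
      refine ge_of_tendsto hlim ?_
      filter_upwards [eventually_ge_atTop y₂] with y hy
      refine (hm (Set.mem_Ici.2 hy₂) (Set.mem_Ici.2 (hy₂.trans hy)) hy).trans ?_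
      refine mul_le_mul_of_nonneg_right ?_ (Real.exp_pos _).le
      have h1 := step1 y (hy₂.trans hy)
      have h2 := hanti (Set.mem_Ici.2 le_rfl) (Set.mem_Ici.2 (hy₂.trans hy)) (hy₂.trans hy)
      have h3 := mul_le_mul_of_nonneg_left h2 hk.le
      linarith
    exact nonpos_of_mul_nonpos_left hle (Real.exp_pos _)
  have hm : AntitoneOn (fun y => g y * Real.exp (k * y)) (Set.Ici y₀) := by
    have hder : ∀ y, y₀ ≤ y → HasDerivAt (fun y => g y * Real.exp (k * y))
        ((g' y + k * g y) * Real.exp (k * y)) y := by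
      intro y hy
      have h1 : HasDerivAt (fun y => Real.exp (k * y)) (Real.exp (k * y) * (k * 1)) y :=
        ((hasDerivAt_id y).const_mul k).exp
      refine ((hg y hy).mul h1).congr_deriv ?_
      ring
    exact antitoneOn_of_hasDerivWithinAt_nonpos (convex_Ici y₀)
      (fun y hy => (hder y hy).continuousAt.continuousWithinAt)
      (fun y hy => (hder y (interior_subset hy)).hasDerivWithinAt)
      (fun y hy => mul_nonpos_of_nonpos_of_nonneg (step2 y (interior_subset hy)) (Real.exp_pos _).le)
  have h := hm (Set.mem_Ici.2 le_rfl) (Set.mem_Ici.2 hy) hy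
  simp only at h
  calc g y = g y * Real.exp (k * y) * Real.exp (-(k * y)) := by
        rw [mul_assoc, ← Real.exp_add]; simp
    _ ≤ g y₀ * Real.exp (k * y₀) * Real.exp (-(k * y)) := by gcongr
    _ = _ := by rw [mul_assoc, ← Real.exp_add]; congr 2; ring

/-- The convexity lemma is applied to `|a|²`, whose second derivative `2 Re(q) |a|² + 2 |a'|²` is at
least `(2k)² |a|²`; the square root halves the rate. -/
theorem norm_le_exp_of_deriv_eq {a a' q : ℝ → ℂ} {y₀ k : ℝ} (hy₀ : 0 < y₀) (hk : 0 < k)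
    (ha : ∀ y, 0 < y → HasDerivAt a (a' y) y) (ha' : ∀ y, 0 < y → HasDerivAt a' (q y * a y) y)
    (hq : ∀ y, y₀ ≤ y → 2 * k ^ 2 ≤ (q y).re)
    (hint : IntegrableOn (fun y => ‖a y‖ ^ 2 / y ^ 2) (Set.Ioi y₀)) {y : ℝ} (hy : y₀ ≤ y) :
    ‖a y‖ ≤ ‖a y₀‖ * Real.exp (-(k * (y - y₀))) := by
  have key := le_exp_of_convex (g := fun y => ‖a y‖ ^ 2) (g' := fun y => 2 * inner ℝ (a y) (a' y))
    (g'' := fun y => 2 * (inner ℝ (a y) (q y * a y) + inner ℝ (a' y) (a' y))) (k := 2 * k)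
    hy₀ (by positivity) (fun y hy => (ha y (hy₀.trans_le hy)).norm_sq)
    (fun y hy => ((ha y (hy₀.trans_le hy)).inner ℝ (ha' y (hy₀.trans_le hy))).const_mul 2)
    (fun y => by positivity) (fun y hy => ?_) hint hy
  · refine le_of_sq_le_sq (key.trans_eq ?_) (by positivity)
    rw [mul_pow, ← Real.exp_nat_mul]
    congr 2; push_cast; ring
  · have h1 : inner ℝ (a y) (q y * a y) = (q y).re * ‖a y‖ ^ 2 := by
      rw [Complex.inner, mul_assoc, Complex.mul_conj', Complex.mul_re]
      norm_cast
      simp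
    have h2 : 0 ≤ inner ℝ (a' y) (a' y) := real_inner_self_nonneg
    rw [h1]
    have h3 := mul_le_mul_of_nonneg_right (hq y hy) (sq_nonneg ‖a y‖)
    nlinarith

theorem eq_zero_of_deriv_eq {d d' q : ℝ → ℂ} (hd : ∀ y, 0 < y → HasDerivAt d (d' y) y)
    (hd' : ∀ y, 0 < y → HasDerivAt d' (q y * d y) y) (hq : ContinuousOn q (Set.Ioi 0)) {y₁ : ℝ}
    (hy₁ : 0 < y₁) (h0 : d y₁ = 0) (h0' : d' y₁ = 0) {y : ℝ} (hy : 0 < y) : d y = 0 := by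
  set A := min y y₁ / 2
  set B := max y y₁ + 1
  have hA : 0 < A := by positivity [lt_min hy hy₁]
  obtain ⟨Q, hQ⟩ := (isCompact_Icc (a := A) (b := B)).exists_bound_of_continuousOn
    (hq.mono fun t ht => lt_of_lt_of_le hA ht.1)
  have hlip : ∀ t ∈ Set.Ioo A B, LipschitzOnWith (max 1 Q.toNNReal)
      (fun p : ℂ × ℂ => (p.2, q t * p.1)) Set.univ := by
    intro t ht
    refine LipschitzWith.lipschitzOnWith (LipschitzWith.of_dist_le_mul fun p p' => ?_)
    have hqt : ‖q t‖ ≤ Q := hQ t ⟨ht.1.le, ht.2.le⟩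
    have hQ1 : Q ≤ ((max 1 Q.toNNReal : NNReal) : ℝ) := by
      rw [NNReal.coe_max]; exact (Real.le_coe_toNNReal Q).trans (le_max_right _ _)
    have h1 : (1 : ℝ) ≤ ((max 1 Q.toNNReal : NNReal) : ℝ) := by
      rw [NNReal.coe_max]; exact le_max_left _ _
    rw [Prod.dist_eq, Prod.dist_eq]
    refine max_le ?_ ?_
    · calc dist p.2 p'.2 = 1 * dist p.2 p'.2 := (one_mul _).symm
        _ ≤ _ := mul_le_mul h1 (le_max_right _ _) dist_nonneg (by positivity)
    · rw [dist_eq_norm, ← mul_sub, norm_mul, ← dist_eq_norm]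
      exact mul_le_mul (hqt.trans hQ1) (le_max_left _ _) dist_nonneg (by positivity)
  have hIoo : ∀ t ∈ Set.Ioo A B, 0 < t := fun t ht => hA.trans ht.1
  have key := ODE_solution_unique_of_mem_Ioo (t₀ := y₁) (f := fun t => (d t, d' t))
    (g := fun _ => 0) (s := fun _ => Set.univ) hlip
    ⟨by have := min_le_right y y₁; simp only [A]; linarith,
      by have := le_max_right y y₁; simp only [B]; linarith⟩
    (fun t ht => ⟨(hd t (hIoo t ht)).prodMk (hd' t (hIoo t ht)), trivial⟩)
    (fun t ht => ⟨(hasDerivAt_const t (0 : ℂ × ℂ)).congr_deriv (by simp; rfl), trivial⟩)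
    (by simp [h0, h0'])
  have := key (x := y) ⟨by have := min_le_left y y₁; simp only [A]; linarith,
      by have := le_max_left y y₁; simp only [B]; linarith⟩
  simpa using congrArg Prod.fst this

/-- Two solutions of `a'' = q a`, one of which tends to zero together with its derivative, are
proportional. -/
theorem exists_eq_mul_of_deriv_eq {a a' u u' q : ℝ → ℂ} (ha : ∀ y, 0 < y → HasDerivAt a (a' y) y)
    (ha' : ∀ y, 0 < y → HasDerivAt a' (q y * a y) y) (hu : ∀ y, 0 < y → HasDerivAt u (u' y) y)
    (hu' : ∀ y, 0 < y → HasDerivAt u' (q y * u y) y) (hq : ContinuousOn q (Set.Ioi 0))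
    (h1 : Tendsto (fun y => a y * u y) atTop (𝓝 0))
    (h2 : Tendsto (fun y => a y * u' y) atTop (𝓝 0))
    (hne : ∃ y, 0 < y ∧ u y ≠ 0) : ∃ c : ℂ, ∀ y, 0 < y → a y = c * u y := by
  obtain ⟨w, hw⟩ : ∃ w, ∀ y ∈ Set.Ioi (0 : ℝ), a y * u' y - a' y * u y = w := by
    have hder : ∀ y ∈ Set.Ioi (0 : ℝ), HasDerivAt (fun y => a y * u' y - a' y * u y) 0 y := by
      intro y hy
      refine (((ha y hy).mul (hu' y hy)).sub ((ha' y hy).mul (hu y hy))).congr_deriv ?_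
      ring
    exact isOpen_Ioi.exists_is_const_of_deriv_eq_zero isPreconnected_Ioi
      (fun y hy => (hder y hy).differentiableAt.differentiableWithinAt)
      (fun y hy => (hder y hy).deriv)
  have hw0 : w = 0 := by
    -- Nothing is known about `a'`, so the constant Wronskian `w = a u' - a' u` cannot be estimated
    -- directly. Adding `w y` to `a u` eliminates `a'` from the derivative. The increment of `a u +
    -- w y` over `[y, y + 1]` tends to `w` because `a u → 0`, and to `0` because its derivative `2 a
    -- u'` does.
    have hder : ∀ y, 0 < y → HasDerivAt (fun y : ℝ => a y * u y + w * y) (2 * (a y * u' y)) y := by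
      intro y hy
      have h3 := ((ha y hy).mul (hu y hy)).add (((hasDerivAt_id y).ofReal_comp).const_mul w)
      refine h3.congr_deriv ?_
      rw [← hw y hy]; simp; ring
    have hlim : Tendsto (fun y : ℝ => (a (y + 1) * u (y + 1) + w * ((y + 1 : ℝ) : ℂ)) -
        (a y * u y + w * y)) atTop (𝓝 w) := by
      have h3 := (h1.comp (tendsto_atTop_add_const_right atTop (1 : ℝ) tendsto_id)).sub h1
      have h4 := h3.add_const w
      rw [sub_zero, zero_add] at h4
      refine h4.congr fun y => ?_
      simp; ring
    have hlim0 : Tendsto (fun y : ℝ => (a (y + 1) * u (y + 1) + w * ((y + 1 : ℝ) : ℂ)) -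
        (a y * u y + w * y)) atTop (𝓝 0) := by
      rw [Metric.tendsto_atTop] at h2 ⊢
      intro ε hε
      obtain ⟨N, hN⟩ := h2 (ε / 4) (by positivity)
      refine ⟨max N 1, fun y hy => ?_⟩
      have hyN : N ≤ y := (le_max_left _ _).trans hy
      have hy0 : 0 < y := lt_of_lt_of_le one_pos ((le_max_right _ _).trans hy)
      have h3 := norm_image_sub_le_of_norm_deriv_le_segment' (a := y) (b := y + 1) (C := ε / 2)
        (f := fun y : ℝ => a y * u y + w * y) (f' := fun y => 2 * (a y * u' y))
        (fun x hx => (hder x (hy0.trans_le hx.1)).hasDerivWithinAt)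
        (fun x hx => by
          have h4 := hN x (hyN.trans hx.1)
          rw [dist_zero_right] at h4
          rw [norm_mul, Complex.norm_ofNat]; linarith) (y + 1) ⟨by linarith, le_rfl⟩
      rw [dist_zero_right]
      refine h3.trans_lt ?_
      rw [add_sub_cancel_left]; linarith
    exact tendsto_nhds_unique hlim hlim0
  obtain ⟨y₁, hy₁, hu1⟩ := hne
  refine ⟨a y₁ / u y₁, fun y hy => ?_⟩
  have hww := hw y₁ hy₁
  rw [hw0] at hww
  have := eq_zero_of_deriv_eq (d := fun y => a y - a y₁ / u y₁ * u y)
    (d' := fun y => a' y - a y₁ / u y₁ * u' y) (q := q)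
    (fun y hy => (ha y hy).sub ((hu y hy).const_mul _))
    (fun y hy => ((ha' y hy).sub ((hu' y hy).const_mul _)).congr_deriv (by ring)) hq hy₁
    (by field_simp; ring) (by field_simp; linear_combination -hww) hy
  exact sub_eq_zero.1 this

/-! ### The Whittaker function as a solution -/

/-- The derivative of `√y K(r y)`. -/
def besselSqrtDeriv (ν : ℂ) (r y : ℝ) : ℂ :=
  (1 / (2 * Real.sqrt y) : ℝ) * besselK ν (r * y) -
    (2 * Real.pi * r * Real.sqrt y : ℝ) * besselMoment 1 ν (r * y)

theorem hasDerivAt_besselMoment_mul (k : ℕ) (ν : ℂ) {r y : ℝ} (hr : 0 < r) (hy : 0 < y) :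
    HasDerivAt (fun y : ℝ => besselMoment k ν (r * y))
      (-(2 * Real.pi * r) * besselMoment (k + 1) ν (r * y)) y := by
  have h := (hasDerivAt_besselMoment k ν (mul_pos hr hy)).scomp y ((hasDerivAt_id y).const_mul r)
  refine h.congr_deriv ?_
  simp; ring

theorem hasDerivAt_sqrt_mul_besselK (ν : ℂ) {r y : ℝ} (hr : 0 < r) (hy : 0 < y) :
    HasDerivAt (fun y : ℝ => (Real.sqrt y : ℂ) * besselK ν (r * y)) (besselSqrtDeriv ν r y) y := by
  refine (((Real.hasDerivAt_sqrt hy.ne').ofReal_comp).mul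
    (hasDerivAt_besselMoment_mul 0 ν hr hy)).congr_deriv ?_
  rw [besselSqrtDeriv]; push_cast; ring

/-- The factor `√y` removes the first order term of the Bessel equation, giving the normal form `a''
= q a` that the Fourier coefficients of a cusp form also satisfy. -/
theorem hasDerivAt_besselSqrtDeriv (ν : ℂ) {r y : ℝ} (hr : 0 < r) (hy : 0 < y) :
    HasDerivAt (besselSqrtDeriv ν r) ((4 * Real.pi ^ 2 * r ^ 2 + (ν ^ 2 - 1 / 4) / (y : ℂ) ^ 2) *
      ((Real.sqrt y : ℂ) * besselK ν (r * y))) y := by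
  have hs : 0 < Real.sqrt y := Real.sqrt_pos.2 hy
  have d1 : HasDerivAt (fun y : ℝ => 1 / (2 * Real.sqrt y))
      (-(1 / (4 * Real.sqrt y * y))) y := by
    have := ((Real.hasDerivAt_sqrt hy.ne').const_mul 2).inv (by positivity)
    simp only [one_div]
    refine this.congr_deriv ?_
    field_simp
    rw [Real.sq_sqrt hy.le]; ring
  have d2 : HasDerivAt (fun y : ℝ => 2 * Real.pi * r * Real.sqrt y)
      (2 * Real.pi * r * (1 / (2 * Real.sqrt y))) y :=
    (Real.hasDerivAt_sqrt hy.ne').const_mul _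
  have h := (d1.ofReal_comp.mul (hasDerivAt_besselMoment_mul 0 ν hr hy)).sub
    (d2.ofReal_comp.mul (hasDerivAt_besselMoment_mul 1 ν hr hy))
  refine h.congr_deriv ?_
  have hb := besselMoment_two ν (mul_pos hr hy)
  have hsq : (Real.sqrt y : ℂ) ^ 2 = y := by exact_mod_cast Real.sq_sqrt hy.le
  have hs' : (Real.sqrt y : ℂ) ≠ 0 := by exact_mod_cast hs.ne'
  push_cast at hb ⊢
  rw [← hsq] at hb ⊢
  simp only [besselK]
  generalize besselMoment 0 ν (r * y) = k0 at *
  generalize besselMoment 1 ν (r * y) = k1 at *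
  generalize besselMoment (1 + 1) ν (r * y) = k2 at *
  generalize (Real.sqrt y : ℂ) = t at *
  field_simp
  linear_combination 4 * hb

theorem tendsto_besselMoment_mul_zero (k : ℕ) (ν : ℂ) {r : ℝ} (hr : 0 < r) (n : ℕ) :
    Tendsto (fun y : ℝ => (y : ℂ) ^ n * besselMoment k ν (r * y)) atTop (𝓝 0) := by
  obtain ⟨C, hC0, hC⟩ := norm_besselMoment_le k |ν.re|
  rw [tendsto_zero_iff_norm_tendsto_zero]
  have h1 : Tendsto (fun y : ℝ => C * (y ^ n * Real.exp (-(Real.pi * r) * y))) atTop (𝓝 0) := by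
    rw [show (0 : ℝ) = C * 0 by ring]
    have := tendsto_rpow_mul_exp_neg_mul_atTop_nhds_zero (n : ℝ) (Real.pi * r) (by positivity)
    simp only [Real.rpow_natCast] at this
    exact this.const_mul C
  refine squeeze_zero' (Eventually.of_forall fun y => norm_nonneg _) ?_ h1
  filter_upwards [eventually_ge_atTop (1 / 2 / r), eventually_ge_atTop 0] with y hy hy0
  rw [norm_mul, norm_pow, Complex.norm_real, Real.norm_of_nonneg hy0]
  have := hC ν (r * y) le_rfl (by rw [div_le_iff₀ hr] at hy; linarith)
  calc y ^ n * ‖besselMoment k ν (r * y)‖ ≤ y ^ n * (C * Real.exp (-(Real.pi * (r * y)))) := by gcongr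
    _ = _ := by rw [show -(Real.pi * (r * y)) = -(Real.pi * r) * y by ring]; ring

/-! ### The hyperbolic measure in coordinates -/

/-- The point `x + i y` of the upper half-plane, for `p = (y, x)`. -/
def halfPlanePoint (p : ℝ × ℝ) : ℍ := ofComplex (p.2 + p.1 * Complex.I)

/-- The measure `dy / y ^ 2` on the positive half-line. -/
def heightMeasure : Measure ℝ :=
  (volume.restrict (Set.Ioi 0)).withDensity fun y => ENNReal.ofReal (1 / y ^ 2)

instance : SigmaFinite heightMeasure :=
  SigmaFinite.withDensity_ofReal _

theorem measurable_ofComplex : Measurable (ofComplex : ℂ → ℍ) := by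
  have h : ∀ s : Set ℍ, MeasurableSet s → MeasurableSet ((ofComplex : ℂ → ℍ) ⁻¹' s) := by
    intro s hs
    have hU : MeasurableSet {z : ℂ | 0 < z.im} := (isOpen_lt continuous_const Complex.continuous_im).measurableSet
    -- `ofComplex` takes one fixed default value off the upper half-plane, so the preimage there is
    -- everything or nothing.
    have h1 : (ofComplex : ℂ → ℍ) ⁻¹' s =
        (UpperHalfPlane.coe '' s) ∪ ({z : ℂ | 0 < z.im}ᶜ ∩ {_z | ofComplex (0 : ℂ) ∈ s}) := by
      ext z
      by_cases hz : 0 < z.im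
      · constructor
        · intro h
          exact Or.inl ⟨ofComplex z, h, by rw [ofComplex_apply_of_im_pos hz]⟩
        · rintro (⟨τ, hτ, rfl⟩ | ⟨h, -⟩)
          · simpa using hτ
          · exact absurd hz h
      · have e : ofComplex z = ofComplex 0 := by
          rw [ofComplex_apply_of_im_nonpos (not_lt.1 hz), ofComplex_apply_of_im_nonpos (by simp)]
        simp only [Set.mem_preimage, e, Set.mem_union, Set.mem_image, Set.mem_inter_iff,
          Set.mem_compl_iff, Set.mem_ofPred_eq, hz, not_false_eq_true, true_and]
        constructor
        · exact Or.inr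
        · rintro (⟨τ, -, rfl⟩ | h)
          · exact absurd τ.im_pos hz
          · exact h
    rw [h1]
    exact (measurableEmbedding_coe.measurableSet_image.2 hs).union
      (hU.compl.inter (MeasurableSet.const _))
  exact fun s hs => h s hs

theorem measurable_halfPlanePoint : Measurable halfPlanePoint :=
  measurable_ofComplex.comp (by fun_prop)

theorem map_halfPlanePoint :
    Measure.map halfPlanePoint (heightMeasure.prod volume) = (volume : Measure ℍ) := by
  ext s hs
  rw [Measure.map_apply measurable_halfPlanePoint hs, volume_eq_lintegral]
  have hs' := measurableEmbedding_coe.measurableSet_image.2 hs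
  rw [← lintegral_indicator hs',
    ← Complex.volume_preserving_equiv_real_prod.symm.lintegral_comp_emb
      Complex.measurableEquivRealProd.symm.measurableEmbedding,
    Measure.volume_eq_prod, lintegral_prod_symm', Measure.prod_apply (measurable_halfPlanePoint hs),
    heightMeasure, lintegral_withDensity_eq_lintegral_mul_non_measurable, ← lintegral_indicator measurableSet_Ioi]
  · refine lintegral_congr fun y => ?_
    by_cases hy : 0 < y
    · rw [Set.indicator_of_mem (Set.mem_Ioi.2 hy)]
      have hset : Prod.mk y ⁻¹' (halfPlanePoint ⁻¹' s) =
          {x : ℝ | ((x : ℂ) + y * Complex.I) ∈ UpperHalfPlane.coe '' s} := by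
        ext x
        have him : 0 < ((x : ℂ) + y * Complex.I).im := by simpa using hy
        simp only [Set.mem_preimage, halfPlanePoint, Set.mem_ofPred_eq]
        constructor
        · intro h; exact ⟨_, h, by rw [ofComplex_apply_of_im_pos him]⟩
        · rintro ⟨τ, hτ, h⟩
          rw [← h]; simpa using hτ
      have hm : MeasurableSet {x : ℝ | ((x : ℂ) + y * Complex.I) ∈ UpperHalfPlane.coe '' s} :=
        (by fun_prop : Measurable fun x : ℝ => (x : ℂ) + y * Complex.I) hs'
      rw [Pi.mul_apply, hset, ← setLIntegral_one, ← lintegral_indicator hm, ← lintegral_const_mul']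
      · refine lintegral_congr fun x => ?_
        have e : Complex.measurableEquivRealProd.symm (x, y) = (x : ℂ) + y * Complex.I := by
          rw [Complex.measurableEquivRealProd_symm_apply]
          apply Complex.ext <;> simp
        rw [e]
        by_cases hx : ((x : ℂ) + y * Complex.I) ∈ UpperHalfPlane.coe '' s
        · rw [Set.indicator_of_mem hx, Set.indicator_of_mem (by exact hx)]
          simp only [Complex.add_im, Complex.ofReal_im, Complex.mul_im, Complex.ofReal_re,
            Complex.I_im, mul_one, Complex.I_re, mul_zero, add_zero, zero_add]
          rw [ENNReal.ofReal_eq_coe_nnreal (by positivity)]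
          congr 1
          ext
          simp
        · rw [Set.indicator_of_notMem hx, Set.indicator_of_notMem (by exact hx), mul_zero]
      · exact ENNReal.ofReal_ne_top
    · rw [Set.indicator_of_notMem (by exact hy)]
      rw [← lintegral_zero (μ := (volume : Measure ℝ))]
      refine lintegral_congr fun x => ?_
      rw [Set.indicator_of_notMem]
      rintro ⟨τ, -, h⟩
      have h1 := congrArg Complex.im h
      rw [Complex.measurableEquivRealProd_symm_apply] at h1
      exact hy (by simp at h1; rw [← h1]; exact τ.im_pos)
  · fun_prop
  · filter_upwards with y using ENNReal.ofReal_lt_top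
  · refine Measurable.indicator ?_ hs' |>.comp Complex.measurableEquivRealProd.symm.measurable
    fun_prop

theorem lintegral_halfPlane {φ : ℍ → ENNReal} (hφ : Measurable φ) :
    ∫⁻ z, φ z = ∫⁻ y in Set.Ioi (0 : ℝ), ENNReal.ofReal (1 / y ^ 2) * ∫⁻ x : ℝ, φ (halfPlanePoint (y, x)) := by
  rw [← map_halfPlanePoint, lintegral_map hφ measurable_halfPlanePoint,
    lintegral_prod (fun p => φ (halfPlanePoint p)) (hφ.comp measurable_halfPlanePoint).aemeasurable, heightMeasure,
    lintegral_withDensity_eq_lintegral_mul_non_measurable _ (by fun_prop)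
      (Eventually.of_forall fun y => ENNReal.ofReal_lt_top)]
  rfl

theorem integrable_halfPlane_iff {φ : ℍ → ℂ} (hφ : AEStronglyMeasurable φ) :
    Integrable φ ↔ Integrable (fun p => φ (halfPlanePoint p)) (heightMeasure.prod volume) := by
  rw [← map_halfPlanePoint] at hφ ⊢
  exact integrable_map_measure hφ measurable_halfPlanePoint.aemeasurable

theorem integral_heightMeasure (G : ℝ → ℂ) :
    ∫ y, G y ∂heightMeasure = ∫ y in Set.Ioi (0 : ℝ), (1 / (y : ℂ) ^ 2) * G y := by
  rw [heightMeasure, integral_withDensity_eq_integral_toReal_smul₀ (by fun_prop)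
    (Eventually.of_forall fun y => ENNReal.ofReal_lt_top)]
  refine integral_congr_ae (Eventually.of_forall fun y => ?_)
  simp only
  rw [ENNReal.toReal_ofReal (by positivity), Complex.real_smul]
  push_cast; rfl

theorem integral_halfPlane {φ : ℍ → ℂ} (hφ : Integrable φ) :
    ∫ z, φ z = ∫ y in Set.Ioi (0 : ℝ), (1 / (y : ℂ) ^ 2) * ∫ x : ℝ, φ (halfPlanePoint (y, x)) := by
  have h := (integrable_halfPlane_iff hφ.aestronglyMeasurable).1 hφ
  rw [← integral_heightMeasure, ← integral_prod _ h]
  conv_lhs => rw [← map_halfPlanePoint]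
  rw [integral_map measurable_halfPlanePoint.aemeasurable]
  rw [map_halfPlanePoint]; exact hφ.aestronglyMeasurable

/-! ### Unfolding -/

instance : SMulInvariantMeasure SL(2, ℤ) ℍ volume :=
  ⟨fun γ _ hs => measure_preimage_smul_of_nullMeasurableSet hs.nullMeasurableSet
    (Matrix.SpecialLinearGroup.mapGL ℝ γ)⟩

instance : MeasurableConstSMul SL(2, ℤ) ℍ :=
  ⟨fun γ => measurable_const_smul (Matrix.SpecialLinearGroup.mapGL ℝ γ)⟩

instance : Countable SL(2, ℤ) :=
  Function.Injective.countable (f := fun γ : SL(2, ℤ) => fun i j => (γ i j : ℤ))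
    fun γ γ' h => by ext i j; exact congrFun (congrFun h i) j

theorem measurableSet_fd : MeasurableSet 𝒟 := ModularGroup.isClosed_fd.measurableSet

/-- A horizontal line meets the boundary of the fundamental domain in at most four points. -/
theorem volume_fd_diff_fdo : volume (𝒟 \ 𝒟ᵒ) = 0 := by
  have hm : MeasurableSet (𝒟 \ 𝒟ᵒ) := measurableSet_fd.diff ModularGroup.isOpen_fdo.measurableSet
  rw [← map_halfPlanePoint, Measure.map_apply measurable_halfPlanePoint hm,
    Measure.measure_prod_null (measurable_halfPlanePoint hm)]
  refine (withDensity_absolutelyContinuous _ _).ae_le ?_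
  filter_upwards [ae_restrict_mem measurableSet_Ioi] with y hy
  have hsub : Prod.mk y ⁻¹' (halfPlanePoint ⁻¹' (𝒟 \ 𝒟ᵒ)) ⊆
      ({1 / 2, -(1 / 2), Real.sqrt (1 - y ^ 2), -Real.sqrt (1 - y ^ 2)} : Set ℝ) := by
    intro x hx
    have him : 0 < ((x : ℂ) + y * Complex.I).im := by simpa using hy
    have hre : (halfPlanePoint (y, x)).re = x := by
      rw [halfPlanePoint, ofComplex_apply_of_im_pos him]; simp
    have hcoe : ((halfPlanePoint (y, x) : ℍ) : ℂ) = (x : ℂ) + y * Complex.I := by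
      rw [halfPlanePoint, ofComplex_apply_of_im_pos him]
    obtain ⟨⟨h1, h2⟩, h3⟩ := hx
    simp only [ModularGroup.fdo, Set.mem_ofPred_eq, not_and_or, not_lt] at h3
    rw [hcoe] at h1 h3
    rw [hre] at h2 h3
    have hn : Complex.normSq ((x : ℂ) + y * Complex.I) = x ^ 2 + y ^ 2 := by
      rw [Complex.normSq_add_mul_I]
    rw [hn] at h1 h3
    rcases h3 with h3 | h3
    · have h4 : x ^ 2 = 1 - y ^ 2 := by linarith
      have h5 : x = Real.sqrt (1 - y ^ 2) ∨ x = -Real.sqrt (1 - y ^ 2) := by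
        rw [← h4, Real.sqrt_sq_eq_abs]
        rcases abs_choice x with h | h <;> rw [h] <;> simp
      rcases h5 with h5 | h5
      · exact Or.inr (Or.inr (Or.inl h5))
      · exact Or.inr (Or.inr (Or.inr h5))
    · rcases abs_eq (by norm_num : (0 : ℝ) ≤ 1 / 2) |>.1 (le_antisymm h2 h3) with h | h
      · exact Or.inl h
      · exact Or.inr (Or.inl h)
  exact measure_mono_null hsub (Set.Finite.measure_zero (by simp) _)

/-- Off the null set of translates of the boundary, an orbit meets `𝒟` only in its interior, where
two equivalent positions differ by `±1`. -/
theorem ae_smul_mem_fd_iff :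
    ∀ᵐ z : ℍ, ∃ γ₀ : SL(2, ℤ), ∀ γ : SL(2, ℤ), γ • z ∈ 𝒟 ↔ γ = γ₀ ∨ γ = -γ₀ := by
  have h : ∀ᵐ z : ℍ, ∀ γ : SL(2, ℤ), γ • z ∉ 𝒟 \ 𝒟ᵒ := by
    rw [ae_all_iff]
    intro γ
    have := (measurePreserving_smul γ (volume : Measure ℍ)).quasiMeasurePreserving.preimage_null
      volume_fd_diff_fdo
    exact compl_mem_ae_iff.2 this
  filter_upwards [h] with z hz
  obtain ⟨γ₀, h₀⟩ := ModularGroup.exists_smul_mem_fd z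
  have h₁ : γ₀ • z ∈ 𝒟ᵒ := by
    by_contra hc; exact hz γ₀ ⟨h₀, hc⟩
  refine ⟨γ₀, fun γ => ⟨fun hγ => ?_, ?_⟩⟩
  · have h2 : (γ * γ₀⁻¹) • (γ₀ • z) ∈ 𝒟 := by rwa [smul_smul, inv_mul_cancel_right]
    rcases ModularGroup.eq_one_or_neg_one_of_mem_fdo_mem_fd h₁ h2 with h3 | h3
    · exact Or.inl (mul_inv_eq_one.1 h3)
    · right
      rw [mul_inv_eq_iff_eq_mul] at h3
      rw [h3, neg_mul, one_mul]
  · rintro (rfl | rfl)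
    · exact h₀
    · rwa [ModularGroup.SL_neg_smul]

theorem specialLinear_ne_neg (γ : SL(2, ℤ)) : γ ≠ -γ := by
  intro h
  have h1 : ∀ i j, γ i j = 0 := fun i j => by
    have := congrArg (fun m : SL(2, ℤ) => m i j) h
    simp at this
    omega
  have hdet := γ.det_coe
  rw [Matrix.det_fin_two] at hdet
  simp [h1] at hdet

/-- A family over `SL(2, ℤ)` that is supported on `{γ, -γ}` with value `c`. -/
theorem hasSum_of_pair {M : Type*} [AddCommMonoid M] [TopologicalSpace M] {u : SL(2, ℤ) → M} {c : M}
    (γ₀ : SL(2, ℤ)) (h1 : u γ₀ = c) (h2 : u (-γ₀) = c) (h0 : ∀ γ, γ ≠ γ₀ → γ ≠ -γ₀ → u γ = 0) :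
    HasSum u (c + c) := by
  have := hasSum_sum_of_ne_finset_zero (f := u) (s := {γ₀, -γ₀}) (L := .unconditional _) (fun γ hγ => by
    simp only [Finset.mem_insert, Finset.mem_singleton, not_or] at hγ
    exact h0 γ hγ.1 hγ.2)
  rwa [Finset.sum_pair (specialLinear_ne_neg γ₀), h1, h2] at this

theorem indicator_eq_indicator_one_mul {X M : Type*} [MulZeroOneClass M] (D : Set X) (u : X → M)
    (x : X) : D.indicator u x = D.indicator 1 x * u x := by
  by_cases h : x ∈ D <;> simp [h]

/-- The translates `γ 𝒟` cover almost every point exactly twice, because `-1` acts trivially; this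
is the source of the factor `2`. -/
theorem lintegral_fd_tsum_smul {φ : ℍ → ENNReal} (hφ : Measurable φ) :
    ∑' γ : SL(2, ℤ), ∫⁻ z in 𝒟, φ (γ • z) = 2 * ∫⁻ z, φ z := by
  have hmeas : ∀ γ : SL(2, ℤ), Measurable fun z => Set.indicator 𝒟 1 (γ⁻¹ • z) * φ z := fun γ =>
    ((measurable_one.indicator measurableSet_fd).comp (measurable_const_smul γ⁻¹)).mul hφ
  have h1 : ∀ γ : SL(2, ℤ), ∫⁻ z in 𝒟, φ (γ • z) =
      ∫⁻ z, Set.indicator 𝒟 1 (γ⁻¹ • z) * φ z := by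
    intro γ
    rw [← lintegral_indicator measurableSet_fd,
      ← (measurePreserving_smul γ (volume : Measure ℍ)).lintegral_comp (hmeas γ)]
    refine lintegral_congr fun z => ?_
    rw [inv_smul_smul, ← indicator_eq_indicator_one_mul 𝒟 (fun z => φ (γ • z))]
  simp only [h1]
  rw [← lintegral_tsum (fun γ => (hmeas γ).aemeasurable), ← lintegral_const_mul _ hφ]
  refine lintegral_congr_ae ?_
  filter_upwards [ae_smul_mem_fd_iff] with z ⟨γ₀, hz⟩
  rw [ENNReal.tsum_mul_right]
  congr 1
  rw [← (Equiv.inv SL(2, ℤ)).tsum_eq]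
  have := hasSum_of_pair
    (u := fun γ : SL(2, ℤ) => Set.indicator 𝒟 (1 : ℍ → ENNReal) ((γ⁻¹)⁻¹ • z)) (c := 1) γ₀
    (by rw [inv_inv, Set.indicator_of_mem ((hz γ₀).2 (Or.inl rfl))]; rfl) (by
      rw [inv_inv, Set.indicator_of_mem ((hz (-γ₀)).2 (Or.inr rfl))]; rfl) (fun γ h h' => by
      rw [inv_inv, Set.indicator_of_notMem]
      rw [hz γ]; tauto)
  exact this.tsum_eq.trans (by norm_num)

/-- The non-negative version applied to `‖φ‖` provides the absolute convergence that permits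
interchanging sum and integral. -/
theorem integral_fd_tsum_smul {φ : ℍ → ℂ} (hm : Measurable φ) (hφ : Integrable φ) :
    (∀ᵐ z ∂(volume.restrict 𝒟), Summable fun γ : SL(2, ℤ) => φ (γ • z)) ∧
    IntegrableOn (fun z => ∑' γ : SL(2, ℤ), φ (γ • z)) 𝒟 ∧
    ∫ z in 𝒟, ∑' γ : SL(2, ℤ), φ (γ • z) = 2 * ∫ z, φ z := by
  have hfin : ∑' γ : SL(2, ℤ), ∫⁻ z in 𝒟, ‖φ (γ • z)‖ₑ ≠ ⊤ := by
    rw [lintegral_fd_tsum_smul (φ := fun z => ‖φ z‖ₑ) hm.enorm]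
    exact ENNReal.mul_ne_top (by simp) hφ.2.ne
  have hmeas : ∀ γ : SL(2, ℤ), Measurable fun z => φ (γ • z) := fun γ =>
    hm.comp (measurable_const_smul γ)
  have hlt : ∫⁻ z in 𝒟, ∑' γ : SL(2, ℤ), ‖φ (γ • z)‖ₑ < ⊤ := by
    rw [lintegral_tsum fun γ => (hmeas γ).enorm.aemeasurable]
    exact hfin.lt_top
  have hsum : ∀ᵐ z ∂(volume.restrict 𝒟), Summable fun γ : SL(2, ℤ) => φ (γ • z) := by
    have := ae_lt_top' (Measurable.tsum fun γ => (hmeas γ).enorm).aemeasurable hlt.ne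
    filter_upwards [this] with z hz
    refine Summable.of_norm ?_
    have h2 : Summable fun γ : SL(2, ℤ) => ‖φ (γ • z)‖₊ := by
      rw [← ENNReal.tsum_coe_ne_top_iff_summable]
      exact hz.ne
    exact NNReal.summable_coe.2 h2
  refine ⟨hsum, ⟨?_, ?_⟩, ?_⟩
  · exact (Measurable.tsum fun γ => hmeas γ).aestronglyMeasurable
  · refine lt_of_le_of_lt (lintegral_mono_ae ?_) hlt
    filter_upwards [hsum] with z hz
    exact enorm_tsum_le_tsum_enorm
  · rw [integral_tsum (fun γ => (hmeas γ).aestronglyMeasurable) hfin]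
    have hmeas' : ∀ γ : SL(2, ℤ), Measurable fun z => Set.indicator 𝒟 1 (γ⁻¹ • z) * φ z :=
      fun γ =>
        ((measurable_one.indicator measurableSet_fd).comp (measurable_const_smul γ⁻¹)).mul hm
    have h0 : ∀ (γ : SL(2, ℤ)) (z : ℍ), Set.indicator 𝒟 (fun z => φ (γ • z)) z =
        Set.indicator 𝒟 1 (γ⁻¹ • γ • z) * φ (γ • z) := fun γ z => by
      rw [inv_smul_smul, ← indicator_eq_indicator_one_mul 𝒟 (fun z => φ (γ • z))]
    have h1 : ∀ γ : SL(2, ℤ), ∫ z in 𝒟, φ (γ • z) =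
        ∫ z, Set.indicator 𝒟 1 (γ⁻¹ • z) * φ z := by
      intro γ
      rw [← integral_indicator measurableSet_fd]
      refine Eq.trans ?_ ((measurePreserving_smul γ (volume : Measure ℍ)).integral_comp
        (measurableEmbedding_const_smul γ) fun z => Set.indicator 𝒟 1 (γ⁻¹ • z) * φ z)
      exact integral_congr_ae (Eventually.of_forall fun z => h0 γ z)
    simp only [h1]
    rw [← integral_tsum, ← integral_const_mul]
    · refine integral_congr_ae ?_
      filter_upwards [ae_smul_mem_fd_iff] with z ⟨γ₀, hz⟩
      rw [tsum_mul_right]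
      congr 1
      rw [← (Equiv.inv SL(2, ℤ)).tsum_eq]
      have := hasSum_of_pair
        (u := fun γ : SL(2, ℤ) => Set.indicator 𝒟 (1 : ℍ → ℂ) ((γ⁻¹)⁻¹ • z)) (c := 1) γ₀
        (by rw [inv_inv, Set.indicator_of_mem ((hz γ₀).2 (Or.inl rfl))]; rfl) (by
          rw [inv_inv, Set.indicator_of_mem ((hz (-γ₀)).2 (Or.inr rfl))]; rfl) (fun γ h h' => by
          rw [inv_inv, Set.indicator_of_notMem]
          rw [hz γ]; tauto)
      exact this.tsum_eq.trans (by norm_num)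
    · exact fun γ => (hmeas' γ).aestronglyMeasurable
    · convert hfin using 3 with γ
      rw [← lintegral_indicator measurableSet_fd,
        ← (measurePreserving_smul γ (volume : Measure ℍ)).lintegral_comp (hmeas' γ).enorm]
      refine lintegral_congr fun z => ?_
      rw [← h0]
      by_cases h : z ∈ 𝒟 <;> simp [h]

/-- The strip `0 < Re z ≤ 1`. -/
def unitStrip : Set ℍ := {z | z.re ∈ Set.Ioc 0 1}

theorem measurableSet_unitStrip : MeasurableSet unitStrip :=
  (UpperHalfPlane.continuous_re.measurable) measurableSet_Ioc

theorem eq_T_zpow_or_eq_neg_of_mem_parabolicSubgroup {p : SL(2, ℤ)} (hp : p ∈ parabolicSubgroup) :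
    ∃ n : ℤ, p = ModularGroup.T ^ n ∨ p = -ModularGroup.T ^ n := by
  have hc : p 1 0 = 0 := hp
  have had := p.det_coe
  replace had : p 0 0 * p 1 1 = 1 := by rw [Matrix.det_fin_two, hc] at had; lia
  rcases Int.eq_one_or_neg_one_of_mul_eq_one' had with (⟨ha, hd⟩ | ⟨ha, hd⟩)
  · refine ⟨p 0 1, Or.inl ?_⟩
    ext i j; fin_cases i <;> fin_cases j <;>
      simp [ha, hc, hd, ModularGroup.coe_T_zpow, show (1 : Fin (0 + 2)) = (1 : Fin 2) from rfl]
  · refine ⟨-(p 0 1), Or.inr ?_⟩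
    ext i j; fin_cases i <;> fin_cases j <;>
      simp [ha, hc, hd, ModularGroup.coe_T_zpow, show (1 : Fin (0 + 2)) = (1 : Fin 2) from rfl]

theorem T_zpow_mem_parabolicSubgroup (n : ℤ) : ModularGroup.T ^ n ∈ parabolicSubgroup := by
  show (ModularGroup.T ^ n) 1 0 = 0
  simp [ModularGroup.coe_T_zpow]

theorem neg_mem_parabolicSubgroup {p : SL(2, ℤ)} (hp : p ∈ parabolicSubgroup) :
    -p ∈ parabolicSubgroup := by
  show (-p) 1 0 = 0
  have hc : p 1 0 = 0 := hp
  simp [hc]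

theorem im_smul_of_mem_parabolicSubgroup {p : SL(2, ℤ)} (hp : p ∈ parabolicSubgroup) (z : ℍ) :
    (p • z).im = z.im := by
  obtain ⟨n, rfl | rfl⟩ := eq_T_zpow_or_eq_neg_of_mem_parabolicSubgroup hp
  · exact ModularGroup.im_T_zpow_smul z n
  · rw [ModularGroup.SL_neg_smul]; exact ModularGroup.im_T_zpow_smul z n

/-- Since `P = {± T^n}`, each coset of `P` contains exactly two elements, `± T^n γ` for a single
`n`, that move `z` into the strip of width one, and the imaginary part is constant on the coset. The
factor `2` cancels against the one in `integral_fd_tsum_smul`. -/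
theorem tsum_unitStrip_indicator {w : ℂ} {z : ℍ}
    (hs : Summable fun γ : SL(2, ℤ) => unitStrip.indicator (fun z => ((z.im : ℝ) : ℂ) ^ w) (γ • z)) :
    ∑' γ : SL(2, ℤ), unitStrip.indicator (fun z => ((z.im : ℝ) : ℂ) ^ w) (γ • z) =
      2 * eisensteinSum w z := by
  set Q := Quotient (QuotientGroup.rightRel parabolicSubgroup)
  set mkQ : SL(2, ℤ) → Q := Quotient.mk _
  rw [← (Equiv.sigmaFiberEquiv mkQ).tsum_eq, Summable.tsum_sigma, eisensteinSum, ← tsum_mul_left]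
  swap
  · exact (Equiv.sigmaFiberEquiv mkQ).summable_iff.2 hs
  refine tsum_congr fun q => ?_
  -- the two elements of the fibre moving `z` to the strip
  obtain ⟨n₀, hn₀, huniq⟩ := existsUnique_add_zsmul_mem_Ioc (one_pos : (0 : ℝ) < 1) (q.out • z).re 0
  simp only [zsmul_eq_mul, mul_one, zero_add] at hn₀ huniq
  have hmk : ∀ γ : SL(2, ℤ), mkQ γ = q ↔ γ * q.out⁻¹ ∈ parabolicSubgroup := by
    intro γ
    constructor
    · intro h
      have h' : (Quotient.mk (QuotientGroup.rightRel parabolicSubgroup) q.out) = mkQ γ := by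
        rw [Quotient.out_eq]; exact h.symm
      exact QuotientGroup.rightRel_apply.1 (Quotient.exact h')
    · intro h
      exact (Quotient.sound (QuotientGroup.rightRel_apply.2 h)).symm.trans (Quotient.out_eq q)
  have hmem : ∀ n : ℤ, (ModularGroup.T ^ n * q.out) • z ∈ unitStrip ↔ n = n₀ := by
    intro n
    have : ((ModularGroup.T ^ n * q.out) • z).re = (q.out • z).re + n := by
      rw [mul_smul, ModularGroup.re_T_zpow_smul]
    rw [unitStrip, Set.mem_ofPred_eq, this]
    exact ⟨fun h => huniq n h, fun h => h ▸ hn₀⟩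
  have him : ∀ γ : SL(2, ℤ), mkQ γ = q → (γ • z).im = (q.out • z).im := by
    intro γ hγ
    have : γ = (γ * q.out⁻¹) * q.out := by group
    rw [this, mul_smul, im_smul_of_mem_parabolicSubgroup ((hmk γ).1 hγ)]
  have hq0 : mkQ (ModularGroup.T ^ n₀ * q.out) = q := by
    rw [hmk, mul_inv_cancel_right]; exact T_zpow_mem_parabolicSubgroup n₀
  have hq1 : mkQ (-(ModularGroup.T ^ n₀ * q.out)) = q := by
    rw [hmk, neg_mul, mul_inv_cancel_right]
    exact neg_mem_parabolicSubgroup (T_zpow_mem_parabolicSubgroup n₀)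
  have hval : ∀ γ : SL(2, ℤ), mkQ γ = q → γ • z ∈ unitStrip →
      γ = ModularGroup.T ^ n₀ * q.out ∨ γ = -(ModularGroup.T ^ n₀ * q.out) := by
    intro γ hγ hz
    obtain ⟨n, hn⟩ := eq_T_zpow_or_eq_neg_of_mem_parabolicSubgroup ((hmk γ).1 hγ)
    rw [mul_inv_eq_iff_eq_mul, mul_inv_eq_iff_eq_mul, neg_mul] at hn
    have hn' : n = n₀ := by
      rw [← hmem n]
      rcases hn with rfl | rfl
      · exact hz
      · rwa [ModularGroup.SL_neg_smul] at hz
    subst hn'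
    exact hn
  have hfib : ∀ u : SL(2, ℤ) → ℂ, ∑' c : {γ // mkQ γ = q}, u c =
      ∑' γ : SL(2, ℤ), {γ | mkQ γ = q}.indicator u γ := fun u => tsum_subtype {γ | mkQ γ = q} u
  simp only [Equiv.sigmaFiberEquiv_apply]
  rw [hfib fun γ => unitStrip.indicator (fun z => ((z.im : ℝ) : ℂ) ^ w) (γ • z)]
  have key := hasSum_of_pair (u := {γ | mkQ γ = q}.indicator fun γ =>
      unitStrip.indicator (fun z => ((z.im : ℝ) : ℂ) ^ w) (γ • z))
    (c := (((q.out • z).im : ℝ) : ℂ) ^ w) (ModularGroup.T ^ n₀ * q.out) ?_ ?_ ?_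
  · rw [key.tsum_eq]; ring
  · rw [Set.indicator_of_mem (by exact hq0), Set.indicator_of_mem ((hmem n₀).2 rfl), him _ hq0]
  · rw [Set.indicator_of_mem (by exact hq1), Set.indicator_of_mem, him _ hq1]
    rw [ModularGroup.SL_neg_smul]
    exact (hmem n₀).2 rfl
  · intro γ h1 h2
    by_cases hγ : mkQ γ = q
    · rw [Set.indicator_of_mem (by exact hγ), Set.indicator_of_notMem]
      intro hc
      rcases hval γ hγ hc with h | h
      · exact h1 h
      · exact h2 h
    · rw [Set.indicator_of_notMem (by exact hγ)]

/-- Right multiplication by `γ` permutes the cosets; the chosen representatives change only by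
elements of `P`, which preserve the imaginary part. -/
theorem eisensteinSum_smul (w : ℂ) (γ : SL(2, ℤ)) (z : ℍ) :
    eisensteinSum w (γ • z) = eisensteinSum w z := by
  set Q := Quotient (QuotientGroup.rightRel parabolicSubgroup)
  let e : Q ≃ Q :=
    { toFun := Quotient.map (· * γ) fun a b h => by
        rw [← Quotient.eq_iff_equiv, Quotient.eq, QuotientGroup.rightRel_apply] at *
        simpa [mul_assoc] using h
      invFun := Quotient.map (· * γ⁻¹) fun a b h => by
        rw [← Quotient.eq_iff_equiv, Quotient.eq, QuotientGroup.rightRel_apply] at *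
        simpa [mul_assoc] using h
      left_inv := by rintro ⟨a⟩; exact congrArg (Quotient.mk _) (by simp)
      right_inv := by rintro ⟨a⟩; exact congrArg (Quotient.mk _) (by simp) }
  rw [eisensteinSum, eisensteinSum]
  conv_rhs => rw [← e.tsum_eq]
  refine tsum_congr fun q => ?_
  congr 2
  have h : (e q).out * (q.out * γ)⁻¹ ∈ parabolicSubgroup := by
    rw [← QuotientGroup.rightRel_apply]
    refine Quotient.exact ?_
    rw [Quotient.out_eq]
    conv_rhs => rw [← Quotient.out_eq q]
    rfl
  have e2 : (e q).out = ((e q).out * (q.out * γ)⁻¹) * (q.out * γ) := by group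
  have e3 := im_smul_of_mem_parabolicSubgroup h ((q.out * γ) • z)
  rw [← mul_smul, ← e2, mul_smul] at e3
  exact e3.symm

/-- Unfolding of an integral against an Eisenstein series. -/
theorem integral_eisensteinSum_mul {w : ℂ} {h : ℍ → ℂ} (hm : Measurable h)
    (hinv : ∀ (γ : SL(2, ℤ)) (z : ℍ), h (γ • z) = h z)
    (hint : IntegrableOn (fun z : ℍ => ((z.im : ℝ) : ℂ) ^ w * h z) unitStrip) :
    ∫ z in 𝒟, eisensteinSum w z * h z =
      ∫ z in unitStrip, ((z.im : ℝ) : ℂ) ^ w * h z := by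
  have him : Measurable fun z : ℍ => ((z.im : ℝ) : ℂ) ^ w := by
    have := UpperHalfPlane.continuous_im.measurable
    fun_prop
  obtain ⟨h1, h2, h3⟩ := integral_fd_tsum_smul
    (φ := unitStrip.indicator fun z : ℍ => ((z.im : ℝ) : ℂ) ^ w * h z)
    ((him.mul hm).indicator measurableSet_unitStrip)
    ((integrable_indicator_iff measurableSet_unitStrip).2 hint)
  rw [integral_indicator measurableSet_unitStrip] at h3
  have e : ∀ (z : ℍ) (γ : SL(2, ℤ)), unitStrip.indicator (fun z : ℍ => ((z.im : ℝ) : ℂ) ^ w * h z) (γ • z) =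
      unitStrip.indicator (fun z : ℍ => ((z.im : ℝ) : ℂ) ^ w) (γ • z) * h z := by
    intro z γ
    by_cases hz : γ • z ∈ unitStrip
    · rw [Set.indicator_of_mem hz, Set.indicator_of_mem hz, hinv]
    · rw [Set.indicator_of_notMem hz, Set.indicator_of_notMem hz, zero_mul]
  have h4 : ∫ z in 𝒟, ∑' γ : SL(2, ℤ),
      unitStrip.indicator (fun z : ℍ => ((z.im : ℝ) : ℂ) ^ w * h z) (γ • z) =
      ∫ z in 𝒟, 2 * (eisensteinSum w z * h z) := by
    refine integral_congr_ae ?_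
    filter_upwards [h1] with z hz
    simp only [e] at hz ⊢
    -- Where `h z ≠ 0`, summability of the Eisenstein family follows by dividing by `h z`; elsewhere
    -- both sides vanish, so its convergence need not be known.
    by_cases h0 : h z = 0
    · simp [h0]
    · rw [tsum_mul_right, tsum_unitStrip_indicator ((summable_mul_right_iff h0).1 hz)]
      ring
  rw [h4, integral_const_mul] at h3
  exact mul_left_cancel₀ two_ne_zero h3

/-! ### Fourier coefficients of functions on a strip -/

/-- The coefficient `∫_0^1 h(x + i y) exp(-2 π i n x) dx`. -/
def stripCoeff (h : ℂ → ℂ) (n : ℤ) (y : ℝ) : ℂ :=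
  ∫ x in (0 : ℝ)..1, h (x + y * Complex.I) * fourierExp (-n) x

theorem fourierCoeffAt_eq_stripCoeff (f : ℍ → ℂ) (n : ℤ) (y : ℝ) :
    fourierCoeffAt f n y = stripCoeff (f ∘ ofComplex) n y := rfl

theorem isOpen_im_pos : IsOpen {z : ℂ | 0 < z.im} :=
  isOpen_lt continuous_const Complex.continuous_im

theorem norm_fourierExp (n : ℤ) (x : ℝ) : ‖fourierExp n x‖ = 1 := by
  rw [fourierExp, Complex.norm_exp]
  simp

theorem hasDerivAt_fourierExp (n : ℤ) (x : ℝ) :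
    HasDerivAt (fourierExp n) (2 * Real.pi * Complex.I * n * fourierExp n x) x := by
  have h : HasDerivAt (fun x : ℝ => 2 * Real.pi * Complex.I * n * (x : ℂ))
      (2 * Real.pi * Complex.I * n * 1) x := (Complex.ofRealCLM.hasDerivAt (x := x)).const_mul _
  have h2 := h.cexp
  refine h2.congr_deriv ?_
  rw [fourierExp]; ring

@[fun_prop]
theorem continuous_fourierExp (n : ℤ) : Continuous (fourierExp n) := by
  unfold fourierExp; fun_prop

theorem fourierExp_one (n : ℤ) : fourierExp n 1 = 1 := by
  rw [fourierExp, Complex.exp_eq_one_iff]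
  exact ⟨n, by push_cast; ring⟩

theorem fourierExp_zero_right (n : ℤ) : fourierExp n 0 = 1 := by simp [fourierExp]

theorem continuousOn_horizontal {h : ℂ → ℂ} (hh : ContinuousOn h {z : ℂ | 0 < z.im}) {y : ℝ}
    (hy : 0 < y) : Continuous fun x : ℝ => h (x + y * Complex.I) :=
  hh.comp_continuous (by fun_prop) fun x => by simpa using hy

theorem intervalIntegrable_stripCoeff {h : ℂ → ℂ} (hh : ContinuousOn h {z : ℂ | 0 < z.im}) (n : ℤ)
    {y : ℝ} (hy : 0 < y) (a b : ℝ) :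
    IntervalIntegrable (fun x : ℝ => h (x + y * Complex.I) * fourierExp (-n) x) volume a b :=
  ((continuousOn_horizontal hh hy).mul (continuous_fourierExp _)).intervalIntegrable _ _

theorem norm_stripCoeff_le {h : ℂ → ℂ} {n : ℤ} {y C : ℝ}
    (hC : ∀ x ∈ Set.Ioc (0 : ℝ) 1, ‖h (x + y * Complex.I)‖ ≤ C) : ‖stripCoeff h n y‖ ≤ C := by
  have := intervalIntegral.norm_integral_le_of_norm_le_const (a := (0 : ℝ)) (b := 1) (C := C)
    (f := fun x : ℝ => h (x + y * Complex.I) * fourierExp (-n) x) (fun x hx => by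
      rw [Set.uIoc_of_le zero_le_one] at hx
      rw [norm_mul, norm_fourierExp, mul_one]; exact hC x hx)
  simpa [stripCoeff] using this

theorem exists_bound_horizontal {h : ℂ → ℂ} (hh : ContinuousOn h {z : ℂ | 0 < z.im}) {a b : ℝ}
    (ha : 0 < a) : ∃ C, ∀ x ∈ Set.Icc (0 : ℝ) 1, ∀ y ∈ Set.Icc a b,
      ‖h (x + y * Complex.I)‖ ≤ C := by
  have hK : IsCompact ((fun p : ℝ × ℝ => (p.1 : ℂ) + p.2 * Complex.I) ''
      (Set.Icc 0 1 ×ˢ Set.Icc a b)) :=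
    (isCompact_Icc.prod isCompact_Icc).image (by fun_prop)
  obtain ⟨C, hC⟩ := hK.exists_bound_of_continuousOn (hh.mono (by
    rintro _ ⟨p, hp, rfl⟩
    have : a ≤ p.2 := hp.2.1
    simp; linarith))
  exact ⟨C, fun x hx y hy => hC _ ⟨(x, y), ⟨hx, hy⟩, rfl⟩⟩

theorem contDiffOn_fderiv_apply {h : ℂ → ℂ} (hh : ContDiffOn ℝ ∞ h {z : ℂ | 0 < z.im}) (v : ℂ) :
    ContDiffOn ℝ ∞ (fun z => fderiv ℝ h z v) {z : ℂ | 0 < z.im} :=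
  (hh.fderiv_of_isOpen isOpen_im_pos (by simp)).clm_apply contDiffOn_const

theorem hasFDerivAt_of_contDiffOn {h : ℂ → ℂ} (hh : ContDiffOn ℝ ∞ h {z : ℂ | 0 < z.im}) {z : ℂ}
    (hz : 0 < z.im) : HasFDerivAt h (fderiv ℝ h z) z :=
  ((hh.differentiableOn (by simp)).differentiableAt (isOpen_im_pos.mem_nhds hz)).hasFDerivAt

theorem hasDerivAt_stripCoeff {h : ℂ → ℂ} (hh : ContDiffOn ℝ ∞ h {z : ℂ | 0 < z.im}) (n : ℤ)
    {y : ℝ} (hy : 0 < y) :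
    HasDerivAt (stripCoeff h n) (stripCoeff (fun z => fderiv ℝ h z Complex.I) n y) y := by
  have hc := (contDiffOn_fderiv_apply hh Complex.I).continuousOn
  obtain ⟨C, hC⟩ := exists_bound_horizontal hc (a := y / 2) (b := 2 * y) (by positivity)
  refine (intervalIntegral.hasDerivAt_integral_of_dominated_loc_of_deriv_le (𝕜 := ℝ) (μ := volume)
    (F := fun t x => h (x + t * Complex.I) * fourierExp (-n) x)
    (F' := fun t x => fderiv ℝ h (x + t * Complex.I) Complex.I * fourierExp (-n) x)
    (s := Set.Ioo (y / 2) (2 * y)) (bound := fun _ => C)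
    (Ioo_mem_nhds (by linarith) (by linarith)) ?_ ?_ ?_ ?_ ?_ ?_).2
  · filter_upwards [eventually_gt_nhds hy] with t ht
    exact ((continuousOn_horizontal hh.continuousOn ht).mul
      (continuous_fourierExp _)).aestronglyMeasurable
  · exact intervalIntegrable_stripCoeff hh.continuousOn n hy _ _
  · exact ((continuousOn_horizontal hc hy).mul (continuous_fourierExp _)).aestronglyMeasurable
  · refine Eventually.of_forall fun x hx t ht => ?_
    rw [Set.uIoc_of_le zero_le_one] at hx
    rw [norm_mul, norm_fourierExp, mul_one]
    exact hC x ⟨hx.1.le, hx.2⟩ t ⟨ht.1.le, ht.2.le⟩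
  · exact intervalIntegrable_const
  · refine Eventually.of_forall fun x _ t ht => ?_
    have ht0 : 0 < t := by have := ht.1; linarith
    have h1 := hasFDerivAt_of_contDiffOn hh (z := x + t * Complex.I) (by simpa using ht0)
    have h2 : HasDerivAt (fun t : ℝ => (x : ℂ) + t * Complex.I) (1 * Complex.I) t :=
      ((Complex.ofRealCLM.hasDerivAt (x := t)).mul_const Complex.I).const_add _
    have h3 := (h1.comp_hasDerivAt t h2).mul_const (fourierExp (-n) x)
    rwa [one_mul] at h3

/-- Integration by parts over a full period, where the boundary terms cancel. -/
theorem stripCoeff_fderiv_one {h : ℂ → ℂ} (hh : ContDiffOn ℝ ∞ h {z : ℂ | 0 < z.im})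
    (hper : ∀ z : ℂ, 0 < z.im → h (z + 1) = h z) (n : ℤ) {y : ℝ} (hy : 0 < y) :
    stripCoeff (fun z => fderiv ℝ h z 1) n y = 2 * Real.pi * Complex.I * n * stripCoeff h n y := by
  have hder : ∀ x : ℝ, HasDerivAt (fun x : ℝ => h (x + y * Complex.I) * fourierExp (-n) x)
      (fderiv ℝ h (x + y * Complex.I) 1 * fourierExp (-n) x +
        h (x + y * Complex.I) * (2 * Real.pi * Complex.I * (-n : ℤ) * fourierExp (-n) x)) x := by
    intro x
    have h1 := hasFDerivAt_of_contDiffOn hh (z := x + y * Complex.I) (by simpa using hy)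
    have h2 : HasDerivAt (fun x : ℝ => (x : ℂ) + y * Complex.I) 1 x :=
      (Complex.ofRealCLM.hasDerivAt (x := x)).add_const _
    exact (h1.comp_hasDerivAt x h2).mul (hasDerivAt_fourierExp (-n) x)
  have c1 := intervalIntegrable_stripCoeff (contDiffOn_fderiv_apply hh 1).continuousOn n hy 0 1
  have c2 := intervalIntegrable_stripCoeff hh.continuousOn n hy 0 1
  have e : ∀ x : ℝ, h (x + y * Complex.I) *
      (2 * Real.pi * Complex.I * (-n : ℤ) * fourierExp (-n) x) =
      -(2 * Real.pi * Complex.I * n) * (h (x + y * Complex.I) * fourierExp (-n) x) := by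
    intro x; push_cast; ring
  have key := intervalIntegral.integral_eq_sub_of_hasDerivAt (a := 0) (b := 1)
    (fun x _ => hder x) (by simp only [e]; exact c1.add (c2.const_mul _))
  simp only [e] at key
  rw [intervalIntegral.integral_add c1 (c2.const_mul _), intervalIntegral.integral_const_mul] at key
  have hp := hper (y * Complex.I) (by simpa using hy)
  simp only [fourierExp_one, fourierExp_zero_right, Complex.ofReal_one, Complex.ofReal_zero,
    zero_add, add_comm (1 : ℂ), hp, sub_self] at key
  rw [stripCoeff, stripCoeff]
  linear_combination key

theorem fderiv_apply_periodic {h : ℂ → ℂ} (hper : ∀ z : ℂ, 0 < z.im → h (z + 1) = h z) (v z : ℂ)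
    (hz : 0 < z.im) : fderiv ℝ h (z + 1) v = fderiv ℝ h z v := by
  rw [← fderiv_comp_add_right]
  congr 1
  refine Filter.EventuallyEq.fderiv_eq ?_
  filter_upwards [isOpen_im_pos.mem_nhds hz] with w hw using hper w hw

theorem laplacian_eq_fderiv {h : ℂ → ℂ} (hh : ContDiffOn ℝ ∞ h {z : ℂ | 0 < z.im}) {z : ℂ}
    (hz : 0 < z.im) : Laplacian.laplacian h z =
      fderiv ℝ (fun w => fderiv ℝ h w 1) z 1 +
        fderiv ℝ (fun w => fderiv ℝ h w Complex.I) z Complex.I := by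
  have hd : DifferentiableAt ℝ (fderiv ℝ h) z :=
    ((hh.fderiv_of_isOpen (m := ∞) isOpen_im_pos (by simp)).differentiableOn
      (by simp)).differentiableAt (isOpen_im_pos.mem_nhds hz)
  have e : ∀ v, fderiv ℝ (fun w => fderiv ℝ h w v) z v = fderiv ℝ (fderiv ℝ h) z v v := by
    intro v
    rw [fderiv_clm_apply hd (differentiableAt_const v)]
    simp
  rw [InnerProductSpace.laplacian_eq_iteratedFDeriv_complexPlane, e, e]
  simp [iteratedFDeriv_two_apply]

/-! ### Fourier analysis of cusp forms -/

theorem ofComplex_coe_add_one {z : ℂ} (hz : 0 < z.im) :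
    ofComplex (z + 1) = ModularGroup.T • ofComplex z := by
  have hz' : 0 < (z + 1).im := by simpa using hz
  ext1
  rw [modular_T_smul, coe_vadd, ofComplex_apply_of_im_pos hz, ofComplex_apply_of_im_pos hz', coe_mk, coe_mk,
    Complex.ofReal_one, add_comm]

theorem comp_ofComplex_periodic {f : ℍ → ℂ} (hf : ∀ (γ : SL(2, ℤ)) (z : ℍ), f (γ • z) = f z) {z : ℂ}
    (hz : 0 < z.im) : (f ∘ ofComplex) (z + 1) = (f ∘ ofComplex) z := by
  rw [Function.comp_apply, Function.comp_apply, ofComplex_coe_add_one hz, hf]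

theorem stripCoeff_const_mul_sub {h₁ h₂ h : ℂ → ℂ} {c : ℂ} {n : ℤ} {y : ℝ} (hy : 0 < y)
    (h1 : ContinuousOn h₁ {z : ℂ | 0 < z.im}) (h2 : ContinuousOn h₂ {z : ℂ | 0 < z.im})
    (e : ∀ x : ℝ, h (x + y * Complex.I) =
      c * h₁ (x + y * Complex.I) - h₂ (x + y * Complex.I)) :
    stripCoeff h n y = c * stripCoeff h₁ n y - stripCoeff h₂ n y := by
  rw [stripCoeff, stripCoeff, stripCoeff, ← intervalIntegral.integral_const_mul,
    ← intervalIntegral.integral_sub ((intervalIntegrable_stripCoeff h1 n hy 0 1).const_mul c)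
      (intervalIntegrable_stripCoeff h2 n hy 0 1)]
  refine intervalIntegral.integral_congr fun x _ => ?_
  simp only [e]; ring

theorem sq_norm_intervalIntegral_le {g : ℝ → ℂ} (hg : Continuous g) :
    ‖∫ x in (0 : ℝ)..1, g x‖ ^ 2 ≤ ∫ x in (0 : ℝ)..1, ‖g x‖ ^ 2 := by
  set c : ℝ := ∫ x in (0 : ℝ)..1, ‖g x‖ with hc
  have h1 : ‖∫ x in (0 : ℝ)..1, g x‖ ≤ c :=
    intervalIntegral.norm_integral_le_integral_norm zero_le_one
  have i1 : IntervalIntegrable (fun x => ‖g x‖ ^ 2) volume 0 1 :=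
    (by fun_prop : Continuous fun x => ‖g x‖ ^ 2).intervalIntegrable _ _
  have i2 : IntervalIntegrable (fun x => 2 * c * ‖g x‖) volume 0 1 :=
    (by fun_prop : Continuous fun x => 2 * c * ‖g x‖).intervalIntegrable _ _
  have h2 : 0 ≤ ∫ x in (0 : ℝ)..1, (‖g x‖ ^ 2 - 2 * c * ‖g x‖ + c ^ 2) := by
    refine intervalIntegral.integral_nonneg zero_le_one fun x _ => ?_
    nlinarith [sq_nonneg (‖g x‖ - c)]
  rw [intervalIntegral.integral_add (i1.sub i2) intervalIntegrable_const,
    intervalIntegral.integral_sub i1 i2, intervalIntegral.integral_const_mul, ← hc] at h2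
  simp only [intervalIntegral.integral_const, sub_zero, one_smul] at h2
  have h3 : ‖∫ x in (0 : ℝ)..1, g x‖ ^ 2 ≤ c ^ 2 := by gcongr
  nlinarith

theorem halfPlanePoint_coe {y x : ℝ} (hy : 0 < y) :
    ((halfPlanePoint (y, x) : ℍ) : ℂ) = (x : ℂ) + y * Complex.I := by
  rw [halfPlanePoint, ofComplex_apply_of_im_pos (by simpa using hy)]

theorem halfPlanePoint_im {y x : ℝ} (hy : 0 < y) : (halfPlanePoint (y, x)).im = y := by
  rw [← coe_im, halfPlanePoint_coe hy]; simp

theorem halfPlanePoint_re {y x : ℝ} (hy : 0 < y) : (halfPlanePoint (y, x)).re = x := by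
  rw [← coe_re, halfPlanePoint_coe hy]; simp

theorem halfPlanePoint_re_im (z : ℍ) : halfPlanePoint (z.im, z.re) = z := by
  ext1
  rw [halfPlanePoint_coe z.im_pos]
  apply Complex.ext <;> simp

theorem integrable_heightMeasure_iff (G : ℝ → ℝ) :
    Integrable G heightMeasure ↔ IntegrableOn (fun y => G y / y ^ 2) (Set.Ioi 0) := by
  rw [heightMeasure, integrable_withDensity_iff_integrable_smul₀' (by fun_prop)
    (Eventually.of_forall fun y => ENNReal.ofReal_lt_top), IntegrableOn]
  refine integrable_congr (Eventually.of_forall fun y => ?_)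
  simp only
  rw [ENNReal.toReal_ofReal (by positivity), smul_eq_mul]
  ring

namespace IsMaassCuspForm

variable {s : ℂ} {f : ℍ → ℂ}

theorem continuousOn (hf : IsMaassCuspForm s f) : ContinuousOn (f ∘ ofComplex) {z : ℂ | 0 < z.im} := hf.smooth.continuousOn

theorem continuous (hf : IsMaassCuspForm s f) : Continuous f := by
  have : f = fun z : ℍ => (f ∘ ofComplex) (z : ℂ) := by
    funext z; simp
  rw [this]
  exact hf.continuousOn.comp_continuous continuous_coe fun z => z.im_pos

theorem hasDerivAt_fourierCoeffAt (hf : IsMaassCuspForm s f) (n : ℤ) {y : ℝ} (hy : 0 < y) :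
    HasDerivAt (fourierCoeffAt f n)
      (stripCoeff (fun z => fderiv ℝ (f ∘ ofComplex) z Complex.I) n y) y :=
  hasDerivAt_stripCoeff hf.smooth n hy

/-- The eigenvalue equation reads `f_yy = s(s-1) y^(-2) f - f_xx`, and `∂_x` acts on the `n`-th
coefficient as `2πin`. Writing `s(s-1)` as `(s-1/2)² - 1/4` matches the equation of `√y
K_(s-1/2)(2π|n|y)`. -/
theorem hasDerivAt_deriv_fourierCoeffAt (hf : IsMaassCuspForm s f) (n : ℤ) {y : ℝ} (hy : 0 < y) :
    HasDerivAt (stripCoeff (fun z => fderiv ℝ (f ∘ ofComplex) z Complex.I) n)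
      ((4 * Real.pi ^ 2 * (|(n : ℝ)| : ℝ) ^ 2 + ((s - 1 / 2) ^ 2 - 1 / 4) / (y : ℂ) ^ 2) *
        fourierCoeffAt f n y) y := by
  refine (hasDerivAt_stripCoeff (contDiffOn_fderiv_apply hf.smooth Complex.I) n hy).congr_deriv ?_
  have hper := fun z hz => comp_ofComplex_periodic hf.invariant (z := z) hz
  have c1 := contDiffOn_fderiv_apply hf.smooth 1
  have c2 := contDiffOn_fderiv_apply c1 1
  rw [stripCoeff_const_mul_sub (h₁ := f ∘ ofComplex)
    (h₂ := fun z => fderiv ℝ (fun w => fderiv ℝ (f ∘ ofComplex) w 1) z 1)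
    (c := s * (s - 1) / (y : ℂ) ^ 2) hy hf.continuousOn c2.continuousOn,
    stripCoeff_fderiv_one c1 (fun z hz => fderiv_apply_periodic hper 1 z hz) n hy,
    stripCoeff_fderiv_one hf.smooth hper n hy, fourierCoeffAt_eq_stripCoeff]
  · have : (((|(n : ℝ)| : ℝ) : ℂ)) ^ 2 = (n : ℂ) ^ 2 := by
      rw [← Complex.ofReal_pow, sq_abs]; push_cast; rfl
    rw [this]
    have hI := Complex.I_sq
    linear_combination (-(4 * Real.pi ^ 2 * n ^ 2 * stripCoeff (f ∘ ofComplex) n y)) * hI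
  · intro x
    have hz : 0 < ((x : ℂ) + y * Complex.I).im := by simpa using hy
    have h := hf.eigen (ofComplex (x + y * Complex.I))
    rw [ofComplex_apply_of_im_pos hz, coe_mk, laplacian_eq_fderiv hf.smooth hz] at h
    have him : UpperHalfPlane.im ⟨(x : ℂ) + y * Complex.I, hz⟩ = y := by
      rw [← coe_im, coe_mk]; simp
    rw [him] at h
    have hy' : (y : ℂ) ≠ 0 := by exact_mod_cast hy.ne'
    rw [Function.comp_apply, ofComplex_apply_of_im_pos hz]
    field_simp
    linear_combination h

/-- The half-strip of width one above height `1` lies in `𝒟`, so this is Cauchy-Schwarz on each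
horizontal segment combined with the `L²` condition. -/
theorem integrable_sq_norm_fourierCoeffAt (hf : IsMaassCuspForm s f) (n : ℤ) :
    IntegrableOn (fun y => ‖fourierCoeffAt f n y‖ ^ 2 / y ^ 2) (Set.Ioi 1) := by
  set b : ℝ → ℝ := fun y => ∫ x in (-(1 / 2) : ℝ)..(1 / 2), ‖f (halfPlanePoint (y, x))‖ ^ 2
  set D : Set ℍ := {z : ℍ | z.re ∈ Set.Ioc (-(1 / 2)) (1 / 2) ∧ 1 < z.im} with hD
  have hDm : MeasurableSet D :=
    (UpperHalfPlane.continuous_re.measurable measurableSet_Ioc).inter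
      (UpperHalfPlane.continuous_im.measurable measurableSet_Ioi)
  have hsub : D ⊆ 𝒟 := by
    rintro z ⟨⟨h1, h2⟩, h3⟩
    refine ⟨?_, abs_le.2 ⟨h1.le, h2⟩⟩
    rw [Complex.normSq_apply]
    have : 1 < (z : ℂ).im := h3
    nlinarith [mul_self_nonneg (z : ℂ).re]
  have hi : Integrable (D.indicator fun z => ‖f z‖ ^ 2) := by
    rw [integrable_indicator_iff hDm]
    have h1 := hf.memLp.norm.integrable_sq
    exact (show IntegrableOn (fun z => ‖f z‖ ^ 2) 𝒟 volume from h1).mono_set hsub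
  have hi' : Integrable fun z => ((D.indicator (fun z => ‖f z‖ ^ 2) z : ℝ) : ℂ) := hi.ofReal
  rw [integrable_halfPlane_iff hi'.aestronglyMeasurable] at hi'
  have h2 := hi'.re.integral_prod_left
  simp only [RCLike.re_to_complex, Complex.ofReal_re] at h2
  have h3 := (integrable_heightMeasure_iff _).1 h2
  have h4 : IntegrableOn (fun y => b y / y ^ 2) (Set.Ioi 1) := by
    refine (h3.mono_set (Set.Ioi_subset_Ioi zero_le_one)).congr_fun (fun y hy => ?_) measurableSet_Ioi
    have hy1 : 1 < y := hy
    have hy0 : 0 < y := one_pos.trans hy1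
    simp only [b]
    rw [intervalIntegral.integral_of_le (by norm_num), ← integral_indicator measurableSet_Ioc]
    congr 2
    funext x
    simp only [Set.indicator_apply, hD, Set.mem_ofPred_eq, halfPlanePoint_re hy0, halfPlanePoint_im hy0,
      hy1, and_true]
  refine h4.mono' ?_ ?_
  · refine ContinuousOn.aestronglyMeasurable (fun y hy => ContinuousAt.continuousWithinAt ?_)
      measurableSet_Ioi
    have hy0 : 0 < y := one_pos.trans hy
    exact ((hf.hasDerivAt_fourierCoeffAt n hy0).continuousAt.norm.pow 2).div
      (by fun_prop) (by positivity)
  · filter_upwards [ae_restrict_mem measurableSet_Ioi] with y hy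
    have hy0 : 0 < y := one_pos.trans hy
    rw [Real.norm_of_nonneg (by positivity)]
    gcongr
    have hc := continuousOn_horizontal hf.continuousOn hy0
    have h5 := sq_norm_intervalIntegral_le (hc.mul (continuous_fourierExp (-n)))
    refine h5.trans_eq ?_
    simp only [Pi.mul_apply, norm_mul, norm_fourierExp, mul_one, b]
    -- Coefficients are taken over `[0, 1]` but the fundamental domain sits over `[-1/2, 1/2]`;
    -- periodicity moves one segment to the other.
    have hp : Function.Periodic (fun x : ℝ => ‖(f ∘ ofComplex) (x + y * Complex.I)‖ ^ 2) 1 := by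
      intro x
      have := comp_ofComplex_periodic hf.invariant (z := x + y * Complex.I) (by simpa using hy0)
      simp only
      rw [← this]; push_cast
      rw [add_right_comm]
    have := hp.intervalIntegral_add_eq 0 (-(1 / 2))
    rw [zero_add, show (-(1 / 2) : ℝ) + 1 = 1 / 2 by norm_num] at this
    exact this

end IsMaassCuspForm

/-! ### Decay, Bessel form and summability of the Fourier coefficients -/

namespace IsMaassCuspForm

variable {s : ℂ} {f : ℍ → ℂ}

/-- In `q = 4π²n² + l/y²` with `l = s(s-1)` the second term has modulus at most `1` once `y ≥ 1 +
|l|`, so `Re q ≥ 2(πn)²` there. The threshold does not depend on `n`, which allows the bounds to be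
summed over `n`. -/
theorem exists_norm_fourierCoeffAt_le (s : ℂ) : ∃ y₀ : ℝ, 1 ≤ y₀ ∧ ∀ (f : ℍ → ℂ), IsMaassCuspForm s f →
    ∀ (n : ℤ), n ≠ 0 → ∀ y, y₀ ≤ y → ‖fourierCoeffAt f n y‖ ≤
      ‖fourierCoeffAt f n y₀‖ * Real.exp (-(Real.pi * |(n : ℝ)| * (y - y₀))) := by
  set l : ℂ := (s - 1 / 2) ^ 2 - 1 / 4 with hl
  have hy1 : 1 ≤ 1 + ‖l‖ := by linarith [norm_nonneg l]
  refine ⟨1 + ‖l‖, hy1, fun f hf n hn y hy => ?_⟩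
  have hn1 : (1 : ℝ) ≤ |(n : ℝ)| := by exact_mod_cast Int.one_le_abs hn
  refine norm_le_exp_of_deriv_eq (by positivity) (by positivity)
    (fun y hy => hf.hasDerivAt_fourierCoeffAt n hy)
    (fun y hy => hf.hasDerivAt_deriv_fourierCoeffAt n hy) (fun t ht => ?_)
    ((hf.integrable_sq_norm_fourierCoeffAt n).mono_set (Set.Ioi_subset_Ioi hy1)) hy
  rw [← hl]
  have ht1 : 1 ≤ t := hy1.trans ht
  have h1 : ‖l / (t : ℂ) ^ 2‖ ≤ 1 := by
    rw [norm_div, norm_pow, Complex.norm_real, Real.norm_of_nonneg (by linarith), div_le_one (by positivity)]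
    nlinarith
  have h2 := (abs_le.1 ((Complex.abs_re_le_norm _).trans h1)).1
  rw [Complex.add_re]
  have h3 : ((4 * Real.pi ^ 2 * (|(n : ℝ)| : ℝ) ^ 2 : ℂ)).re = 4 * Real.pi ^ 2 * |(n : ℝ)| ^ 2 := by
    exact_mod_cast Complex.ofReal_re _
  rw [h3]
  have hpi := Real.pi_gt_three
  have h4 : 1 ≤ Real.pi ^ 2 * |(n : ℝ)| ^ 2 := by
    rw [← mul_pow]; exact one_le_pow₀ (by nlinarith)
  nlinarith

/-- Boundedness of the coefficient against exponential decay of the Bessel solution and its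
derivative is what the Wronskian argument requires. -/
theorem exists_fourierCoeffAt_eq (hf : IsMaassCuspForm s f) {n : ℤ} (hn : n ≠ 0) :
    ∃ c : ℂ, ∀ y : ℝ, 0 < y → fourierCoeffAt f n y =
      c * ((Real.sqrt y : ℂ) * besselK (s - 1 / 2) (|(n : ℝ)| * y)) := by
  obtain ⟨y₀, hy₀, hb⟩ := exists_norm_fourierCoeffAt_le s
  have hr : 0 < |(n : ℝ)| := by positivity
  set r := |(n : ℝ)| with hrdef
  set ν := s - 1 / 2 with hν
  have hbd : IsBoundedUnder (· ≤ ·) atTop (norm ∘ fourierCoeffAt f n) := by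
    refine ⟨‖fourierCoeffAt f n y₀‖, ?_⟩
    rw [eventually_map]
    filter_upwards [eventually_ge_atTop y₀] with y hy
    refine (hb f hf n hn y hy).trans (mul_le_of_le_one_right (norm_nonneg _) ?_)
    rw [Real.exp_le_one_iff, neg_nonpos]
    have : 0 ≤ y - y₀ := by linarith
    positivity
  have hsq : ∀ k, Tendsto (fun y : ℝ => (Real.sqrt y : ℂ) * besselMoment k ν (r * y)) atTop (𝓝 0) := by
    intro k
    have h1 := tendsto_besselMoment_mul_zero k ν hr 1
    refine squeeze_zero_norm' ?_ (tendsto_zero_iff_norm_tendsto_zero.1 h1)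
    filter_upwards [eventually_ge_atTop 1] with y hy
    rw [norm_mul, norm_mul, pow_one, Complex.norm_real, Complex.norm_real,
      Real.norm_of_nonneg (Real.sqrt_nonneg _), Real.norm_of_nonneg (by linarith)]
    gcongr
    rw [Real.sqrt_le_left (by linarith)]
    nlinarith
  refine exists_eq_mul_of_deriv_eq (fun y hy => hf.hasDerivAt_fourierCoeffAt n hy)
    (fun y hy => hf.hasDerivAt_deriv_fourierCoeffAt n hy)
    (fun y hy => hasDerivAt_sqrt_mul_besselK ν hr hy)
    (fun y hy => hasDerivAt_besselSqrtDeriv ν hr hy) ?_ ?_ ?_ ?_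
  · refine ContinuousOn.add (by fun_prop) (ContinuousOn.div (by fun_prop) (by fun_prop) ?_)
    intro y hy
    have : (y : ℂ) ≠ 0 := by exact_mod_cast (ne_of_gt hy)
    positivity
  · simp only [mul_comm (fourierCoeffAt f n _)]
    exact (hsq 0).zero_mul_isBoundedUnder_le hbd
  · simp only [mul_comm (fourierCoeffAt f n _)]
    refine Tendsto.zero_mul_isBoundedUnder_le ?_ hbd
    have h0 : Tendsto (fun y : ℝ => ((1 / (2 * Real.sqrt y) : ℝ) : ℂ) * besselK ν (r * y)) atTop (𝓝 0) := by
      have h1 := tendsto_besselMoment_mul_zero 0 ν hr 0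
      refine squeeze_zero_norm' ?_ (tendsto_zero_iff_norm_tendsto_zero.1 h1)
      filter_upwards [eventually_ge_atTop 1] with y hy
      rw [norm_mul, pow_zero, one_mul, Complex.norm_real, Real.norm_of_nonneg (by positivity)]
      refine mul_le_of_le_one_left (norm_nonneg _) ?_
      have : 1 ≤ Real.sqrt y := Real.one_le_sqrt.2 hy
      rw [div_le_one (by positivity)]; linarith
    have h2 := h0.sub ((hsq 1).const_mul (2 * Real.pi * r : ℂ))
    rw [mul_zero, sub_zero] at h2
    refine h2.congr fun y => ?_
    rw [besselSqrtDeriv]; push_cast; ring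
  · obtain ⟨y, hy, hne⟩ := exists_besselK_ne_zero ν
    refine ⟨y / r, by positivity, ?_⟩
    rw [mul_div_cancel₀ _ hr.ne']
    refine mul_ne_zero ?_ hne
    exact_mod_cast (Real.sqrt_pos.2 (by positivity)).ne'

/-- Two integrations by parts in `x`; quadratic decay in `n` makes the Fourier series absolutely
convergent on every horizontal line, however low. -/
theorem exists_sq_mul_norm_fourierCoeffAt_le (hf : IsMaassCuspForm s f) {y : ℝ} (hy : 0 < y) :
    ∃ C, ∀ n : ℤ, (n : ℝ) ^ 2 * ‖fourierCoeffAt f n y‖ ≤ C := by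
  have hper := fun z hz => comp_ofComplex_periodic hf.invariant (z := z) hz
  have c1 := contDiffOn_fderiv_apply hf.smooth 1
  obtain ⟨C, hC⟩ := exists_bound_horizontal (contDiffOn_fderiv_apply c1 1).continuousOn
    (a := y) (b := y) hy
  refine ⟨C, fun n => ?_⟩
  have h1 := stripCoeff_fderiv_one c1 (fun z hz => fderiv_apply_periodic hper 1 z hz) n hy
  rw [stripCoeff_fderiv_one hf.smooth hper n hy] at h1
  have h2 := norm_stripCoeff_le (h := fun z => fderiv ℝ (fun w => fderiv ℝ (f ∘ ofComplex) w 1) z 1) (n := n)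
    (y := y) (C := C) (fun x hx => hC x ⟨hx.1.le, hx.2⟩ y ⟨le_rfl, le_rfl⟩)
  rw [h1, ← fourierCoeffAt_eq_stripCoeff] at h2
  simp only [norm_mul, Complex.norm_I, Complex.norm_ofNat, Complex.norm_real, mul_one,
    Real.norm_of_nonneg Real.pi_pos.le, Complex.norm_intCast] at h2
  refine le_trans ?_ h2
  rw [← sq_abs]
  have hpi := Real.pi_gt_three
  have h3 : 0 ≤ |(n : ℝ)| ^ 2 * ‖fourierCoeffAt f n y‖ := by positivity
  nlinarith [mul_le_mul_of_nonneg_right (show (1 : ℝ) ≤ 4 * Real.pi ^ 2 by nlinarith) h3]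

theorem summable_norm_fourierCoeffAt (hf : IsMaassCuspForm s f) {y : ℝ} (hy : 0 < y) :
    Summable fun n : ℤ => ‖fourierCoeffAt f n y‖ := by
  obtain ⟨C, hC⟩ := hf.exists_sq_mul_norm_fourierCoeffAt_le hy
  have h1 : Summable fun n : ℤ => C * (1 / (n : ℝ) ^ 2) :=
    ((Real.summable_one_div_int_pow (p := 2)).2 (by norm_num)).mul_left C
  refine (summable_congr_cofinite ?_).1 (h1.of_norm_bounded_eventually
    (f := fun n : ℤ => ‖fourierCoeffAt f n y‖) ?_)
  · exact Eventually.of_forall fun _ => rfl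
  · have : {(0 : ℤ)}ᶜ ∈ (cofinite : Filter ℤ) := (Set.finite_singleton _).compl_mem_cofinite
    filter_upwards [this] with n hn
    have hn0 : (n : ℝ) ≠ 0 := by exact_mod_cast hn
    rw [norm_norm, mul_one_div, le_div_iff₀ (by positivity), mul_comm]
    exact hC n

end IsMaassCuspForm

/-- The Fourier series of a periodic function on the half-plane along a horizontal line. -/
theorem hasSum_fourierCoeffAt {f : ℍ → ℂ} (hc : ContinuousOn (f ∘ ofComplex) {z : ℂ | 0 < z.im})
    (hinv : ∀ (γ : SL(2, ℤ)) (z : ℍ), f (γ • z) = f z) (z : ℍ)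
    (hs : Summable fun n : ℤ => ‖fourierCoeffAt f n z.im‖) :
    HasSum (fun n : ℤ => fourierCoeffAt f n z.im * fourierExp n z.re) (f z) := by
  have : Fact ((0 : ℝ) < 1) := ⟨one_pos⟩
  set g : ℝ → ℂ := fun x => (f ∘ ofComplex) (x + z.im * Complex.I) with hg
  have hper : Function.Periodic g 1 := by
    intro x
    have := comp_ofComplex_periodic hinv (z := x + z.im * Complex.I) (by simpa using z.im_pos)
    simp only [hg]
    rw [← this]; push_cast
    rw [add_right_comm]
  let F : C(AddCircle (1 : ℝ), ℂ) := ⟨hper.lift, continuous_coinduced_dom.2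
    (continuousOn_horizontal hc z.im_pos)⟩
  have hF : ∀ x : ℝ, F (x : AddCircle (1 : ℝ)) = g x := fun x => hper.lift_coe x
  have hco : ∀ n : ℤ, fourierCoeff F n = fourierCoeffAt f n z.im := by
    intro n
    rw [fourierCoeff_eq_intervalIntegral F n 0, fourierCoeffAt, zero_add, div_one, one_smul]
    refine intervalIntegral.integral_congr fun x _ => ?_
    simp only [hF, fourier_coe_apply, smul_eq_mul, fourierExp, hg, Function.comp_apply]
    rw [mul_comm]
    congr 2
    push_cast; ring
  have := has_pointwise_sum_fourier_series_of_summable (f := F) (by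
    rw [← summable_norm_iff]; simpa only [hco] using hs) (z.re : AddCircle (1 : ℝ))
  simp only [hco, hF, smul_eq_mul, fourier_coe_apply] at this
  have hz : g z.re = f z := congrArg f (halfPlanePoint_re_im z)
  rw [hz] at this
  convert this using 4 with n
  rw [fourierExp]; push_cast; congr 1; ring

/-! ### Decay of cusp forms and size of their coefficients -/

namespace IsMaassCuspForm

variable {s : ℂ} {f : ℍ → ℂ}

theorem fourierCoeffAt_zero (hf : IsMaassCuspForm s f) {y : ℝ} (hy : 0 < y) :
    fourierCoeffAt f 0 y = 0 := by
  have := hf.cuspidal y hy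
  simpa [fourierCoeffAt, fourierExp] using this

/-- A cusp form decays exponentially at the cusp. -/
theorem exists_norm_le_exp (hf : IsMaassCuspForm s f) :
    ∃ C, 0 ≤ C ∧ ∀ z : ℍ, ‖f z‖ ≤ C * Real.exp (-(Real.pi * z.im)) := by
  obtain ⟨y₀, hy₀, hb⟩ := exists_norm_fourierCoeffAt_le s
  set A : ℝ := ∑' n : ℤ, ‖fourierCoeffAt f n y₀‖ with hA
  have hsum := hf.summable_norm_fourierCoeffAt (one_pos.trans_le hy₀)
  have hA0 : 0 ≤ A := tsum_nonneg fun n => norm_nonneg _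
  -- The term `n = 0` is absent and `|n| ≥ 1` otherwise, so the common factor `exp(-π(y - y₀))`
  -- comes out of the Fourier series and the series at height `y₀` remains.
  have h1 : ∀ z : ℍ, y₀ ≤ z.im → ‖f z‖ ≤ A * Real.exp (-(Real.pi * (z.im - y₀))) := by
    intro z hz
    rw [← (hasSum_fourierCoeffAt hf.continuousOn hf.invariant z
      (hf.summable_norm_fourierCoeffAt z.im_pos)).tsum_eq, hA, ← tsum_mul_right]
    refine tsum_of_norm_bounded (hsum.mul_right _).hasSum fun n => ?_
    rw [norm_mul, norm_fourierExp, mul_one]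
    rcases eq_or_ne n 0 with rfl | hn
    · rw [hf.fourierCoeffAt_zero z.im_pos, norm_zero]; positivity
    · refine (hb f hf n hn _ hz).trans ?_
      gcongr
      have hn1 : (1 : ℝ) ≤ |(n : ℝ)| := by exact_mod_cast Int.one_le_abs hn
      have : 0 ≤ z.im - y₀ := by linarith
      nlinarith [Real.pi_pos]
  -- Boundedness near the cusp spreads to the whole half-plane by invariance; this handles heights
  -- below `y₀`, where `exp(π y₀)` compensates the exponential factor.
  obtain ⟨B, hB⟩ := ModularGroup.exists_bound_of_invariant hf.continuous (by
    rw [isBoundedAtImInfty_iff]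
    refine ⟨A, y₀, fun z hz => (h1 z hz).trans (mul_le_of_le_one_right hA0 ?_)⟩
    rw [Real.exp_le_one_iff, neg_nonpos]
    have : 0 ≤ z.im - y₀ := by linarith
    have := Real.pi_pos
    positivity) hf.invariant
  refine ⟨max A B * Real.exp (Real.pi * y₀), by positivity, fun z => ?_⟩
  rw [mul_assoc, ← Real.exp_add]
  rcases le_total y₀ z.im with hz | hz
  · refine (h1 z hz).trans ?_
    rw [show Real.pi * y₀ + -(Real.pi * z.im) = -(Real.pi * (z.im - y₀)) by ring]
    gcongr
    exact le_max_left _ _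
  · have h2 : B ≤ max A B := le_max_right _ _
    refine ((hB z).trans h2).trans (le_mul_of_one_le_right (hA0.trans (le_max_left _ _)) ?_)
    rw [← Real.exp_zero, Real.exp_le_exp]
    nlinarith [Real.pi_pos]

/-- The coefficients of a cusp form with respect to the Bessel functions. -/
theorem exists_besselCoeff (hf : IsMaassCuspForm s f) :
    ∃ c : ℤ → ℂ, (∀ n : ℤ, n ≠ 0 → ∀ y : ℝ, 0 < y → fourierCoeffAt f n y =
        c n * ((Real.sqrt y : ℂ) * besselK (s - 1 / 2) (|(n : ℝ)| * y))) ∧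
      ∃ C, 0 ≤ C ∧ ∀ n : ℤ, n ≠ 0 → ‖c n‖ ≤ C * Real.sqrt |(n : ℝ)| := by
  choose! c hc using fun (n : ℤ) (hn : n ≠ 0) => hf.exists_fourierCoeffAt_eq hn
  refine ⟨c, hc, ?_⟩
  obtain ⟨B, hB0, hB⟩ := hf.exists_norm_le_exp
  obtain ⟨t, ht, hne⟩ := exists_besselK_ne_zero (s - 1 / 2)
  have hpos : 0 < ‖besselK (s - 1 / 2) t‖ := norm_pos_iff.2 hne
  have hst : 0 < Real.sqrt t := Real.sqrt_pos.2 ht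
  refine ⟨B / (Real.sqrt t * ‖besselK (s - 1 / 2) t‖), by positivity, fun n hn => ?_⟩
  have hr : 0 < |(n : ℝ)| := by positivity
  -- Hecke's argument: at height `t / |n|` the Bessel factor has the fixed non-zero value at `t`,
  -- the left side is bounded because `f` is, and `√(t/|n|)` accounts for the growth `√|n|`.
  have h1 := hc n hn (t / |(n : ℝ)|) (by positivity)
  rw [mul_div_cancel₀ _ hr.ne'] at h1
  have h2 : ‖fourierCoeffAt f n (t / |(n : ℝ)|)‖ ≤ B := by
    refine norm_stripCoeff_le (h := f ∘ ofComplex) fun x _ => (hB _).trans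
      (mul_le_of_le_one_right hB0 ?_)
    rw [Real.exp_le_one_iff, neg_nonpos]
    exact mul_nonneg Real.pi_pos.le (im_pos _).le
  rw [h1, norm_mul, norm_mul, Complex.norm_real, Real.norm_of_nonneg (Real.sqrt_nonneg _),
    Real.sqrt_div ht.le] at h2
  have hsr : 0 < Real.sqrt |(n : ℝ)| := Real.sqrt_pos.2 hr
  rw [div_mul_eq_mul_div, le_div_iff₀ (by positivity)]
  rw [div_mul_eq_mul_div, mul_div_assoc', div_le_iff₀ hsr] at h2
  exact h2

end IsMaassCuspForm

/-! ### Whittaker coefficients -/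

/-- The chosen constant is unique because `W_s` is non-zero somewhere. This requires `Γ(s) ≠ 0`: as
division by zero gives zero, `W_s` would otherwise vanish identically. -/
theorem whittakerCoeff_eq {s : ℂ} {f : ℍ → ℂ} {n : ℤ} (hn : n ≠ 0) (hs : Complex.Gamma s ≠ 0) {c : ℂ}
    (hc : ∀ y : ℝ, 0 < y → fourierCoeffAt f n y =
      c * ((Real.sqrt y : ℂ) * besselK (s - 1 / 2) (|(n : ℝ)| * y))) :
    whittakerCoeff s f n = c * Complex.Gamma s / ((Real.pi : ℂ) ^ s * Real.sqrt |(n : ℝ)|) ∧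
    ∀ y : ℝ, 0 < y → fourierCoeffAt f n y =
      whittakerCoeff s f n * maassWhittaker s (|(n : ℝ)| * y) := by
  have hr : 0 < |(n : ℝ)| := by positivity
  have hsr : (Real.sqrt |(n : ℝ)| : ℂ) ≠ 0 := by exact_mod_cast (Real.sqrt_pos.2 hr).ne'
  have hpi : (Real.pi : ℂ) ^ s ≠ 0 := by
    rw [Complex.cpow_ne_zero_iff]; exact Or.inl (by exact_mod_cast Real.pi_ne_zero)
  have h1 : ∀ y : ℝ, 0 < y → fourierCoeffAt f n y =
      c * Complex.Gamma s / ((Real.pi : ℂ) ^ s * Real.sqrt |(n : ℝ)|) *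
        maassWhittaker s (|(n : ℝ)| * y) := by
    intro y hy
    rw [hc y hy, maassWhittaker_eq, Real.sqrt_mul hr.le]
    push_cast
    field_simp
  have h : ∃ c : ℂ, ∀ y : ℝ, 0 < y → fourierCoeffAt f n y = c * maassWhittaker s (|(n : ℝ)| * y) :=
    ⟨_, h1⟩
  have h2 : ∀ y : ℝ, 0 < y → fourierCoeffAt f n y =
      whittakerCoeff s f n * maassWhittaker s (|(n : ℝ)| * y) := by
    rw [whittakerCoeff, dif_pos h]; exact h.choose_spec
  refine ⟨?_, h2⟩
  obtain ⟨t, ht, hne⟩ := exists_besselK_ne_zero (s - 1 / 2)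
  have h3 := (h2 (t / |(n : ℝ)|) (by positivity)).symm.trans (h1 (t / |(n : ℝ)|) (by positivity))
  refine mul_right_cancel₀ ?_ h3
  rw [mul_div_cancel₀ _ hr.ne', maassWhittaker_eq]
  refine mul_ne_zero (div_ne_zero hpi hs) (mul_ne_zero ?_ hne)
  exact_mod_cast (Real.sqrt_pos.2 ht).ne'

theorem IsMaassCuspForm.hasSum_whittakerCoeff {s : ℂ} {f : ℍ → ℂ} (hf : IsMaassCuspForm s f)
    (hs : Complex.Gamma s ≠ 0) (z : ℍ) :
    HasSum (fun n : {n : ℤ // n ≠ 0} =>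
      whittakerCoeff s f n * maassWhittaker s (|((n : ℤ) : ℝ)| * z.im) * fourierExp n z.re)
      (f z) := by
  have h := hasSum_fourierCoeffAt hf.continuousOn hf.invariant z
    (hf.summable_norm_fourierCoeffAt z.im_pos)
  rw [← hasSum_subtype_iff_of_support_subset (s := {n : ℤ | n ≠ 0})] at h
  · have e : (fun n : {n : ℤ // n ≠ 0} => whittakerCoeff s f n *
        maassWhittaker s (|((n : ℤ) : ℝ)| * z.im) * fourierExp n z.re) =
        (fun n : ℤ => fourierCoeffAt f n z.im * fourierExp n z.re) ∘ Subtype.val := by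
      funext n
      obtain ⟨c, hc⟩ := hf.exists_fourierCoeffAt_eq n.2
      simp only [Function.comp_apply]
      rw [(whittakerCoeff_eq n.2 hs hc).2 _ z.im_pos]
    rw [e]
    exact h
  · intro n hn
    rw [Function.mem_support] at hn
    rintro rfl
    exact hn (by rw [hf.fourierCoeffAt_zero z.im_pos, zero_mul])

/-! ### Eisenstein series as lattice sums -/

/-- The quadratic form `|m z + n|² / Im z` at `v = (m, n)`. -/
def latticeForm (z : ℍ) (v : Fin 2 → ℤ) : ℝ := ‖(v 0 : ℂ) * z + v 1‖ ^ 2 / z.im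

theorem latticeForm_nonneg (z : ℍ) (v : Fin 2 → ℤ) : 0 ≤ latticeForm z v :=
  div_nonneg (by positivity) z.im_pos.le

theorem latticeForm_pos (z : ℍ) {v : Fin 2 → ℤ} (hv : v ≠ 0) : 0 < latticeForm z v := by
  refine div_pos (pow_pos (norm_pos_iff.2 ?_) 2) z.im_pos
  intro h
  have h1 := congrArg Complex.im h
  simp only [Complex.add_im, Complex.mul_im, Complex.intCast_re, Complex.intCast_im, zero_mul, add_zero,
    Complex.zero_im, coe_im, mul_eq_zero, z.im_ne_zero, or_false, Int.cast_eq_zero] at h1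
  rw [h1] at h
  have h2 : v 1 = 0 := by simpa using h
  exact hv (by ext i; fin_cases i <;> simp [h1, h2])

theorem latticeForm_smul (z : ℍ) (g : ℤ) (v : Fin 2 → ℤ) :
    latticeForm z (g • v) = (g : ℝ) ^ 2 * latticeForm z v := by
  have : (((g • v) 0 : ℤ) : ℂ) * z + ((g • v) 1 : ℤ) = g * ((v 0 : ℂ) * z + v 1) := by
    simp; ring
  rw [latticeForm, this, norm_mul, mul_pow, Complex.norm_intCast, sq_abs, latticeForm, mul_div_assoc]

theorem im_smul_eq_inv_latticeForm (γ : SL(2, ℤ)) (z : ℍ) :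
    (γ • z).im = (latticeForm z (γ 1))⁻¹ := by
  rw [ModularGroup.im_smul_eq_div_normSq, ModularGroup.denom_apply, latticeForm,
    Complex.normSq_eq_norm_sq, inv_div]

theorem norm_latticeForm_cpow (z : ℍ) {s : ℂ} (hs : 0 < s.re) (v : Fin 2 → ℤ) :
    ‖((latticeForm z v : ℝ) : ℂ) ^ (-s)‖ = (latticeForm z v) ^ (-s.re) := by
  rcases eq_or_ne v 0 with rfl | hv
  · have h : latticeForm z 0 = 0 := by simp [latticeForm]
    rw [h, Complex.ofReal_zero, Complex.zero_cpow, Real.zero_rpow, norm_zero]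
    · exact (neg_neg_of_pos hs).ne
    · intro h; rw [neg_eq_zero] at h; simp [h] at hs
  · rw [Complex.norm_cpow_eq_rpow_re_of_pos (latticeForm_pos z hv), Complex.neg_re]

theorem summable_latticeForm_rpow (z : ℍ) {σ : ℝ} (hσ : 1 < σ) :
    Summable fun v : Fin 2 → ℤ => (latticeForm z v) ^ (-σ) := by
  have h1 := EisensteinSeries.summable_one_div_norm_rpow (k := 2 * σ) (by linarith)
  refine Summable.of_nonneg_of_le (fun v => Real.rpow_nonneg (latticeForm_nonneg z v) _) (fun v => ?_)
    (h1.mul_left (z.im ^ σ * EisensteinSeries.r z ^ (-(2 * σ))))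
  rw [latticeForm, Real.div_rpow (by positivity) z.im_pos.le, Real.rpow_neg z.im_pos.le σ, div_inv_eq_mul,
    mul_comm, mul_assoc]
  gcongr
  refine le_trans (le_of_eq ?_) (EisensteinSeries.summand_bound z (by linarith) v)
  rw [← Real.rpow_natCast, ← Real.rpow_mul (norm_nonneg _)]
  congr 1; push_cast; ring

/-- Every non-zero pair of integers is uniquely of the form `± g (c, d)`, where `(c, d)` is the
bottom row of the representative of a coset. -/
theorem bijective_bottomRow : Function.Bijective
    (fun p : Quotient (QuotientGroup.rightRel parabolicSubgroup) × (ℕ+ × ℤˣ) =>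
      (⟨((p.2.2 : ℤ) * (p.2.1 : ℕ)) • (p.1.out 1), by
        intro h
        have h1 : ∀ i, p.1.out 1 i = 0 := by
          intro i
          have := congrFun h i
          simpa using this
        have hdet := p.1.out.det_coe
        rw [Matrix.det_fin_two] at hdet
        simp [h1] at hdet⟩ : {v : Fin 2 → ℤ // v ≠ 0})) := by
  have hcop : ∀ γ : SL(2, ℤ), Int.gcd (γ 1 0) (γ 1 1) = 1 := fun γ =>
    Int.isCoprime_iff_gcd_eq_one.1 (γ.isCoprime_row 1)
  constructor
  · rintro ⟨q, g, ε⟩ ⟨q', g', ε'⟩ h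
    replace h := Subtype.ext_iff.1 h
    simp only at h
    have h0 := congrFun h 0
    have h1 := congrFun h 1
    simp only [Pi.smul_apply, smul_eq_mul] at h0 h1
    -- The multiple `g` is recovered as the gcd of the entries, bottom rows being coprime.
    have hg : g = g' := by
      have e : ∀ (ε : ℤˣ) (g : ℕ+) (γ : SL(2, ℤ)),
          Int.gcd ((ε : ℤ) * (g : ℕ) * γ 1 0) ((ε : ℤ) * (g : ℕ) * γ 1 1) = g := by
        intro ε g γ
        rw [Int.gcd_mul_left, hcop, mul_one, Int.natAbs_mul, Int.units_natAbs]; simp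
      have := e ε g q.out
      rw [h0, h1, e] at this
      exact PNat.eq this.symm
    subst hg
    have hg0 : ((g : ℕ) : ℤ) ≠ 0 := by exact_mod_cast g.ne_zero
    have h0' : (ε : ℤ) * q.out 1 0 = (ε' : ℤ) * q'.out 1 0 :=
      mul_left_cancel₀ hg0 (by linear_combination h0)
    have h1' : (ε : ℤ) * q.out 1 1 = (ε' : ℤ) * q'.out 1 1 :=
      mul_left_cancel₀ hg0 (by linear_combination h1)
    -- The lower left entry of `γ' γ⁻¹` is the determinant formed by the two bottom rows, so
    -- proportional rows lie in the same coset of `P`.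
    have hq : q = q' := by
      rw [← Quotient.out_eq q, ← Quotient.out_eq q']
      refine Quotient.sound (QuotientGroup.rightRel_apply.2 ?_)
      show (q'.out * q.out⁻¹) 1 0 = 0
      have : (q'.out * q.out⁻¹) 1 0 = q'.out 1 0 * q.out 1 1 - q'.out 1 1 * q.out 1 0 := by
        rw [Matrix.SpecialLinearGroup.coe_mul, Matrix.mul_apply, Fin.sum_univ_two,
          Matrix.SpecialLinearGroup.SL2_inv_expl]
        simp
        ring
      rw [this]
      refine mul_left_cancel₀ (mul_ne_zero ε'.ne_zero ε.ne_zero) ?_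
      linear_combination (-(ε : ℤ) * q.out 1 1) * h0' + ((ε : ℤ) * q.out 1 0) * h1'
    subst hq
    have hε : ε = ε' := by
      have h2 : (ε : ℤ) * ((q.out 1 0) ^ 2 + (q.out 1 1) ^ 2) =
          (ε' : ℤ) * ((q.out 1 0) ^ 2 + (q.out 1 1) ^ 2) := by
        linear_combination q.out 1 0 * h0' + q.out 1 1 * h1'
      refine Units.ext (mul_right_cancel₀ ?_ h2)
      intro h3
      have h4 : q.out 1 0 = 0 := by nlinarith [sq_nonneg (q.out 1 0), sq_nonneg (q.out 1 1)]
      have h5 : q.out 1 1 = 0 := by nlinarith [sq_nonneg (q.out 1 0), sq_nonneg (q.out 1 1)]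
      have := hcop q.out
      rw [h4, h5] at this
      simp at this
    rw [hε]
  · rintro ⟨v, hv⟩
    -- For surjectivity, `v` is divided by its gcd and the resulting coprime pair is completed to a
    -- matrix of determinant one.
    have hg : 0 < Int.gcd (v 0) (v 1) := by
      rw [Int.gcd_pos_iff]
      by_contra! hc
      exact hv (by ext i; fin_cases i <;> simp [hc.1, hc.2])
    obtain ⟨a, b, hab, ha, hb⟩ := Int.exists_gcd_one hg
    obtain ⟨γ, hγ0, hγ1⟩ := (Int.isCoprime_iff_gcd_eq_one.2 hab).exists_SL2_row 1
    set q : Quotient (QuotientGroup.rightRel parabolicSubgroup) := Quotient.mk _ γ with hq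
    have hp : γ * q.out⁻¹ ∈ parabolicSubgroup :=
      QuotientGroup.rightRel_apply.1 (Quotient.exact (Quotient.out_eq q))
    have hrow : ∃ ε : ℤˣ, ∀ i, γ 1 i = (ε : ℤ) * q.out 1 i := by
      obtain ⟨n, hn⟩ := eq_T_zpow_or_eq_neg_of_mem_parabolicSubgroup hp
      rw [mul_inv_eq_iff_eq_mul, mul_inv_eq_iff_eq_mul, neg_mul] at hn
      rcases hn with hn | hn
      · refine ⟨1, fun i => ?_⟩
        rw [hn, ModularGroup.T_pow_mul_apply_one]
        simp
      · refine ⟨-1, fun i => ?_⟩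
        have := congrFun (ModularGroup.T_pow_mul_apply_one n q.out) i
        rw [hn, Matrix.SpecialLinearGroup.coe_neg, Matrix.neg_apply, this]
        simp
    obtain ⟨ε, hε⟩ := hrow
    refine ⟨⟨q, ⟨Int.gcd (v 0) (v 1), hg⟩, ε⟩, Subtype.ext ?_⟩
    funext i
    have e0 := hε 0
    have e1 := hε 1
    rw [hγ0] at e0
    rw [hγ1] at e1
    simp only [PNat.mk_coe, Pi.smul_apply, smul_eq_mul]
    fin_cases i
    · simp only [Fin.zero_eta]
      conv_rhs => rw [ha, e0]
      ring
    · simp only [Fin.mk_one]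
      conv_rhs => rw [hb, e1]
      ring

/-- With `v = ± g (c, d)` the form scales by `g²`, and at `(c, d)` it equals `1 / Im(γz)`. The sum
therefore factors into the coset sum, `ζ(2s)` from `g`, and `2` from the sign. -/
theorem tsum_latticeForm_cpow (z : ℍ) {s : ℂ} (hs : 1 < s.re) :
    ∑' v : Fin 2 → ℤ, ((latticeForm z v : ℝ) : ℂ) ^ (-s) =
      2 * riemannZeta (2 * s) * eisensteinSum s z := by
  have hs0 : 0 < s.re := one_pos.trans hs
  have hsum : Summable fun v : Fin 2 → ℤ => ((latticeForm z v : ℝ) : ℂ) ^ (-s) := by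
    refine Summable.of_norm ?_
    simp only [norm_latticeForm_cpow z hs0]
    exact summable_latticeForm_rpow z hs
  -- The convention `0 ^ (-s) = 0` makes the zero vector harmless, so one may sum over the full
  -- lattice, as Poisson summation needs.
  have hzero : ((latticeForm z 0 : ℝ) : ℂ) ^ (-s) = 0 := by
    rw [← norm_eq_zero, norm_latticeForm_cpow z hs0]
    simp [latticeForm, Real.zero_rpow (neg_neg_of_pos hs0).ne]
  have h1 : ∑' v : Fin 2 → ℤ, ((latticeForm z v : ℝ) : ℂ) ^ (-s) =
      ∑' v : {v : Fin 2 → ℤ // v ≠ 0}, ((latticeForm z v : ℝ) : ℂ) ^ (-s) := by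
    refine (tsum_subtype_eq_of_support_subset (s := {v : Fin 2 → ℤ | v ≠ 0}) ?_).symm
    intro v hv
    rw [Function.mem_support] at hv
    rintro rfl
    exact hv hzero
  have hterm : ∀ p : Quotient (QuotientGroup.rightRel parabolicSubgroup) × (ℕ+ × ℤˣ),
      ((latticeForm z (Equiv.ofBijective _ bijective_bottomRow p) : ℝ) : ℂ) ^ (-s) =
      (((p.1.out • z).im : ℝ) : ℂ) ^ s * (((p.2.1 : ℕ) : ℂ) ^ (2 * s))⁻¹ := by
    rintro ⟨q, g, ε⟩
    simp only [Equiv.ofBijective_apply]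
    have hg : (0 : ℝ) < ((g : ℕ) : ℝ) := by exact_mod_cast g.pos
    have hsq : (((ε : ℤ) * (g : ℕ) : ℤ) : ℝ) ^ 2 = ((g : ℕ) : ℝ) ^ 2 := by
      rcases Int.units_eq_one_or ε with rfl | rfl <;> simp
    rw [latticeForm_smul, hsq, im_smul_eq_inv_latticeForm, Complex.ofReal_mul,
      Complex.mul_cpow_ofReal_nonneg (by positivity) (latticeForm_nonneg z _), Complex.ofReal_inv,
      Complex.inv_cpow _ _ (by
        rw [Complex.arg_ofReal_of_nonneg (latticeForm_nonneg z _)]; exact Real.pi_ne_zero.symm),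
      Complex.cpow_neg, Complex.cpow_neg, mul_comm]
    congr 2
    rw [sq, Complex.ofReal_mul, Complex.mul_cpow_ofReal_nonneg hg.le hg.le, ← Complex.cpow_add _ _
      (by exact_mod_cast hg.ne'), two_mul]
    simp
  have hsum' : Summable fun p : Quotient (QuotientGroup.rightRel parabolicSubgroup) × (ℕ+ × ℤˣ) =>
      (((p.1.out • z).im : ℝ) : ℂ) ^ s * (((p.2.1 : ℕ) : ℂ) ^ (2 * s))⁻¹ := by
    simp only [← hterm]
    exact (Equiv.summable_iff (Equiv.ofBijective _ bijective_bottomRow)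
      (f := fun v : {v : Fin 2 → ℤ // v ≠ 0} => ((latticeForm z v : ℝ) : ℂ) ^ (-s))).2
      (hsum.comp_injective Subtype.val_injective)
  have hzeta : ∑' p : ℕ+ × ℤˣ, (((p.1 : ℕ) : ℂ) ^ (2 * s))⁻¹ = 2 * riemannZeta (2 * s) := by
    have hz2 : 1 < (2 * s).re := by simp; linarith
    have hp : Summable fun n : ℕ+ => (((n : ℕ) : ℂ) ^ (2 * s))⁻¹ := by
      have := (Complex.summable_one_div_nat_cpow.2 hz2).comp_injective PNat.coe_injective
      simpa [Function.comp_def] using this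
    have : Summable fun p : ℕ+ × ℤˣ => (((p.1 : ℕ) : ℂ) ^ (2 * s))⁻¹ := by
      simpa using summable_mul_of_summable_norm hp.norm
        (g := fun _ : ℤˣ => (1 : ℂ)) (Summable.of_finite)
    rw [this.tsum_prod, zeta_eq_tsum_one_div_nat_add_one_cpow hz2, ← tsum_mul_left]
    rw [← Equiv.pnatEquivNat.symm.tsum_eq]
    refine tsum_congr fun n => ?_
    rw [tsum_fintype]
    simp
  rw [h1, ← (Equiv.ofBijective _ bijective_bottomRow).tsum_eq, tsum_congr hterm, hsum'.tsum_prod]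
  simp only [tsum_mul_left, tsum_mul_right, hzeta]
  rw [eisensteinSum]; ring

/-! ### Poisson summation along a row -/

theorem summable_int_rpow_mul_exp (A : ℝ) {c : ℝ} (hc : 0 < c) :
    Summable fun n : ℤ => |(n : ℝ)| ^ A * Real.exp (-(c * |(n : ℝ)|)) := by
  have h : Summable fun n : ℕ => (n : ℝ) ^ A * Real.exp (-(c * n)) := by
    refine Summable.of_norm_bounded_eventually_nat
      (Real.summable_pow_mul_exp_neg_nat_mul ⌈A⌉₊ hc) ?_
    filter_upwards [eventually_ge_atTop 1] with n hn
    have hn1 : (1 : ℝ) ≤ n := by exact_mod_cast hn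
    rw [Real.norm_of_nonneg (by positivity), neg_mul, ← Real.rpow_natCast]
    gcongr
    exact Nat.le_ceil A
  rw [summable_int_iff_summable_nat_and_neg]
  constructor <;> simpa using h

theorem norm_besselK_le (A : ℝ) {δ : ℝ} (hδ : 0 < δ) : ∃ C : ℝ, 0 ≤ C ∧ ∀ (ν : ℂ) (y : ℝ),
    |ν.re| ≤ A → δ ≤ y → ‖besselK ν y‖ ≤ C * Real.exp (-(Real.pi * y)) := by
  refine ⟨∫ x : ℝ, Real.exp ((A + (0 : ℕ)) * |x|) * Real.exp (-(Real.pi * δ * Real.cosh x)),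
    integral_nonneg fun x => by positivity, fun ν y hν hy => ?_⟩
  rw [← integral_mul_const]
  refine norm_integral_le_of_norm_le
    ((integrable_exp_abs_mul_exp_cosh (A + (0 : ℕ)) (by positivity)).mul_const _)
    (Eventually.of_forall fun x => (norm_besselMoment_integrand_le 0 ν y x).trans ?_)
  rw [mul_assoc (Real.exp ((A + (0 : ℕ)) * |x|)),
    ← Real.exp_add (-(Real.pi * δ * Real.cosh x))]
  gcongr
  have := Real.one_le_cosh x
  have hp := Real.pi_pos
  have hy0 : 0 < y := hδ.trans_le hy
  have h1 : Real.pi * y ≤ Real.pi * y * Real.cosh x := le_mul_of_one_le_right (by positivity) this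
  have h2 : Real.pi * δ * Real.cosh x ≤ Real.pi * y * Real.cosh x := by gcongr
  linarith

/-- Substitution `t = (k/m) exp x`, which balances the terms `m² t` and `k² / t`. -/
theorem integral_cpow_mul_exp_eq_besselK (ν : ℂ) {m k : ℝ} (hm : 0 < m) (hk : 0 < k) (y : ℝ) :
    ∫ t in Set.Ioi (0 : ℝ), (t : ℂ) ^ (ν - 1) *
      (Real.exp (-(Real.pi * y * (m ^ 2 * t + k ^ 2 / t))) : ℂ) =
      ((k / m : ℝ) : ℂ) ^ ν * besselK ν (k * m * y) := by
  have hr : 0 < k / m := by positivity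
  have himg : (fun x : ℝ => k / m * Real.exp x) '' Set.univ = Set.Ioi 0 := by
    ext t
    simp only [Set.image_univ, Set.mem_range, Set.mem_Ioi]
    constructor
    · rintro ⟨x, rfl⟩; positivity
    · intro ht
      exact ⟨Real.log (t / (k / m)), by rw [Real.exp_log (by positivity)]; field_simp⟩
  have h := integral_image_eq_integral_abs_deriv_smul (MeasurableSet.univ (α := ℝ))
    (fun x _ => ((Real.hasDerivAt_exp x).const_mul (k / m)).hasDerivWithinAt)
    (fun x _ x' _ h => Real.exp_injective (mul_left_cancel₀ hr.ne' h))
    (fun t : ℝ => (t : ℂ) ^ (ν - 1) *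
      (Real.exp (-(Real.pi * y * (m ^ 2 * t + k ^ 2 / t))) : ℂ))
  rw [himg] at h
  rw [h, setIntegral_univ, besselK, besselMoment, ← integral_const_mul]
  refine integral_congr_ae (Eventually.of_forall fun x => ?_)
  have hx := Real.exp_pos x
  have hrx : 0 < k / m * Real.exp x := by positivity
  have hrx' : ((k / m * Real.exp x : ℝ) : ℂ) ≠ 0 := by exact_mod_cast hrx.ne'
  have hx' : (Real.exp x : ℂ) ≠ 0 := by exact_mod_cast hx.ne'
  simp only
  rw [abs_of_pos hrx, Complex.real_smul, Complex.cpow_sub _ _ hrx', Complex.cpow_one, ← mul_assoc,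
    mul_div_cancel₀ _ hrx', Complex.ofReal_mul (k / m),
    Complex.mul_cpow_ofReal_nonneg hr.le hx.le, Complex.cpow_def_of_ne_zero hx',
    ← Complex.ofReal_log hx.le, Real.log_exp, pow_zero, one_mul, mul_comm (x : ℂ), mul_assoc]
  congr 4
  rw [Real.cosh_eq, Real.exp_neg]
  field_simp

theorem summable_row_bound {y σ : ℝ} (hy : 0 < y) (hσ : 0 ≤ σ) :
    ∃ u : ℤ → ℝ, Summable u ∧ (∀ n, 0 ≤ u n) ∧ ∀ (ν : ℂ), ν.re = σ →
      ∀ (m : ℕ+) (k : ℤ), k ≠ 0 →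
      (|(k : ℝ)| / (m : ℕ)) ^ σ * ‖besselK ν (|(k : ℝ)| * (m : ℕ) * y)‖ ≤
        u k * Real.exp (-(Real.pi / 2 * y * (m : ℕ))) := by
  obtain ⟨C, hC0, hC⟩ := norm_besselK_le |σ| hy
  refine ⟨fun k => C * (|(k : ℝ)| ^ σ * Real.exp (-(Real.pi / 2 * y * |(k : ℝ)|))),
    (summable_int_rpow_mul_exp σ (by positivity)).mul_left C, fun n => by positivity,
    fun ν hν m k hk => ?_⟩
  have hk1 : (1 : ℝ) ≤ |(k : ℝ)| := by exact_mod_cast Int.one_le_abs hk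
  have hm1 : (1 : ℝ) ≤ (m : ℕ) := by exact_mod_cast m.pos
  -- This inequality separates the exponential into a factor in `k` and a factor in `m`, so that the
  -- double series over rows and frequencies converges absolutely.
  have hkm : (|(k : ℝ)| + (m : ℕ)) / 2 ≤ |(k : ℝ)| * (m : ℕ) := by nlinarith
  have h1 := hC ν (|(k : ℝ)| * (m : ℕ) * y) (by rw [hν]) (le_mul_of_one_le_left hy.le (by nlinarith))
  calc (|(k : ℝ)| / (m : ℕ)) ^ σ * ‖besselK ν (|(k : ℝ)| * (m : ℕ) * y)‖
      ≤ |(k : ℝ)| ^ σ * (C * Real.exp (-(Real.pi * (|(k : ℝ)| * (m : ℕ) * y)))) := by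
        gcongr
        exact div_le_self (by positivity) hm1
    _ ≤ |(k : ℝ)| ^ σ * (C * Real.exp (-(Real.pi / 2 * y * |(k : ℝ)|) + -(Real.pi / 2 * y * (m : ℕ)))) := by
        gcongr
        have : 0 < Real.pi * y := by positivity
        nlinarith
    _ = _ := by rw [Real.exp_add]; ring

/-- The terms after Poisson summation. -/
def rowTerm (s : ℂ) (z : ℍ) (m : ℕ+) (k : ℤ) : ℂ :=
  if k = 0 then (Real.sqrt z.im : ℂ) * (Complex.Gamma (s - 1 / 2) *
    ((Real.pi * z.im * (m : ℕ) ^ 2 : ℝ) : ℂ) ^ (-(s - 1 / 2)))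
  else (Real.sqrt z.im : ℂ) * (((|(k : ℝ)| / (m : ℕ) : ℝ) : ℂ) ^ (s - 1 / 2) *
    besselK (s - 1 / 2) (|(k : ℝ)| * (m : ℕ) * z.im)) * fourierExp (k * (m : ℕ)) z.re

theorem latticeForm_row (z : ℍ) (m n : ℤ) :
    latticeForm z ![m, n] = ((m * z.re + n) ^ 2 + m ^ 2 * z.im ^ 2) / z.im := by
  rw [latticeForm, ← Complex.normSq_eq_norm_sq]
  congr 1
  rw [Complex.normSq_apply]
  simp
  ring

/-- Poisson summation for a Gaussian in `n` centred at `-m Re z`; the shift of the centre produces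
the characters. -/
theorem tsum_exp_latticeForm (z : ℍ) (m : ℤ) {t : ℝ} (ht : 0 < t) :
    ∑' n : ℤ, (Real.exp (-(t * (Real.pi * latticeForm z ![m, n]))) : ℂ) =
      ((Real.sqrt (z.im / t) : ℝ) : ℂ) * ∑' k : ℤ,
        (Real.exp (-(Real.pi * z.im * ((m : ℝ) ^ 2 * t + (k : ℝ) ^ 2 / t))) : ℂ) *
          fourierExp (k * m) z.re := by
  have hy := z.im_pos
  have hyC : (z.im : ℂ) ≠ 0 := by exact_mod_cast hy.ne'
  have htC : (t : ℂ) ≠ 0 := by exact_mod_cast ht.ne'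
  have h := Complex.tsum_exp_neg_quadratic (a := ((t / z.im : ℝ) : ℂ))
    (by rw [Complex.ofReal_re]; positivity) (-((t / z.im : ℝ) : ℂ) * m * z.re)
  have h1 : ((t / z.im : ℝ) : ℂ) ^ (1 / 2 : ℂ) = (Real.sqrt (t / z.im) : ℝ) := by
    rw [Real.sqrt_eq_rpow, Complex.ofReal_cpow (by positivity)]; norm_num
  have h2 : (1 : ℂ) / ((Real.sqrt (t / z.im) : ℝ) : ℂ) = ((Real.sqrt (z.im / t) : ℝ) : ℂ) := by
    rw [← inv_div t z.im, Real.sqrt_inv]; push_cast; rw [one_div]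
  rw [h1, h2] at h
  have e1 : ∀ n : ℤ, (Real.exp (-(t * (Real.pi * latticeForm z ![m, n]))) : ℂ) =
      Complex.exp (-Real.pi * ((t / z.im : ℝ) : ℂ) * n ^ 2 +
        2 * Real.pi * (-((t / z.im : ℝ) : ℂ) * m * z.re) * n) *
      Complex.exp (-Real.pi * (t / z.im) * m ^ 2 * (z.re ^ 2 + z.im ^ 2)) := by
    intro n
    rw [← Complex.exp_add, latticeForm_row]
    push_cast
    congr 1
    field_simp
    ring
  have e2 : ∀ k : ℤ, (Real.exp (-(Real.pi * z.im * ((m : ℝ) ^ 2 * t + (k : ℝ) ^ 2 / t))) : ℂ) *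
          fourierExp (k * m) z.re =
      Complex.exp (-Real.pi / ((t / z.im : ℝ) : ℂ) *
        (k + Complex.I * (-((t / z.im : ℝ) : ℂ) * m * z.re)) ^ 2) *
      Complex.exp (-Real.pi * (t / z.im) * m ^ 2 * (z.re ^ 2 + z.im ^ 2)) := by
    intro k
    rw [fourierExp, ← Complex.exp_add]
    push_cast
    rw [← Complex.exp_add]
    congr 1
    have hI := Complex.I_sq
    field_simp
    ring_nf
    rw [hI]
    ring
  rw [tsum_congr e1, tsum_congr e2, tsum_mul_right, tsum_mul_right, h]
  ring

theorem integrableOn_cpow_mul_exp {ν : ℂ} (hν : 0 < ν.re) {y : ℝ} (hy : 0 < y) (m : ℕ+) (k : ℤ) :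
    IntegrableOn (fun t : ℝ => (t : ℂ) ^ (ν - 1) *
      (Real.exp (-(Real.pi * y * (((m : ℕ) : ℝ) ^ 2 * t + (k : ℝ) ^ 2 / t))) : ℂ)) (Set.Ioi 0) := by
  have hm : (0 : ℝ) < (m : ℕ) := by exact_mod_cast m.pos
  have h := (integral_Ioi_cpow_mul_exp hν (r := Real.pi * y * ((m : ℕ) : ℝ) ^ 2) (by positivity)).1
  refine Integrable.mono h ?_ ?_
  · refine ContinuousOn.aestronglyMeasurable (ContinuousOn.mul ?_ ?_) measurableSet_Ioi
    · intro t ht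
      exact (Complex.continuousAt_ofReal_cpow_const _ _ (Or.inr (ne_of_gt ht))).continuousWithinAt
    · refine Complex.continuous_ofReal.comp_continuousOn (Real.continuous_exp.comp_continuousOn ?_)
      refine ContinuousOn.neg (ContinuousOn.mul continuousOn_const (ContinuousOn.add (by fun_prop) ?_))
      exact continuousOn_const.div continuousOn_id fun t ht => ne_of_gt ht
  · filter_upwards [ae_restrict_mem measurableSet_Ioi] with t ht
    have ht0 : 0 < t := ht
    rw [norm_mul, norm_mul, Complex.norm_real, Complex.norm_real, Real.norm_of_nonneg (Real.exp_pos _).le,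
      Real.norm_of_nonneg (Real.exp_pos _).le]
    refine mul_le_mul_of_nonneg_left (Real.exp_le_exp.2 ?_) (norm_nonneg _)
    have : 0 ≤ Real.pi * y * ((k : ℝ) ^ 2 / t) := by positivity
    nlinarith

theorem integral_norm_cpow_mul_exp {ν : ℂ} {y : ℝ} (m : ℕ+) {k : ℤ} (hk : k ≠ 0) :
    ∫ t in Set.Ioi (0 : ℝ), ‖(t : ℂ) ^ (ν - 1) *
      (Real.exp (-(Real.pi * y * (((m : ℕ) : ℝ) ^ 2 * t + (k : ℝ) ^ 2 / t))) : ℂ)‖ =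
    (|(k : ℝ)| / (m : ℕ)) ^ ν.re * ‖besselK ν.re (|(k : ℝ)| * (m : ℕ) * y)‖ := by
  have hm : (0 : ℝ) < (m : ℕ) := by exact_mod_cast m.pos
  have hk0 : 0 < |(k : ℝ)| := by positivity
  have h := integral_cpow_mul_exp_eq_besselK (ν.re : ℂ) hm hk0 y
  have e : ∫ t in Set.Ioi (0 : ℝ), (t : ℂ) ^ ((ν.re : ℂ) - 1) *
      (Real.exp (-(Real.pi * y * (((m : ℕ) : ℝ) ^ 2 * t + |(k : ℝ)| ^ 2 / t))) : ℂ) =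
      ((∫ t in Set.Ioi (0 : ℝ), ‖(t : ℂ) ^ (ν - 1) *
      (Real.exp (-(Real.pi * y * (((m : ℕ) : ℝ) ^ 2 * t + (k : ℝ) ^ 2 / t))) : ℂ)‖ : ℝ) : ℂ) := by
    rw [← integral_complex_ofReal]
    refine setIntegral_congr_fun measurableSet_Ioi fun t ht => ?_
    have ht0 : 0 < t := ht
    rw [norm_mul, Complex.norm_real, Real.norm_of_nonneg (Real.exp_pos _).le,
      Complex.norm_cpow_eq_rpow_re_of_pos ht0, Complex.sub_re, Complex.one_re, sq_abs,
      Complex.ofReal_mul, Complex.ofReal_cpow ht0.le]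
    push_cast
    rfl
  rw [e] at h
  have h2 := congrArg norm h
  rw [Complex.norm_real, Real.norm_of_nonneg (integral_nonneg fun t => norm_nonneg _), norm_mul,
    Complex.norm_cpow_eq_rpow_re_of_pos (by positivity), Complex.ofReal_re] at h2
  exact h2

/-- Each `π^(-s) Γ(s) Q^(-s)` is the integral of `t^(s-1) exp(-πtQ)`, and the row is Poisson-summed
under the integral sign. The frequency `k = 0` leaves a Gamma integral, the others leave Bessel
functions. Absolute convergence on both sides justifies the two interchanges. -/
theorem hasSum_rowTerm {s : ℂ} (hs : 1 < s.re) (z : ℍ) (m : ℕ+) :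
    HasSum (rowTerm s z m) ((Real.pi : ℂ) ^ (-s) * Complex.Gamma s *
      ∑' n : ℤ, ((latticeForm z ![(m : ℕ), n] : ℝ) : ℂ) ^ (-s)) := by
  have hy := z.im_pos
  have hm : (0 : ℝ) < (m : ℕ) := by exact_mod_cast m.pos
  have hs0 : 0 < s.re := one_pos.trans hs
  have hν : 0 < (s - 1 / 2).re := by simp; linarith
  set F : ℤ → ℝ → ℂ := fun n t => (t : ℂ) ^ (s - 1) *
    (Real.exp (-(t * (Real.pi * latticeForm z ![(m : ℕ), n]))) : ℂ) with hF
  set G : ℤ → ℝ → ℂ := fun k t => (Real.sqrt z.im : ℂ) * ((t : ℂ) ^ (s - 1 / 2 - 1) *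
    (Real.exp (-(Real.pi * z.im * (((m : ℕ) : ℝ) ^ 2 * t + (k : ℝ) ^ 2 / t))) : ℂ)) *
    fourierExp (k * (m : ℕ)) z.re with hG
  have hQ : ∀ n : ℤ, 0 < latticeForm z ![(m : ℕ), n] := fun n => latticeForm_pos z (by
    intro h
    have := congrFun h 0
    simp at this)
  have hπQ : ∀ n : ℤ, 0 < Real.pi * latticeForm z ![(m : ℕ), n] := fun n =>
    mul_pos Real.pi_pos (hQ n)
  have hFint : ∀ n, ∫ t in Set.Ioi (0 : ℝ), F n t = (Real.pi : ℂ) ^ (-s) * Complex.Gamma s *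
      ((latticeForm z ![(m : ℕ), n] : ℝ) : ℂ) ^ (-s) := by
    intro n
    rw [(integral_Ioi_cpow_mul_exp hs0 (hπQ n)).2, Complex.ofReal_mul,
      Complex.mul_cpow_ofReal_nonneg Real.pi_pos.le (hQ n).le]
    ring
  have hnF : ∀ n, ∫ t in Set.Ioi (0 : ℝ), ‖F n t‖ = Real.Gamma s.re *
      (Real.pi ^ (-s.re) * latticeForm z ![(m : ℕ), n] ^ (-s.re)) := by
    intro n
    have h := (integral_Ioi_cpow_mul_exp (w := (s.re : ℂ)) (by simpa using hs0) (hπQ n)).2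
    rw [← Complex.ofReal_neg, ← Complex.ofReal_cpow (hπQ n).le, Complex.Gamma_ofReal,
      ← Complex.ofReal_mul, Real.mul_rpow Real.pi_pos.le (hQ n).le] at h
    rw [← Complex.ofReal_inj, ← h, ← integral_complex_ofReal]
    refine setIntegral_congr_fun measurableSet_Ioi fun t ht => ?_
    have ht0 : 0 < t := ht
    simp only [hF]
    rw [norm_mul, Complex.norm_real, Real.norm_of_nonneg (Real.exp_pos _).le,
      Complex.norm_cpow_eq_rpow_re_of_pos ht0, Complex.sub_re, Complex.one_re,
      Complex.ofReal_mul, Complex.ofReal_cpow ht0.le]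
    push_cast
    rfl
  have hFsum : Summable fun n => ∫ t in Set.Ioi (0 : ℝ), ‖F n t‖ := by
    simp only [hnF]
    refine Summable.mul_left _ (Summable.mul_left _ ?_)
    refine (summable_latticeForm_rpow z hs).comp_injective (i := fun n : ℤ => ![((m : ℕ) : ℤ), n]) ?_
    intro n n' h
    have := congrFun h 1
    simpa using this
  have key1 := hasSum_integral_of_summable_integral_norm
    (fun n => (integral_Ioi_cpow_mul_exp hs0 (hπQ n)).1) hFsum
  have hGint : ∀ k, Integrable (G k) (volume.restrict (Set.Ioi 0)) := fun k =>
    ((integrableOn_cpow_mul_exp hν hy m k).const_mul _).mul_const _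
  have hnG : ∀ k, k ≠ 0 → ∫ t in Set.Ioi (0 : ℝ), ‖G k t‖ = Real.sqrt z.im *
      ((|(k : ℝ)| / (m : ℕ)) ^ (s - 1 / 2).re *
        ‖besselK (s - 1 / 2).re (|(k : ℝ)| * (m : ℕ) * z.im)‖) := by
    intro k hk
    simp only [hG, norm_mul (_ * _) (fourierExp _ _), norm_fourierExp, mul_one,
      norm_mul (Real.sqrt z.im : ℂ)]
    rw [integral_const_mul, integral_norm_cpow_mul_exp m hk, Complex.norm_real,
      Real.norm_of_nonneg (Real.sqrt_nonneg _)]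
  have hGsum : Summable fun k => ∫ t in Set.Ioi (0 : ℝ), ‖G k t‖ := by
    obtain ⟨u, hu, hu0, hb⟩ := summable_row_bound hy hν.le
    refine Summable.of_norm_bounded_eventually (g := fun k => Real.sqrt z.im *
      (u k * Real.exp (-(Real.pi / 2 * z.im * (m : ℕ))))) ((hu.mul_right _).mul_left _) ?_
    have : {(0 : ℤ)}ᶜ ∈ (cofinite : Filter ℤ) := (Set.finite_singleton _).compl_mem_cofinite
    filter_upwards [this] with k hk
    rw [hnG k hk, Real.norm_of_nonneg (by positivity)]
    exact mul_le_mul_of_nonneg_left (hb _ (Complex.ofReal_re _) m k hk) (Real.sqrt_nonneg _)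
  have key2 := hasSum_integral_of_summable_integral_norm hGint hGsum
  have heq : ∫ t in Set.Ioi (0 : ℝ), ∑' n, F n t = ∫ t in Set.Ioi (0 : ℝ), ∑' k, G k t := by
    refine setIntegral_congr_fun measurableSet_Ioi fun t ht => ?_
    have ht0 : 0 < t := ht
    have htC : (t : ℂ) ≠ 0 := by exact_mod_cast ht0.ne'
    have h := tsum_exp_latticeForm z (m : ℕ) ht0
    have e : ∀ k : ℤ, G k t = ((Real.sqrt z.im : ℂ) * (t : ℂ) ^ (s - 1 / 2 - 1)) *
        ((Real.exp (-(Real.pi * z.im * ((((m : ℕ) : ℤ) : ℝ) ^ 2 * t + (k : ℝ) ^ 2 / t))) : ℂ) *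
          fourierExp (k * (m : ℕ)) z.re) := fun k => by
      simp only [hG, Int.cast_natCast]; ring
    rw [tsum_congr e, tsum_mul_left, tsum_mul_left, h]
    have hsq : ((Real.sqrt (z.im / t) : ℝ) : ℂ) = (Real.sqrt z.im : ℂ) / (t : ℂ) ^ (1 / 2 : ℂ) := by
      rw [Real.sqrt_div hy.le, Real.sqrt_eq_rpow t]
      push_cast [Complex.ofReal_cpow ht0.le]
      rfl
    have hpow : (t : ℂ) ^ (s - 1 / 2 - 1) = (t : ℂ) ^ (s - 1) / (t : ℂ) ^ (1 / 2 : ℂ) := by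
      rw [← Complex.cpow_sub _ _ htC]; congr 1; ring
    rw [hsq, hpow]
    ring
  have hG0 : ∀ k, ∫ t in Set.Ioi (0 : ℝ), G k t = rowTerm s z m k := by
    intro k
    rcases eq_or_ne k 0 with rfl | hk
    · rw [rowTerm, if_pos rfl, ← (integral_Ioi_cpow_mul_exp hν (r := Real.pi * z.im * (m : ℕ) ^ 2)
        (by positivity)).2, ← integral_const_mul]
      refine integral_congr_ae (Eventually.of_forall fun t => ?_)
      simp only [hG, Int.cast_zero]
      have : fourierExp (0 * ((m : ℕ) : ℤ)) z.re = 1 := by simp [fourierExp]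
      rw [this, mul_one]
      congr 4
      simp
      ring
    · rw [rowTerm, if_neg hk, ← integral_cpow_mul_exp_eq_besselK _ hm (by positivity : 0 < |(k : ℝ)|),
        ← integral_const_mul, ← integral_mul_const]
      simp only [hG, sq_abs]
  simp only [hG0] at key2
  rw [← tsum_mul_left, ← tsum_congr hFint, key1.tsum_eq, heq]
  exact key2

/-! ### Series of Bessel functions -/

/-- The divisor sum `∑_{d e = n} (e / d) ^ ν`. -/
def divisorCoeff (ν : ℂ) (n : ℕ) : ℂ :=
  ∑ p ∈ n.divisorsAntidiagonal, ((p.2 / p.1 : ℝ) : ℂ) ^ ν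

/-- Crude: at most `n` divisors, each contributing at most `n ^ A`. Any polynomial bound suffices
against the exponential decay of the Bessel functions. -/
theorem norm_divisorCoeff_le {A : ℝ} {ν : ℂ} (hν : |ν.re| ≤ A) (n : ℕ) :
    ‖divisorCoeff ν n‖ ≤ (n : ℝ) ^ (A + 1) := by
  rcases Nat.eq_zero_or_pos n with rfl | hn
  · simp [divisorCoeff]; positivity
  have hn1 : (1 : ℝ) ≤ n := by exact_mod_cast hn
  have hterm : ∀ p ∈ n.divisorsAntidiagonal, ‖((p.2 / p.1 : ℝ) : ℂ) ^ ν‖ ≤ (n : ℝ) ^ A := by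
    intro p hp
    rw [Nat.mem_divisorsAntidiagonal] at hp
    have h1 : 0 < p.1 := Nat.pos_of_ne_zero fun h => hp.2 (by rw [← hp.1, h, zero_mul])
    have h2 : 0 < p.2 := Nat.pos_of_ne_zero fun h => hp.2 (by rw [← hp.1, h, mul_zero])
    have h1' : (1 : ℝ) ≤ p.1 := by exact_mod_cast h1
    have h2' : (1 : ℝ) ≤ p.2 := by exact_mod_cast h2
    have hpn : (p.1 : ℝ) * p.2 = n := by exact_mod_cast hp.1
    have hpos : (0 : ℝ) < p.2 / p.1 := by positivity
    rw [Complex.norm_cpow_eq_rpow_re_of_pos hpos]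
    have hA : ν.re ≤ A := (le_abs_self _).trans hν
    have hA' : -ν.re ≤ A := (neg_le_abs _).trans hν
    rcases le_total 0 ν.re with h0 | h0
    · calc (p.2 / p.1 : ℝ) ^ ν.re ≤ (n : ℝ) ^ ν.re := by
            gcongr
            rw [div_le_iff₀ (by positivity)]; nlinarith
        _ ≤ _ := Real.rpow_le_rpow_of_exponent_le hn1 hA
    · have e : (p.2 / p.1 : ℝ) ^ ν.re = (p.1 / p.2 : ℝ) ^ (-ν.re) := by
        rw [Real.rpow_neg (by positivity), ← Real.inv_rpow (by positivity), inv_div]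
      rw [e]
      calc (p.1 / p.2 : ℝ) ^ (-ν.re) ≤ (n : ℝ) ^ (-ν.re) := by
            apply Real.rpow_le_rpow (by positivity) _ (by linarith)
            rw [div_le_iff₀ (by positivity)]; nlinarith
        _ ≤ _ := Real.rpow_le_rpow_of_exponent_le hn1 hA'
  refine (norm_sum_le_of_le _ hterm).trans ?_
  rw [Finset.sum_const, nsmul_eq_mul, Real.rpow_add_one (by positivity), mul_comm]
  gcongr
  rw [← Nat.map_div_right_divisors, Finset.card_map]
  exact Nat.card_divisors_le_self n

theorem differentiable_divisorCoeff (n : ℕ) : Differentiable ℂ fun ν => divisorCoeff ν n := by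
  unfold divisorCoeff
  refine Differentiable.fun_sum fun p hp => ?_
  rw [Nat.mem_divisorsAntidiagonal] at hp
  have h1 : (p.1 : ℝ) ≠ 0 := by
    intro h; exact hp.2 (by rw [← hp.1, Nat.cast_eq_zero.1 h, zero_mul])
  have h2 : (p.2 : ℝ) ≠ 0 := by
    intro h; exact hp.2 (by rw [← hp.1, Nat.cast_eq_zero.1 h, mul_zero])
  exact differentiable_id.const_cpow (Or.inl (by exact_mod_cast div_ne_zero h2 h1))

/-- The term `b_n √y K_ν(|n| y) e(n x)`. -/
def besselTerm (ν : ℂ) (b : ℤ → ℂ) (z : ℍ) (n : ℤ) : ℂ :=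
  b n * ((Real.sqrt z.im : ℂ) * besselK ν (|(n : ℝ)| * z.im)) * fourierExp n z.re

/-- Half of the decay `exp(-π|n|y)` pays for the sum over `n`. The other half is at most
`exp(-πy/2)`, of which one half absorbs `√y ≤ exp(πy/4)` and the rest remains as uniform decay at
the cusp. -/
theorem exists_bound_sqrt_mul_besselK (A B : ℝ) {δ : ℝ} (hδ : 0 < δ) :
    ∃ u : ℤ → ℝ, Summable u ∧ (∀ n, 0 ≤ u n) ∧ ∀ (ν : ℂ) (y : ℝ) (n : ℤ), |ν.re| ≤ A → δ ≤ y →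
      n ≠ 0 → |(n : ℝ)| ^ B * ‖(Real.sqrt y : ℂ) * besselK ν (|(n : ℝ)| * y)‖ ≤
        u n * Real.exp (-(Real.pi / 4 * y)) := by
  obtain ⟨C, hC0, hC⟩ := norm_besselK_le A hδ
  refine ⟨fun n => C * (|(n : ℝ)| ^ B * Real.exp (-(Real.pi / 2 * δ * |(n : ℝ)|))),
    (summable_int_rpow_mul_exp B (by positivity)).mul_left C, fun n => by positivity,
    fun ν y n hν hy hn => ?_⟩
  have hn1 : (1 : ℝ) ≤ |(n : ℝ)| := by exact_mod_cast Int.one_le_abs hn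
  have hy0 : 0 < y := hδ.trans_le hy
  have hsq : Real.sqrt y ≤ Real.exp (Real.pi / 4 * y) := by
    refine le_trans ?_ (Real.add_one_le_exp _)
    have h1 : Real.sqrt y ≤ (1 + y) / 2 := by
      nlinarith [Real.sq_sqrt hy0.le, sq_nonneg (Real.sqrt y - 1)]
    nlinarith [Real.pi_gt_three]
  have h1 := hC ν (|(n : ℝ)| * y) hν (hy.trans (le_mul_of_one_le_left hy0.le hn1))
  rw [norm_mul, Complex.norm_real, Real.norm_of_nonneg (Real.sqrt_nonneg _)]
  calc |(n : ℝ)| ^ B * (Real.sqrt y * ‖besselK ν (|(n : ℝ)| * y)‖)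
      ≤ |(n : ℝ)| ^ B * (Real.exp (Real.pi / 4 * y) * (C * Real.exp (-(Real.pi * (|(n : ℝ)| * y))))) := by
        gcongr
    _ ≤ |(n : ℝ)| ^ B * (Real.exp (Real.pi / 4 * y) * (C *
          Real.exp (-(Real.pi / 2 * δ * |(n : ℝ)|) + -(Real.pi / 2 * y)))) := by
        gcongr
        have h2 : δ * |(n : ℝ)| ≤ y * |(n : ℝ)| := by gcongr
        have h3 : y ≤ y * |(n : ℝ)| := le_mul_of_one_le_right hy0.le hn1
        nlinarith [Real.pi_pos]
    _ = _ := by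
        rw [Real.exp_add, show -(Real.pi / 2 * y) = -(Real.pi / 4 * y) + -(Real.pi / 4 * y) by ring,
          Real.exp_add, Real.exp_neg (Real.pi / 4 * y)]
        field_simp

/-- The non-constant part of an Eisenstein series, up to a factor. -/
def eisensteinTail (s : ℂ) (z : ℍ) : ℂ :=
  ∑' n : ℤ, besselTerm (s - 1 / 2) (fun n => divisorCoeff (s - 1 / 2) n.natAbs) z n

theorem besselTerm_divisorCoeff_zero (ν : ℂ) (z : ℍ) :
    besselTerm ν (fun n => divisorCoeff ν n.natAbs) z 0 = 0 := by
  simp [besselTerm, divisorCoeff]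

theorem exists_bound_eisensteinTail_term (A : ℝ) {δ : ℝ} (hδ : 0 < δ) :
    ∃ u : ℤ → ℝ, Summable u ∧ (∀ n, 0 ≤ u n) ∧ ∀ (ν : ℂ) (z : ℍ) (n : ℤ), |ν.re| ≤ A →
      δ ≤ z.im → ‖besselTerm ν (fun n => divisorCoeff ν n.natAbs) z n‖ ≤
        u n * Real.exp (-(Real.pi / 4 * z.im)) := by
  obtain ⟨u, hu, hu0, hb⟩ := exists_bound_sqrt_mul_besselK A (A + 1) hδ
  refine ⟨u, hu, hu0, fun ν z n hν hz => ?_⟩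
  rcases eq_or_ne n 0 with rfl | hn
  · rw [besselTerm_divisorCoeff_zero, norm_zero]
    have := hu0 0
    positivity
  · rw [besselTerm, norm_mul, norm_fourierExp, mul_one, norm_mul]
    refine le_trans ?_ (hb ν z.im n hν hz hn)
    gcongr
    have := norm_divisorCoeff_le hν n.natAbs
    rwa [Nat.cast_natAbs, Int.cast_abs] at this

theorem summable_eisensteinTail_term (ν : ℂ) (z : ℍ) :
    Summable fun n => ‖besselTerm ν (fun n => divisorCoeff ν n.natAbs) z n‖ := by
  obtain ⟨u, hu, hu0, hb⟩ := exists_bound_eisensteinTail_term |ν.re| z.im_pos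
  exact Summable.of_nonneg_of_le (fun n => norm_nonneg _) (fun n => hb ν z n le_rfl le_rfl)
    (hu.mul_right _)

theorem exists_norm_eisensteinTail_le (A : ℝ) {δ : ℝ} (hδ : 0 < δ) :
    ∃ C, 0 ≤ C ∧ ∀ (s : ℂ) (z : ℍ), |(s - 1 / 2).re| ≤ A → δ ≤ z.im →
      ‖eisensteinTail s z‖ ≤ C * Real.exp (-(Real.pi / 4 * z.im)) := by
  obtain ⟨u, hu, hu0, hb⟩ := exists_bound_eisensteinTail_term A hδ
  refine ⟨∑' n, u n, tsum_nonneg hu0, fun s z hs hz => ?_⟩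
  rw [← tsum_mul_right]
  exact tsum_of_norm_bounded (hu.mul_right _).hasSum fun n => hb _ z n hs hz

theorem differentiable_eisensteinTail (z : ℍ) : Differentiable ℂ fun s => eisensteinTail s z := by
  intro s
  obtain ⟨u, hu, hu0, hb⟩ := exists_bound_eisensteinTail_term (|(s - 1 / 2).re| + 1) z.im_pos
  have hopen : IsOpen {w : ℂ | |(w - 1 / 2).re| < |(s - 1 / 2).re| + 1} :=
    isOpen_lt (by fun_prop) continuous_const
  refine (Complex.differentiableOn_tsum_of_summable_norm (u := fun n =>
    u n * Real.exp (-(Real.pi / 4 * z.im))) (hu.mul_right _) (fun n w _ => ?_) hopen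
    (fun n w hw => hb _ z n (le_of_lt hw) le_rfl)).differentiableAt (hopen.mem_nhds (by simp))
  refine DifferentiableAt.differentiableWithinAt ?_
  rcases eq_or_ne n 0 with rfl | hn
  · simp only [besselTerm_divisorCoeff_zero]
    exact differentiableAt_const _
  · unfold besselTerm
    have hpos : 0 < |(n : ℝ)| * z.im := mul_pos (by positivity) z.im_pos
    have h1 := (differentiable_besselK hpos).comp (differentiable_id.sub_const (1 / 2 : ℂ))
    have h2 := (differentiable_divisorCoeff n.natAbs).comp (differentiable_id.sub_const (1 / 2 : ℂ))
    exact ((h2 w).mul ((differentiableAt_const _).mul (h1 w))).mul (differentiableAt_const _)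

theorem measurable_eisensteinTail (s : ℂ) : Measurable (eisensteinTail s) := by
  unfold eisensteinTail
  have him := UpperHalfPlane.continuous_im.measurable
  have hre := UpperHalfPlane.continuous_re.measurable
  refine Measurable.tsum fun n => ?_
  unfold besselTerm
  rcases eq_or_ne n 0 with rfl | hn
  · simp [divisorCoeff]
  · have hr : 0 < |(n : ℝ)| := by positivity
    have hK : Continuous fun z : ℍ => besselK (s - 1 / 2) (|(n : ℝ)| * z.im) := by
      rw [continuous_iff_continuousAt]
      intro z
      exact ContinuousAt.comp (f := fun z : ℍ => |(n : ℝ)| * z.im)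
        (hasDerivAt_besselMoment 0 (s - 1 / 2) (mul_pos hr z.im_pos)).continuousAt
        (by have := UpperHalfPlane.continuous_im; fun_prop)
    have hf : Measurable fun z : ℍ => fourierExp n z.re :=
      (continuous_fourierExp n).measurable.comp hre
    refine (Measurable.mul measurable_const (Measurable.mul ?_ hK.measurable)).mul hf
    fun_prop

theorem tsum_prod_eq_tsum_divisorCoeff {ν : ℂ} {g : ℕ → ℂ}
    (hs : Summable fun p : ℕ+ × ℕ+ => ((((p.2 : ℕ) : ℝ) / (p.1 : ℕ) : ℝ) : ℂ) ^ ν * g (p.1 * p.2)) :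
    ∑' p : ℕ+ × ℕ+, ((((p.2 : ℕ) : ℝ) / (p.1 : ℕ) : ℝ) : ℂ) ^ ν * g (p.1 * p.2) =
      ∑' n : ℕ+, divisorCoeff ν n * g n := by
  rw [← sigmaAntidiagonalEquivProd.tsum_eq]
  have hs' := sigmaAntidiagonalEquivProd.summable_iff.2 hs
  rw [Summable.tsum_sigma (by exact hs')]
  refine tsum_congr fun n => ?_
  rw [tsum_fintype, divisorCoeff, Finset.sum_mul]
  refine Eq.trans (Finset.sum_congr rfl fun p _ => ?_) (Finset.sum_coe_sort
    (n : ℕ).divisorsAntidiagonal fun p => ((p.2 / p.1 : ℝ) : ℂ) ^ ν * g n)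
  have hp := (Nat.mem_divisorsAntidiagonal.1 p.2).1
  simp only [sigmaAntidiagonalEquivProd, Equiv.coe_fn_mk, divisorsAntidiagonalFactors, PNat.mk_coe]
  rw [hp]

/-! ### The Fourier expansion of the Eisenstein series -/

theorem summable_rowTerm_pair {s : ℂ} (hs : 1 < s.re) (z : ℍ) :
    Summable fun p : ℕ+ × ℤ => if p.2 = 0 then 0 else rowTerm s z p.1 p.2 := by
  have hν : 0 < (s - 1 / 2).re := by simp; linarith
  have hy := z.im_pos
  obtain ⟨u, hu, hu0, hb⟩ := summable_row_bound z.im_pos hν.le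
  have hv : Summable fun m : ℕ+ => Real.exp (-(Real.pi / 2 * z.im * (m : ℕ))) := by
    have h := (Real.summable_pow_mul_exp_neg_nat_mul 0 (r := Real.pi / 2 * z.im) (by positivity)).comp_injective
      PNat.coe_injective
    simpa [Function.comp_def] using h
  refine Summable.of_norm_bounded (g := fun p : ℕ+ × ℤ => Real.sqrt z.im *
    (Real.exp (-(Real.pi / 2 * z.im * (p.1 : ℕ))) * u p.2)) ?_ fun p => ?_
  · exact (Summable.mul_of_nonneg hv hu (fun _ => (Real.exp_pos _).le) hu0).mul_left _
  · have hm : (0 : ℝ) < (p.1 : ℕ) := by exact_mod_cast p.1.pos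
    by_cases hp : p.2 = 0
    · rw [if_pos hp, norm_zero]
      exact mul_nonneg (Real.sqrt_nonneg _) (mul_nonneg (Real.exp_pos _).le (hu0 _))
    · rw [if_neg hp, rowTerm, if_neg hp, norm_mul, norm_fourierExp, mul_one, norm_mul, norm_mul,
        Complex.norm_real, Real.norm_of_nonneg (Real.sqrt_nonneg _),
        Complex.norm_cpow_eq_rpow_re_of_pos (by positivity)]
      have h := hb (s - 1 / 2) rfl p.1 p.2 hp
      rw [mul_comm (u p.2)] at h
      exact mul_le_mul_of_nonneg_left h (Real.sqrt_nonneg _)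

/-- Pairs of a row `m` and a frequency `±k` are regrouped by `n = mk`, the index of the character;
the weights `(k/m)^(s-1/2)` add up to the divisor sum. The two signs of `k` are treated separately.
-/
theorem tsum_rowTerm_sign {s : ℂ} (hs : 1 < s.re) (z : ℍ) (ε : ℤˣ) :
    ∑' m : ℕ+, ∑' k : ℕ+, rowTerm s z m ((ε : ℤ) * (k : ℕ)) =
      ∑' n : ℕ+, besselTerm (s - 1 / 2) (fun n => divisorCoeff (s - 1 / 2) n.natAbs) z
        ((ε : ℤ) * (n : ℕ)) := by
  set g : ℕ → ℂ := fun N => (Real.sqrt z.im : ℂ) * besselK (s - 1 / 2) (N * z.im) *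
    fourierExp ((ε : ℤ) * N) z.re with hg
  have habs : ∀ k : ℕ, |(((ε : ℤ) * (k : ℕ) : ℤ) : ℝ)| = k := by
    intro k
    rcases Int.units_eq_one_or ε with rfl | rfl <;> simp
  have hne : ∀ k : ℕ+, (ε : ℤ) * (k : ℕ) ≠ 0 := fun k =>
    mul_ne_zero ε.ne_zero (by exact_mod_cast k.ne_zero)
  have e : ∀ m k : ℕ+, rowTerm s z m ((ε : ℤ) * (k : ℕ)) =
      ((((k : ℕ) : ℝ) / (m : ℕ) : ℝ) : ℂ) ^ (s - 1 / 2) * g (m * k) := by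
    intro m k
    rw [rowTerm, if_neg (hne k), habs]
    simp only [hg]
    have h1 : (ε : ℤ) * ((m : ℕ) * (k : ℕ) : ℕ) = (ε : ℤ) * (k : ℕ) * (m : ℕ) := by push_cast; ring
    rw [h1]
    push_cast
    rw [mul_comm ((m : ℕ) : ℝ)]
    ring
  have hsum : Summable fun p : ℕ+ × ℕ+ =>
      ((((p.2 : ℕ) : ℝ) / (p.1 : ℕ) : ℝ) : ℂ) ^ (s - 1 / 2) * g (p.1 * p.2) := by
    have := (summable_rowTerm_pair hs z).comp_injective
      (i := fun p : ℕ+ × ℕ+ => (p.1, (ε : ℤ) * (p.2 : ℕ))) (by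
        rintro ⟨a, b⟩ ⟨c, d⟩ h
        simp only [Prod.mk.injEq, mul_right_inj' ε.ne_zero, Nat.cast_inj, PNat.coe_inj] at h
        rw [h.1, h.2])
    refine this.congr fun p => ?_
    simp only [Function.comp_apply, if_neg (hne p.2)]
    exact e p.1 p.2
  have e' : ∀ n : ℕ+, besselTerm (s - 1 / 2) (fun n => divisorCoeff (s - 1 / 2) n.natAbs) z
        ((ε : ℤ) * (n : ℕ)) = divisorCoeff (s - 1 / 2) n * g n := by
    intro n
    rw [besselTerm, habs, Int.natAbs_mul, Int.units_natAbs, one_mul, Int.natAbs_natCast]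
    simp only [hg]; ring
  rw [tsum_congr e', ← tsum_prod_eq_tsum_divisorCoeff hsum, hsum.tsum_prod]
  simp only [e]

theorem tsum_rowTerm {s : ℂ} (hs : 1 < s.re) (z : ℍ) :
    HasSum (fun m : ℕ+ => ∑' k : ℤ, if k = 0 then 0 else rowTerm s z m k) (eisensteinTail s z) := by
  have hsum := summable_rowTerm_pair hs z
  have h1 : ∀ m : ℕ+, ∑' k : ℤ, (if k = 0 then 0 else rowTerm s z m k) =
      ∑' k : ℕ+, rowTerm s z m (((1 : ℤˣ) : ℤ) * (k : ℕ)) +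
        ∑' k : ℕ+, rowTerm s z m (((-1 : ℤˣ) : ℤ) * (k : ℕ)) := by
    intro m
    rw [tsum_int_eq_zero_add_tsum_pnat (hsum.prod_factor m)]
    simp
  have h2 : ∀ ε : ℤˣ, Summable fun m : ℕ+ => ∑' k : ℕ+, rowTerm s z m ((ε : ℤ) * (k : ℕ)) := by
    intro ε
    have hne : ∀ k : ℕ+, (ε : ℤ) * (k : ℕ) ≠ 0 := fun k =>
      mul_ne_zero ε.ne_zero (by exact_mod_cast k.ne_zero)
    have h := hsum.comp_injective
      (i := fun p : ℕ+ × ℕ+ => (p.1, (ε : ℤ) * (p.2 : ℕ))) (by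
        rintro ⟨a, b⟩ ⟨c, d⟩ h
        simp only [Prod.mk.injEq, mul_right_inj' ε.ne_zero, Nat.cast_inj, PNat.coe_inj] at h
        rw [h.1, h.2])
    refine (h.prod).congr fun m => tsum_congr fun k => ?_
    simp only [Function.comp_apply, if_neg (hne k)]
  have h3 := (h2 1).hasSum.add (h2 (-1)).hasSum
  rw [tsum_rowTerm_sign hs z 1, tsum_rowTerm_sign hs z (-1)] at h3
  simp only [← h1] at h3
  convert h3 using 1
  rw [eisensteinTail, tsum_int_eq_zero_add_tsum_pnat (summable_eisensteinTail_term _ z).of_norm,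
    besselTerm_divisorCoeff_zero]
  simp

theorem hasSum_rowTerm_zero {s : ℂ} (hs : 1 < s.re) (z : ℍ) :
    HasSum (fun m : ℕ+ => rowTerm s z m 0)
      (completedRiemannZeta (2 * s - 1) * (z.im : ℂ) ^ (1 - s)) := by
  have hy := z.im_pos
  have hyC : (z.im : ℂ) ≠ 0 := by exact_mod_cast hy.ne'
  have h2 : 1 < (2 * s - 1).re := by simp; linarith
  have hsum : Summable fun m : ℕ+ => 1 / ((m : ℕ) : ℂ) ^ (2 * s - 1) :=
    (Complex.summable_one_div_nat_cpow.2 h2).comp_injective PNat.coe_injective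
  have hz : ∑' m : ℕ+, 1 / ((m : ℕ) : ℂ) ^ (2 * s - 1) = ∑' n : ℕ, 1 / (n : ℂ) ^ (2 * s - 1) := by
    rw [← tsum_zero_pnat_eq_tsum_nat (f := fun n : ℕ => 1 / (n : ℂ) ^ (2 * s - 1))
      (Complex.summable_one_div_nat_cpow.2 h2)]
    rw [Nat.cast_zero, Complex.zero_cpow (by intro h; rw [h] at h2; simp at h2; linarith)]
    simp
  have h := hsum.hasSum.mul_left ((Real.pi : ℂ) ^ (-(2 * s - 1) / 2) *
    Complex.Gamma ((2 * s - 1) / 2) * (z.im : ℂ) ^ (1 - s))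
  rw [hz] at h
  rw [completedZeta_eq_tsum_of_one_lt_re h2]
  have e : (fun m : ℕ+ => rowTerm s z m 0) = fun m : ℕ+ => (Real.pi : ℂ) ^ (-(2 * s - 1) / 2) *
      Complex.Gamma ((2 * s - 1) / 2) * (z.im : ℂ) ^ (1 - s) * (1 / ((m : ℕ) : ℂ) ^ (2 * s - 1)) := by
    funext m
    have hm : (0 : ℝ) < (m : ℕ) := by exact_mod_cast m.pos
    have hmC : ((m : ℕ) : ℂ) ≠ 0 := by exact_mod_cast hm.ne'
    rw [rowTerm, if_pos rfl, Complex.ofReal_mul, Complex.mul_cpow_ofReal_nonneg (by positivity) (by positivity),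
      Complex.ofReal_mul, Complex.mul_cpow_ofReal_nonneg (by positivity) (by positivity)]
    have e1 : (Real.sqrt z.im : ℂ) = (z.im : ℂ) ^ (1 / 2 : ℂ) := by
      rw [Real.sqrt_eq_rpow, Complex.ofReal_cpow hy.le]; norm_num
    have e2 : (z.im : ℂ) ^ (1 - s) = (z.im : ℂ) ^ (1 / 2 : ℂ) * (z.im : ℂ) ^ (-(s - 1 / 2)) := by
      rw [← Complex.cpow_add _ _ hyC]; congr 1; ring
    have e3 : 1 / ((m : ℕ) : ℂ) ^ (2 * s - 1) = (((((m : ℕ) : ℝ) ^ 2 : ℝ)) : ℂ) ^ (-(s - 1 / 2)) := by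
      rw [one_div, ← Complex.cpow_neg, sq, Complex.ofReal_mul, Complex.mul_cpow_ofReal_nonneg hm.le hm.le]
      rw [Complex.ofReal_natCast, ← Complex.cpow_add _ _ hmC]; congr 1; ring
    have e4 : -(2 * s - 1) / 2 = -(s - 1 / 2) := by ring
    have e5 : (2 * s - 1) / 2 = s - 1 / 2 := by ring
    rw [e1, e2, e3, e4, e5]
    ring
  rw [e, mul_right_comm _ (∑' n : ℕ, 1 / (n : ℂ) ^ (2 * s - 1))]
  exact h

/-- In the lattice sum the row `m = 0` gives `2ζ(2s) y^s` and the rows `±m` agree. After Poisson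
summation the zero frequencies of the rows `m ≥ 1` add up to the `y^(1-s)` term, and the other
frequencies form the tail. -/
theorem completedRiemannZeta_mul_eisensteinSum {s : ℂ} (hs : 1 < s.re) (z : ℍ) :
    completedRiemannZeta (2 * s) * eisensteinSum s z =
      completedRiemannZeta (2 * s) * (z.im : ℂ) ^ s +
        completedRiemannZeta (2 * s - 1) * (z.im : ℂ) ^ (1 - s) + eisensteinTail s z := by
  have hs0 : 0 < s.re := one_pos.trans hs
  have hsne : s ≠ 0 := by rintro rfl; simp at hs0
  have hy := z.im_pos
  have hyC : (z.im : ℂ) ≠ 0 := by exact_mod_cast hy.ne'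
  have h2 : 1 < (2 * s).re := by simp; linarith
  have h2s : 2 * s ≠ 0 := mul_ne_zero two_ne_zero hsne
  have hξ : completedRiemannZeta (2 * s) =
      (Real.pi : ℂ) ^ (-s) * Complex.Gamma s * riemannZeta (2 * s) := by
    rw [riemannZeta_def_of_ne_zero h2s, Complex.Gammaℝ_def]
    have : Complex.Gamma s ≠ 0 := Complex.Gamma_ne_zero_of_re_pos hs0
    have hpi : (Real.pi : ℂ) ^ (-s) ≠ 0 := by
      rw [Complex.cpow_ne_zero_iff]; exact Or.inl (by exact_mod_cast Real.pi_ne_zero)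
    rw [show -(2 * s) / 2 = -s by ring, show 2 * s / 2 = s by ring]
    field_simp
  have hsum : Summable fun v : Fin 2 → ℤ => ((latticeForm z v : ℝ) : ℂ) ^ (-s) := by
    refine Summable.of_norm ?_
    simp only [norm_latticeForm_cpow z hs0]
    exact summable_latticeForm_rpow z hs
  have hsum2 : Summable fun p : ℤ × ℤ => ((latticeForm z ![p.1, p.2] : ℝ) : ℂ) ^ (-s) :=
    (finTwoArrowEquiv ℤ).symm.summable_iff.2 hsum
  have hneg : ∀ v : Fin 2 → ℤ, latticeForm z (-v) = latticeForm z v := by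
    intro v
    have := latticeForm_smul z (-1) v
    simpa using this
  set r : ℤ → ℂ := fun m => ∑' n : ℤ, ((latticeForm z ![m, n] : ℝ) : ℂ) ^ (-s) with hr
  have hreven : r.Even := by
    intro m
    simp only [hr]
    rw [← (Equiv.neg ℤ).tsum_eq]
    refine tsum_congr fun n => ?_
    rw [← hneg]
    congr 3
    ext i; fin_cases i <;> simp
  have h1 : ∑' v : Fin 2 → ℤ, ((latticeForm z v : ℝ) : ℂ) ^ (-s) =
      r 0 + 2 * ∑' m : ℕ+, r (m : ℕ) := by
    rw [← (finTwoArrowEquiv ℤ).symm.tsum_eq]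
    refine Eq.trans hsum2.tsum_prod ?_
    exact (tsum_int_eq_zero_add_two_mul_tsum_pnat hreven hsum2.prod).trans (by
      rw [nsmul_eq_mul, Nat.cast_ofNat])
  have hr0 : r 0 = 2 * riemannZeta (2 * s) * (z.im : ℂ) ^ s := by
    have hev : Function.Even fun n : ℤ => ((latticeForm z ![0, n] : ℝ) : ℂ) ^ (-s) := by
      intro n
      simp only
      rw [← hneg]
      congr 3
      ext i; fin_cases i <;> simp
    have hval : ∀ n : ℕ+, ((latticeForm z ![0, ((n : ℕ) : ℤ)] : ℝ) : ℂ) ^ (-s) =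
        (z.im : ℂ) ^ s * (1 / ((n : ℕ) : ℂ) ^ (2 * s)) := by
      intro n
      have hn : (0 : ℝ) < (n : ℕ) := by exact_mod_cast n.pos
      have hnC : ((n : ℕ) : ℂ) ≠ 0 := by exact_mod_cast hn.ne'
      have e0 : latticeForm z ![0, ((n : ℕ) : ℤ)] = ((n : ℕ) : ℝ) * ((n : ℕ) : ℝ) * z.im⁻¹ := by
        rw [latticeForm_row]; push_cast; ring
      rw [e0, Complex.ofReal_mul, Complex.mul_cpow_ofReal_nonneg (by positivity) (by positivity),
        Complex.ofReal_mul, Complex.mul_cpow_ofReal_nonneg hn.le hn.le, Complex.ofReal_natCast,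
        ← Complex.cpow_add _ _ hnC, one_div, ← Complex.cpow_neg, Complex.ofReal_inv,
        Complex.inv_cpow _ _ (by
          rw [Complex.arg_ofReal_of_nonneg hy.le]; exact Real.pi_ne_zero.symm),
        Complex.cpow_neg (z.im : ℂ) s, inv_inv, mul_comm]
      congr 2; ring
    have hz0 : ((latticeForm z ![0, 0] : ℝ) : ℂ) ^ (-s) = 0 := by
      rw [latticeForm_row]; simp [hsne]
    simp only [hr]
    rw [tsum_int_eq_zero_add_two_mul_tsum_pnat hev (hsum2.prod_factor 0), hz0, tsum_congr hval,
      tsum_mul_left, zeta_eq_tsum_one_div_nat_cpow h2,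
      ← tsum_zero_pnat_eq_tsum_nat (f := fun n : ℕ => 1 / (n : ℂ) ^ (2 * s))
      (Complex.summable_one_div_nat_cpow.2 h2), Nat.cast_zero, Complex.zero_cpow h2s]
    simp; ring
  have hrow : HasSum (fun m : ℕ+ => (Real.pi : ℂ) ^ (-s) * Complex.Gamma s * r (m : ℕ))
      (completedRiemannZeta (2 * s - 1) * (z.im : ℂ) ^ (1 - s) + eisensteinTail s z) := by
    have h := (hasSum_rowTerm_zero hs z).add (tsum_rowTerm hs z)
    have e : (fun m : ℕ+ => (Real.pi : ℂ) ^ (-s) * Complex.Gamma s * r (m : ℕ)) = fun m : ℕ+ =>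
        rowTerm s z m 0 + ∑' k : ℤ, if k = 0 then 0 else rowTerm s z m k := by
      funext m
      have h5 := hasSum_rowTerm hs z m
      rw [← h5.tsum_eq, h5.summable.tsum_eq_add_tsum_ite 0]
    rw [e]
    exact h
  have h3 := tsum_latticeForm_cpow z hs
  rw [h1, hr0] at h3
  have h4 := hrow.tsum_eq
  rw [tsum_mul_left] at h4
  rw [hξ]
  linear_combination (-(1 / 2) * (Real.pi : ℂ) ^ (-s) * Complex.Gamma s) * h3 + h4

/-! ### Meromorphic continuation of Eisenstein series -/

/-- Passing to normal form fills in removable singularities, so agreement with an analytic function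
off the point extends to the point. -/
theorem toMeromorphicNFOn_of_eventuallyEq {f h : ℂ → ℂ} {x : ℂ} (hf : MeromorphicOn f Set.univ)
    (hh : AnalyticAt ℂ h x) (e : f =ᶠ[𝓝[≠] x] h) : toMeromorphicNFOn f Set.univ =ᶠ[𝓝 x] h := by
  have h1 : toMeromorphicNFOn f Set.univ =ᶠ[𝓝[≠] x] h :=
    (hf.toMeromorphicNFOn_eq_self_on_nhdsNE (Set.mem_univ x)).trans e
  exact ((meromorphicNFOn_toMeromorphicNFOn f Set.univ (Set.mem_univ x)).eventuallyEq_nhdsNE_iff_eventuallyEq_nhds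
    hh.meromorphicNFAt).1 h1

theorem isMeromorphicContinuation_toMeromorphicNFOn {F g : ℂ → ℂ} {σ : ℝ}
    (hg : MeromorphicOn g Set.univ) (h : ∀ s : ℂ, σ < s.re → AnalyticAt ℂ g s ∧ g s = F s) :
    IsMeromorphicContinuation F (toMeromorphicNFOn g Set.univ) :=
  ⟨meromorphicNFOn_toMeromorphicNFOn g Set.univ, σ, fun s hs =>
    (toMeromorphicNFOn_of_eventuallyEq hg (h s hs).1 (Eventually.of_forall fun _ => rfl)).eq_of_nhds.trans
      (h s hs).2⟩

theorem meromorphicContinuation_eventuallyEq {F g : ℂ → ℂ} {σ : ℝ} (hg : MeromorphicOn g Set.univ)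
    (h : ∀ s : ℂ, σ < s.re → AnalyticAt ℂ g s ∧ g s = F s) {x : ℂ} (hx : AnalyticAt ℂ g x) :
    meromorphicContinuation F =ᶠ[𝓝 x] g := by
  rw [(isMeromorphicContinuation_toMeromorphicNFOn hg h).eq]
  exact toMeromorphicNFOn_of_eventuallyEq hg hx (Eventually.of_forall fun _ => rfl)

/-- The entire function `2s (2s - 1) ξ(2s)`. -/
def xiEntire (s : ℂ) : ℂ := 2 * s * (2 * s - 1) * completedRiemannZeta₀ (2 * s) + 1

theorem differentiable_xiEntire : Differentiable ℂ xiEntire := by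
  have := differentiable_completedZeta₀
  unfold xiEntire
  fun_prop

theorem xiEntire_eq {s : ℂ} (h0 : s ≠ 0) (h1 : 2 * s ≠ 1) :
    xiEntire s = 2 * s * (2 * s - 1) * completedRiemannZeta (2 * s) := by
  have h2 : 1 - 2 * s ≠ 0 := sub_ne_zero.2 h1.symm
  rw [xiEntire, completedRiemannZeta_eq]
  field_simp
  ring

/-- Non-vanishing of `ζ` on `Re ≥ 1`; at `s = 1/2` the pole of `ξ(2s)` is cancelled and the value is
`1`. Consequently the only pole of `E_s` in `Re s ≥ 1/2` is `s = 1`. -/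
theorem xiEntire_ne_zero {s : ℂ} (hs : 1 / 2 ≤ s.re) : xiEntire s ≠ 0 := by
  by_cases h1 : 2 * s = 1
  · rw [xiEntire, h1]; simp
  have h0 : s ≠ 0 := by rintro rfl; norm_num at hs
  rw [xiEntire_eq h0 h1]
  have h2 : (1 : ℝ) ≤ (2 * s).re := by simp; linarith
  have h3 := riemannZeta_ne_zero_of_one_le_re h2
  rw [riemannZeta_def_of_ne_zero (mul_ne_zero two_ne_zero h0)] at h3
  exact mul_ne_zero (mul_ne_zero (mul_ne_zero two_ne_zero h0) (sub_ne_zero.2 h1))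
    fun h => h3 (by rw [h, zero_div])

/-- The residue factor `(s - 1) c_s`. -/
def scatteringNum (s : ℂ) : ℂ := s * xiEntire (1 - s) / xiEntire s

/-- The reciprocal of `ξ(2 s)`. -/
def recipXi (s : ℂ) : ℂ := 2 * s * (2 * s - 1) / xiEntire s

/-- The right hand side of the Fourier expansion of the Eisenstein series. -/
def eisensteinFormula (s : ℂ) (z : ℍ) : ℂ :=
  (z.im : ℂ) ^ s + scatteringNum s / (s - 1) * (z.im : ℂ) ^ (1 - s) + recipXi s * eisensteinTail s z

/-- The right hand side of the Fourier expansion multiplied by `s - 1`. -/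
def eisensteinFormulaNum (s : ℂ) (z : ℍ) : ℂ :=
  (s - 1) * (z.im : ℂ) ^ s + scatteringNum s * (z.im : ℂ) ^ (1 - s) +
    (s - 1) * recipXi s * eisensteinTail s z

theorem differentiable_im_cpow (z : ℍ) : Differentiable ℂ fun s : ℂ => (z.im : ℂ) ^ s :=
  differentiable_id.const_cpow (Or.inl (by exact_mod_cast z.im_pos.ne'))

theorem analyticAt_scatteringNum {s : ℂ} (hs : xiEntire s ≠ 0) : AnalyticAt ℂ scatteringNum s := by
  have h := differentiable_xiEntire
  exact ((by fun_prop : Differentiable ℂ fun s => s * xiEntire (1 - s)).analyticAt s).div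
    (h.analyticAt s) hs

theorem analyticAt_recipXi {s : ℂ} (hs : xiEntire s ≠ 0) : AnalyticAt ℂ recipXi s := by
  have h := differentiable_xiEntire
  exact ((by fun_prop : Differentiable ℂ fun s : ℂ => 2 * s * (2 * s - 1)).analyticAt s).div
    (h.analyticAt s) hs

theorem meromorphicOn_scatteringNum : MeromorphicOn scatteringNum Set.univ := fun s _ => by
  have h := differentiable_xiEntire
  exact ((by fun_prop : Differentiable ℂ fun s => s * xiEntire (1 - s)).analyticAt s).meromorphicAt.div
    (h.analyticAt s).meromorphicAt

theorem meromorphicOn_recipXi : MeromorphicOn recipXi Set.univ := fun s _ => by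
  have h := differentiable_xiEntire
  exact ((by fun_prop : Differentiable ℂ fun s : ℂ => 2 * s * (2 * s - 1)).analyticAt s).meromorphicAt.div
    (h.analyticAt s).meromorphicAt

theorem analyticAt_eisensteinFormulaNum (z : ℍ) {s : ℂ} (hs : xiEntire s ≠ 0) :
    AnalyticAt ℂ (fun s => eisensteinFormulaNum s z) s := by
  have h1 := (differentiable_im_cpow z).analyticAt s
  have h2 := ((differentiable_im_cpow z).comp (differentiable_id.const_sub (1 : ℂ))).analyticAt s
  have h3 := (differentiable_eisensteinTail z).analyticAt s
  exact (((analyticAt_id.sub analyticAt_const).mul h1).add ((analyticAt_scatteringNum hs).mul h2)).add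
    (((analyticAt_id.sub analyticAt_const).mul (analyticAt_recipXi hs)).mul h3)

theorem analyticAt_eisensteinFormula (z : ℍ) {s : ℂ} (hs : xiEntire s ≠ 0) (h1 : s ≠ 1) :
    AnalyticAt ℂ (fun s => eisensteinFormula s z) s := by
  have h2 := (differentiable_im_cpow z).analyticAt s
  have h3 := ((differentiable_im_cpow z).comp (differentiable_id.const_sub (1 : ℂ))).analyticAt s
  have h4 := (differentiable_eisensteinTail z).analyticAt s
  exact (h2.add (((analyticAt_scatteringNum hs).div (analyticAt_id.sub analyticAt_const)
    (sub_ne_zero.2 h1)).mul h3)).add ((analyticAt_recipXi hs).mul h4)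

theorem meromorphicOn_eisensteinFormulaNum (z : ℍ) :
    MeromorphicOn (fun s => eisensteinFormulaNum s z) Set.univ := fun s hs => by
  have h1 := ((differentiable_im_cpow z).analyticAt s).meromorphicAt
  have h2 := (((differentiable_im_cpow z).comp
    (differentiable_id.const_sub (1 : ℂ))).analyticAt s).meromorphicAt
  have h3 := ((differentiable_eisensteinTail z).analyticAt s).meromorphicAt
  have h4 : MeromorphicAt (fun s : ℂ => s - 1) s :=
    (analyticAt_id.sub analyticAt_const).meromorphicAt
  exact ((h4.mul h1).add ((meromorphicOn_scatteringNum s hs).mul h2)).add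
    ((h4.mul (meromorphicOn_recipXi s hs)).mul h3)

theorem meromorphicOn_eisensteinFormula (z : ℍ) :
    MeromorphicOn (fun s => eisensteinFormula s z) Set.univ := fun s hs => by
  have h1 := ((differentiable_im_cpow z).analyticAt s).meromorphicAt
  have h2 := (((differentiable_im_cpow z).comp
    (differentiable_id.const_sub (1 : ℂ))).analyticAt s).meromorphicAt
  have h3 := ((differentiable_eisensteinTail z).analyticAt s).meromorphicAt
  have h4 : MeromorphicAt (fun s : ℂ => s - 1) s :=
    (analyticAt_id.sub analyticAt_const).meromorphicAt
  exact (h1.add (((meromorphicOn_scatteringNum s hs).div h4).mul h2)).add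
    ((meromorphicOn_recipXi s hs).mul h3)

/-- The functional equation of `ξ` identifies `ξ(2s - 1)` with `ξ(2 - 2s)`, so the coefficient of
`y^(1-s)` becomes a quotient of values of `xiEntire`. -/
theorem eisensteinFormula_eq_eisensteinSum {s : ℂ} (hs : 1 < s.re) (z : ℍ) :
    eisensteinFormula s z = eisensteinSum s z := by
  have h0 : s ≠ 0 := by rintro rfl; norm_num at hs
  have h1 : s ≠ 1 := by rintro rfl; norm_num at hs
  have h2 : 2 * s ≠ 1 := by
    intro h
    have := congrArg Complex.re h
    simp at this
    linarith
  have hp : xiEntire s ≠ 0 := xiEntire_ne_zero (by linarith)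
  have h3 : 1 - s ≠ 0 := sub_ne_zero.2 h1.symm
  have h3' : s - 1 ≠ 0 := sub_ne_zero.2 h1
  have h4 : 2 * (1 - s) ≠ 1 := by
    intro h
    have := congrArg Complex.re h
    simp at this
    linarith
  have h5 : 2 * s - 1 ≠ 0 := sub_ne_zero.2 h2
  have hp' : xiEntire (1 - s) =
      2 * (1 - s) * (2 * (1 - s) - 1) * completedRiemannZeta (2 * s - 1) := by
    rw [xiEntire_eq h3 h4, ← completedRiemannZeta_one_sub (2 * s - 1)]
    congr 2; ring
  have key := completedRiemannZeta_mul_eisensteinSum hs z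
  have hX : completedRiemannZeta (2 * s) = xiEntire s / (2 * s * (2 * s - 1)) := by
    rw [xiEntire_eq h0 h2]; field_simp
  rw [hX] at key
  rw [eisensteinFormula, scatteringNum, recipXi, hp']
  field_simp at key ⊢
  linear_combination (1 - s) * key

theorem eisensteinFormulaNum_eq {s : ℂ} (hs : 1 < s.re) (z : ℍ) :
    eisensteinFormulaNum s z = (s - 1) * eisensteinSum s z := by
  have h1 : s - 1 ≠ 0 := sub_ne_zero.2 (by rintro rfl; norm_num at hs)
  rw [← eisensteinFormula_eq_eisensteinSum hs, eisensteinFormula, eisensteinFormulaNum]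
  field_simp

theorem ne_one_of_one_lt_re {s : ℂ} (hs : 1 < s.re) : s ≠ 1 := by rintro rfl; norm_num at hs

theorem eisenstein_eq {s : ℂ} (hs : 1 / 2 ≤ s.re) (h1 : s ≠ 1) (z : ℍ) :
    eisenstein s z = eisensteinFormula s z := by
  rw [eisenstein, if_neg h1]
  exact (meromorphicContinuation_eventuallyEq (σ := 1) (meromorphicOn_eisensteinFormula z)
    (fun s hs => ⟨analyticAt_eisensteinFormula z (xiEntire_ne_zero (by linarith))
      (ne_one_of_one_lt_re hs), eisensteinFormula_eq_eisensteinSum hs z⟩)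
    (analyticAt_eisensteinFormula z (xiEntire_ne_zero hs) h1)).eq_of_nhds

theorem eisensteinStar_eq_deriv (z : ℍ) :
    eisensteinStar z = deriv (fun s => eisensteinFormulaNum s z) 1 := by
  rw [eisensteinStar]
  exact (meromorphicContinuation_eventuallyEq (σ := 1) (meromorphicOn_eisensteinFormulaNum z)
    (fun s hs => ⟨analyticAt_eisensteinFormulaNum z (xiEntire_ne_zero (by linarith)),
      eisensteinFormulaNum_eq hs z⟩)
    (analyticAt_eisensteinFormulaNum z (xiEntire_ne_zero (by norm_num)))).deriv_eq

theorem eisensteinStar_eq (z : ℍ) : eisensteinStar z = z.im + deriv scatteringNum 1 -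
    scatteringNum 1 * Complex.log z.im + recipXi 1 * eisensteinTail 1 z := by
  rw [eisensteinStar_eq_deriv]
  have hy : (z.im : ℂ) ≠ 0 := by exact_mod_cast z.im_pos.ne'
  have hp : xiEntire 1 ≠ 0 := xiEntire_ne_zero (by norm_num)
  have d1 : HasDerivAt (fun s : ℂ => (z.im : ℂ) ^ s) ((z.im : ℂ) ^ (1 : ℂ) * Complex.log z.im * 1) 1 :=
    (hasDerivAt_id (1 : ℂ)).const_cpow (Or.inl hy)
  have d2 : HasDerivAt (fun s : ℂ => (z.im : ℂ) ^ (1 - s))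
      ((z.im : ℂ) ^ (1 - 1 : ℂ) * Complex.log z.im * -1) 1 :=
    ((hasDerivAt_id (1 : ℂ)).const_sub 1).const_cpow (Or.inl hy)
  have d3 := (analyticAt_scatteringNum hp).differentiableAt.hasDerivAt
  have d4 : HasDerivAt (fun s : ℂ => s - 1) 1 1 := (hasDerivAt_id (1 : ℂ)).sub_const 1
  have d5 := (analyticAt_recipXi hp).differentiableAt.hasDerivAt
  have d6 := (differentiable_eisensteinTail z 1).hasDerivAt
  have h := ((d4.mul d1).add (d3.mul d2)).add ((d4.mul d5).mul d6)
  refine h.deriv.trans ?_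
  simp
  ring

theorem eisenstein_smul (s : ℂ) (γ : SL(2, ℤ)) (z : ℍ) : eisenstein s (γ • z) = eisenstein s z := by
  simp only [eisenstein, eisensteinStar, eisensteinSum_smul]

/-! ### Integrals over the fundamental domain -/

theorem half_le_im_of_mem_fd {z : ℍ} (hz : z ∈ 𝒟) : 1 / 2 ≤ z.im := by
  have h := ModularGroup.three_le_four_mul_im_sq_of_mem_fd hz
  nlinarith [z.im_pos]

theorem volume_fd_lt_top : volume (𝒟 : Set ℍ) < ⊤ := by
  have h := lintegral_halfPlane (φ := (𝒟 : Set ℍ).indicator 1)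
    (measurable_one.indicator measurableSet_fd)
  rw [lintegral_indicator_one measurableSet_fd] at h
  rw [h]
  have hle : ∀ y ∈ Set.Ioi (0 : ℝ), ENNReal.ofReal (1 / y ^ 2) *
      ∫⁻ x : ℝ, (𝒟 : Set ℍ).indicator (1 : ℍ → ENNReal) (halfPlanePoint (y, x)) ≤
      (Set.Ioi (1 / 4 : ℝ)).indicator (fun y => ENNReal.ofReal (y ^ (-2 : ℝ))) y := by
    intro y hy
    by_cases hy4 : 1 / 4 < y
    · rw [Set.indicator_of_mem (Set.mem_Ioi.2 hy4)]
      have e : y ^ (-2 : ℝ) = 1 / y ^ 2 := by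
        rw [Real.rpow_neg (Set.mem_Ioi.1 hy).le, one_div]; norm_cast
      rw [e]
      refine mul_le_of_le_one_right zero_le ?_
      calc ∫⁻ x : ℝ, (𝒟 : Set ℍ).indicator (1 : ℍ → ENNReal) (halfPlanePoint (y, x))
          ≤ ∫⁻ x : ℝ, (Set.Icc (-(1 / 2) : ℝ) (1 / 2)).indicator 1 x := by
            refine lintegral_mono fun x => ?_
            by_cases hx : halfPlanePoint (y, x) ∈ (𝒟 : Set ℍ)
            · have h2 := hx.2
              rw [halfPlanePoint_re hy, abs_le] at h2
              rw [Set.indicator_of_mem hx, Set.indicator_of_mem (by exact h2)]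
              rfl
            · rw [Set.indicator_of_notMem hx]; exact zero_le
        _ = 1 := by
            rw [lintegral_indicator_one measurableSet_Icc, Real.volume_Icc]; norm_num
    · rw [Set.indicator_of_notMem (by simpa using hy4)]
      have : ∀ x : ℝ, (𝒟 : Set ℍ).indicator (1 : ℍ → ENNReal) (halfPlanePoint (y, x)) = 0 := by
        intro x
        refine Set.indicator_of_notMem (fun hx => ?_) _
        have := half_le_im_of_mem_fd hx
        rw [halfPlanePoint_im hy] at this
        linarith
      simp [this]
  refine (setLIntegral_mono' measurableSet_Ioi hle).trans_lt ?_
  refine (setLIntegral_le_lintegral _ _).trans_lt ?_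
  rw [lintegral_indicator measurableSet_Ioi]
  exact (integrableOn_Ioi_rpow_of_lt (by norm_num : (-2 : ℝ) < -1) (by norm_num)).lintegral_lt_top

/-- Measurable `SL(2, ℤ)`-invariant functions of exponential decay at the cusp. -/
structure IsRapidlyDecreasing (h : ℍ → ℂ) : Prop where
  measurable : Measurable h
  invariant : ∀ (γ : SL(2, ℤ)) (z : ℍ), h (γ • z) = h z
  exists_norm_le : ∃ C c : ℝ, 0 ≤ C ∧ 0 < c ∧ ∀ z, ‖h z‖ ≤ C * Real.exp (-(c * z.im))

/-- A point below height `1/2` is moved into `𝒟`, whose points have height at least `1/2`; enlarging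
the constant by `exp c` covers the difference. -/
theorem IsRapidlyDecreasing.of_norm_le {h : ℍ → ℂ} (hm : Measurable h)
    (hinv : ∀ (γ : SL(2, ℤ)) (z : ℍ), h (γ • z) = h z) {C c : ℝ} (hC : 0 ≤ C) (hc : 0 < c)
    (hb : ∀ z : ℍ, 1 / 2 ≤ z.im → ‖h z‖ ≤ C * Real.exp (-(c * z.im))) : IsRapidlyDecreasing h := by
  refine ⟨hm, hinv, C * Real.exp c, c, by positivity, hc, fun z => ?_⟩
  rw [mul_assoc, ← Real.exp_add]
  rcases le_or_gt (1 / 2) z.im with hz | hz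
  · refine (hb z hz).trans ?_
    gcongr
    linarith
  · obtain ⟨γ, hγ⟩ := ModularGroup.exists_smul_mem_fd z
    have h1 := half_le_im_of_mem_fd hγ
    rw [← hinv γ z]
    refine (hb _ h1).trans ?_
    gcongr
    nlinarith

/-- Families of functions that are entire in the parameter and grow subexponentially at the cusp,
locally uniformly in the parameter. -/
structure IsModerateFamily (F : ℂ → ℍ → ℂ) : Prop where
  differentiable : ∀ z, Differentiable ℂ fun w => F w z
  measurable : ∀ w, Measurable (F w)
  exists_norm_le : ∀ R c : ℝ, 0 < c → ∃ C, 0 ≤ C ∧ ∀ (w : ℂ) (z : ℍ), ‖w‖ ≤ R → 1 / 2 ≤ z.im →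
    ‖F w z‖ ≤ C * Real.exp (c * z.im)

theorem isModerateFamily_im_cpow : IsModerateFamily fun w z => (z.im : ℂ) ^ w := by
  refine ⟨differentiable_im_cpow, fun w => ?_, fun R c hc => ?_⟩
  · have := UpperHalfPlane.continuous_im.measurable
    fun_prop
  · set n := ⌈R⌉₊
    refine ⟨4 ^ n * (n.factorial / c ^ n), by positivity, fun w z hw hz => ?_⟩
    have hy := z.im_pos
    have hr : |w.re| ≤ n := (Complex.abs_re_le_norm w).trans (hw.trans (Nat.le_ceil R))
    obtain ⟨hr1, hr2⟩ := abs_le.1 hr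
    rw [Complex.norm_cpow_eq_rpow_re_of_pos hy]
    -- Since `2 Im z ≥ 1`, splitting off powers of `2` treats both signs of `Re w` at once.
    have e : z.im ^ w.re = (2 * z.im) ^ w.re * 2 ^ (-w.re) := by
      rw [Real.mul_rpow two_pos.le hy.le, Real.rpow_neg two_pos.le]
      have : (2 : ℝ) ^ w.re ≠ 0 := by positivity
      field_simp
    have h1 : (2 * z.im) ^ w.re ≤ (2 * z.im) ^ (n : ℝ) :=
      Real.rpow_le_rpow_of_exponent_le (by linarith) hr2
    have h2 : (2 : ℝ) ^ (-w.re) ≤ 2 ^ (n : ℝ) :=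
      Real.rpow_le_rpow_of_exponent_le (by norm_num) (by linarith)
    rw [Real.rpow_natCast] at h1 h2
    have h3 := Real.pow_div_factorial_le_exp (x := c * z.im) (by positivity) n
    rw [div_le_iff₀ (by positivity)] at h3
    calc z.im ^ w.re ≤ (2 * z.im) ^ n * 2 ^ n := by
          rw [e]; gcongr
      _ = 4 ^ n / c ^ n * (c * z.im) ^ n := by
          rw [mul_pow, mul_pow, show (4 : ℝ) = 2 * 2 by norm_num, mul_pow]
          field_simp
      _ ≤ 4 ^ n / c ^ n * (Real.exp (c * z.im) * n.factorial) := by gcongr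
      _ = _ := by ring

theorem isModerateFamily_eisensteinTail : IsModerateFamily eisensteinTail := by
  refine ⟨differentiable_eisensteinTail, measurable_eisensteinTail, fun R c hc => ?_⟩
  obtain ⟨C, hC0, hC⟩ := exists_norm_eisensteinTail_le (R + 1) (δ := 1 / 2) (by norm_num)
  refine ⟨C, hC0, fun w z hw hz => (hC w z ?_ hz).trans ?_⟩
  · have h1 := Complex.abs_re_le_norm (w - 1 / 2)
    have h2 := norm_sub_le w (1 / 2)
    have h3 : ‖(1 / 2 : ℂ)‖ ≤ 1 := by norm_num
    linarith
  · have := z.im_pos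
    gcongr
    nlinarith [Real.pi_pos, mul_pos hc this, mul_pos Real.pi_pos this]

/-! ### Integrals over the fundamental domain depending on a parameter -/

namespace IsRapidlyDecreasing

variable {h : ℍ → ℂ} {F : ℂ → ℍ → ℂ}

theorem exists_norm_mul_le (hh : IsRapidlyDecreasing h) (hF : IsModerateFamily F) (R : ℝ) :
    ∃ C, ∀ (w : ℂ) (z : ℍ), ‖w‖ ≤ R → 1 / 2 ≤ z.im → ‖F w z * h z‖ ≤ C := by
  obtain ⟨C, c, hC0, hc, hC⟩ := hh.exists_norm_le
  obtain ⟨D, hD0, hD⟩ := hF.exists_norm_le R c hc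
  refine ⟨D * C, fun w z hw hz => ?_⟩
  rw [norm_mul]
  calc ‖F w z‖ * ‖h z‖ ≤ (D * Real.exp (c * z.im)) * (C * Real.exp (-(c * z.im))) :=
        mul_le_mul (hD w z hw hz) (hC z) (norm_nonneg _) (by positivity)
    _ = D * C * (Real.exp (c * z.im) * Real.exp (-(c * z.im))) := by ring
    _ = D * C := by rw [← Real.exp_add]; simp

theorem integrable_bound (C : ℝ) : Integrable (fun _ : ℍ => C) (volume.restrict 𝒟) :=
  integrableOn_const volume_fd_lt_top.ne

theorem ae_bound (hh : IsRapidlyDecreasing h) (hF : IsModerateFamily F) (R : ℝ) :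
    ∃ g : ℍ → ℝ, Integrable g (volume.restrict 𝒟) ∧
      ∀ᵐ z ∂(volume.restrict 𝒟), ∀ w : ℂ, ‖w‖ ≤ R → ‖F w z * h z‖ ≤ g z := by
  obtain ⟨C, hC⟩ := hh.exists_norm_mul_le hF R
  refine ⟨fun _ => C, integrable_bound C, ?_⟩
  filter_upwards [ae_restrict_mem measurableSet_fd] with z hz w hw
  exact hC w z hw (half_le_im_of_mem_fd hz)

theorem integrableOn (hh : IsRapidlyDecreasing h) (hF : IsModerateFamily F) (w : ℂ) :
    IntegrableOn (fun z => F w z * h z) 𝒟 := by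
  obtain ⟨g, hg, hb⟩ := hh.ae_bound hF ‖w‖
  refine hg.mono' ((hF.measurable w).mul hh.measurable).aestronglyMeasurable ?_
  filter_upwards [hb] with z hz using hz w le_rfl

theorem hasDerivAt_integral (hh : IsRapidlyDecreasing h) (hF : IsModerateFamily F) (w : ℂ) :
    IntegrableOn (fun z => deriv (fun w => F w z) w * h z) 𝒟 ∧
    HasDerivAt (fun w => ∫ z in 𝒟, F w z * h z) (∫ z in 𝒟, deriv (fun w => F w z) w * h z) w := by
  have H := hasDerivAt_integral_of_differentiable (μ := volume.restrict 𝒟)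
    (F := fun w z => F w z * h z)
    (fun z => (hF.differentiable z).mul_const _)
    (fun w => ((hF.measurable w).mul hh.measurable).aestronglyMeasurable) (hh.ae_bound hF) w
  have e : ∀ z, deriv (fun w => F w z * h z) w = deriv (fun w => F w z) w * h z := fun z =>
    deriv_mul_const (hF.differentiable z w) _
  simp only [e] at H
  exact H

theorem differentiable_integral (hh : IsRapidlyDecreasing h) (hF : IsModerateFamily F) :
    Differentiable ℂ fun w => ∫ z in 𝒟, F w z * h z :=
  fun w => (hh.hasDerivAt_integral hF w).2.differentiableAt

end IsRapidlyDecreasing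

/-! ### Pairings with Eisenstein series -/

/-- The integral of `y ^ w h` over the fundamental domain. -/
def heightIntegral (h : ℍ → ℂ) (w : ℂ) : ℂ := ∫ z in 𝒟, (z.im : ℂ) ^ w * h z

/-- The integral of the non-constant part of the Eisenstein series against `h`. -/
def tailIntegral (h : ℍ → ℂ) (w : ℂ) : ℂ := ∫ z in 𝒟, eisensteinTail w z * h z

/-- The pairing of `(w - 1) E_w` with `h`. -/
def eisensteinPairingNum (h : ℍ → ℂ) (w : ℂ) : ℂ :=
  (w - 1) * heightIntegral h w + scatteringNum w * heightIntegral h (1 - w) +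
    (w - 1) * recipXi w * tailIntegral h w

/-- The pairing of `E_w` with `h`. -/
def eisensteinPairing (h : ℍ → ℂ) (w : ℂ) : ℂ := eisensteinPairingNum h w / (w - 1)

namespace IsRapidlyDecreasing

variable {h : ℍ → ℂ}

theorem differentiable_heightIntegral (hh : IsRapidlyDecreasing h) :
    Differentiable ℂ (heightIntegral h) := hh.differentiable_integral isModerateFamily_im_cpow

theorem differentiable_tailIntegral (hh : IsRapidlyDecreasing h) :
    Differentiable ℂ (tailIntegral h) := hh.differentiable_integral isModerateFamily_eisensteinTail

theorem analyticAt_eisensteinPairingNum (hh : IsRapidlyDecreasing h) {w : ℂ} (hw : xiEntire w ≠ 0) :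
    AnalyticAt ℂ (eisensteinPairingNum h) w := by
  have h1 := hh.differentiable_heightIntegral.analyticAt w
  have h2 := (hh.differentiable_heightIntegral.comp (differentiable_id.const_sub (1 : ℂ))).analyticAt w
  have h3 := hh.differentiable_tailIntegral.analyticAt w
  exact (((analyticAt_id.sub analyticAt_const).mul h1).add ((analyticAt_scatteringNum hw).mul h2)).add
    (((analyticAt_id.sub analyticAt_const).mul (analyticAt_recipXi hw)).mul h3)

theorem analyticAt_eisensteinPairing (hh : IsRapidlyDecreasing h) {w : ℂ} (hw : xiEntire w ≠ 0)
    (h1 : w ≠ 1) : AnalyticAt ℂ (eisensteinPairing h) w :=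
  (hh.analyticAt_eisensteinPairingNum hw).div (analyticAt_id.sub analyticAt_const)
    (sub_ne_zero.2 h1)

theorem meromorphicOn_eisensteinPairing (hh : IsRapidlyDecreasing h) :
    MeromorphicOn (eisensteinPairing h) Set.univ := fun w hw => by
  have h1 := (hh.differentiable_heightIntegral.analyticAt w).meromorphicAt
  have h2 := ((hh.differentiable_heightIntegral.comp
    (differentiable_id.const_sub (1 : ℂ))).analyticAt w).meromorphicAt
  have h3 := (hh.differentiable_tailIntegral.analyticAt w).meromorphicAt
  have h4 : MeromorphicAt (fun s : ℂ => s - 1) w :=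
    (analyticAt_id.sub analyticAt_const).meromorphicAt
  exact (((h4.mul h1).add ((meromorphicOn_scatteringNum w hw).mul h2)).add
    ((h4.mul (meromorphicOn_recipXi w hw)).mul h3)).div h4

/-- The exponential decay of `h` makes the three parts of the Fourier expansion of `E_w` separately
integrable against it. -/
theorem integral_eisenstein (hh : IsRapidlyDecreasing h) {w : ℂ} (hw : 1 / 2 ≤ w.re) (h1 : w ≠ 1) :
    IntegrableOn (fun z => eisenstein w z * h z) 𝒟 ∧
      ∫ z in 𝒟, eisenstein w z * h z = eisensteinPairing h w := by
  have i1 := hh.integrableOn isModerateFamily_im_cpow w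
  have i2 := (hh.integrableOn isModerateFamily_im_cpow (1 - w)).const_mul (scatteringNum w / (w - 1))
  have i3 := (hh.integrableOn isModerateFamily_eisensteinTail w).const_mul (recipXi w)
  have e : (fun z => eisenstein w z * h z) = fun z => (z.im : ℂ) ^ w * h z +
      scatteringNum w / (w - 1) * ((z.im : ℂ) ^ (1 - w) * h z) +
      recipXi w * (eisensteinTail w z * h z) := by
    funext z
    rw [eisenstein_eq hw h1, eisensteinFormula]; ring
  rw [e]
  refine ⟨(i1.add i2).add i3, ?_⟩
  have i12 : Integrable (fun z : ℍ => (z.im : ℂ) ^ w * h z +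
    scatteringNum w / (w - 1) * ((z.im : ℂ) ^ (1 - w) * h z)) (volume.restrict 𝒟) := i1.add i2
  rw [integral_add i12 i3, integral_add i1 i2, integral_const_mul, integral_const_mul,
    eisensteinPairing, eisensteinPairingNum, heightIntegral, heightIntegral, tailIntegral]
  have := sub_ne_zero.2 h1
  field_simp

/-- `E₁*` is the derivative of `(s - 1) E_s` at `1`, and the parameter derivative passes through the
integral. The logarithm in `E₁*` is the derivative of `y^w` at `w = 0`. -/
theorem integral_eisensteinStar (hh : IsRapidlyDecreasing h) :
    IntegrableOn (fun z => eisensteinStar z * h z) 𝒟 ∧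
      ∫ z in 𝒟, eisensteinStar z * h z = deriv (eisensteinPairingNum h) 1 := by
  obtain ⟨i1, d1⟩ := hh.hasDerivAt_integral isModerateFamily_im_cpow 1
  obtain ⟨i0, d0⟩ := hh.hasDerivAt_integral isModerateFamily_im_cpow 0
  have j1 := hh.integrableOn isModerateFamily_im_cpow 1
  have j0 := hh.integrableOn isModerateFamily_im_cpow 0
  have jt := hh.integrableOn isModerateFamily_eisensteinTail 1
  have e0 : ∀ z : ℍ, deriv (fun w : ℂ => (z.im : ℂ) ^ w) 0 = Complex.log z.im := fun z => by
    have d1 : HasDerivAt (fun s : ℂ => (z.im : ℂ) ^ s) ((z.im : ℂ) ^ (0 : ℂ) * Complex.log z.im * 1) 0 :=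
      (hasDerivAt_id (0 : ℂ)).const_cpow (Or.inl (by exact_mod_cast z.im_pos.ne'))
    rw [d1.deriv]; simp
  simp only [e0] at i0 d0
  simp only [Complex.cpow_one, Complex.cpow_zero, one_mul] at j1 j0
  have k0 := j0.const_mul (deriv scatteringNum 1)
  have k1 := i0.const_mul (scatteringNum 1)
  have kt := jt.const_mul (recipXi 1)
  have e : (fun z => eisensteinStar z * h z) = fun z => (z.im : ℂ) * h z +
      deriv scatteringNum 1 * h z - scatteringNum 1 * (Complex.log z.im * h z) +
      recipXi 1 * (eisensteinTail 1 z * h z) := by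
    funext z
    rw [eisensteinStar_eq]; ring
  rw [e]
  refine ⟨((j1.add k0).sub k1).add kt, ?_⟩
  have l1 : Integrable (fun z : ℍ => (z.im : ℂ) * h z + deriv scatteringNum 1 * h z)
    (volume.restrict 𝒟) := j1.add k0
  have l2 : Integrable (fun z : ℍ => (z.im : ℂ) * h z + deriv scatteringNum 1 * h z -
    scatteringNum 1 * (Complex.log z.im * h z)) (volume.restrict 𝒟) := l1.sub k1
  rw [integral_add l2 kt, integral_sub l1 k1, integral_add j1 k0,
    integral_const_mul, integral_const_mul, integral_const_mul]
  have hp : xiEntire 1 ≠ 0 := xiEntire_ne_zero (by norm_num)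
  have d3 := (analyticAt_scatteringNum hp).differentiableAt.hasDerivAt
  have d4 : HasDerivAt (fun s : ℂ => s - 1) 1 1 := (hasDerivAt_id (1 : ℂ)).sub_const 1
  have d5 := (analyticAt_recipXi hp).differentiableAt.hasDerivAt
  have d6 := (hh.differentiable_tailIntegral 1).hasDerivAt
  have d7 : HasDerivAt (fun w => heightIntegral h (1 - w)) (-∫ z in 𝒟, Complex.log z.im * h z) 1 := by
    have d0' : HasDerivAt (heightIntegral h) (∫ z in 𝒟, Complex.log z.im * h z) (1 - 1) := by
      rw [sub_self]; exact d0
    refine (d0'.comp (1 : ℂ) ((hasDerivAt_id (1 : ℂ)).const_sub 1)).congr_deriv ?_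
    ring
  have hd := ((d4.mul d1).add (d3.mul d7)).add ((d4.mul d5).mul d6)
  have hd' : HasDerivAt (eisensteinPairingNum h) _ 1 := hd
  rw [hd'.deriv]
  simp [heightIntegral, tailIntegral]
  ring

theorem integrable_rpow_mul_exp {r c : ℝ} (hr : 1 < r) (hc : 0 < c) (C : ℝ) :
    Integrable (fun y : ℝ => y ^ r * (C * Real.exp (-(c * y)))) heightMeasure := by
  rw [integrable_heightMeasure_iff]
  have h := (integrableOn_rpow_mul_exp_neg_mul_rpow (s := r - 2) (p := 1) (b := c) (by linarith)
    one_pos hc).const_mul C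
  refine IntegrableOn.congr_fun h (fun y hy => ?_) measurableSet_Ioi
  have hy' : 0 < y := hy
  simp only [Real.rpow_one]
  rw [Real.rpow_sub hy', neg_mul]
  norm_cast
  ring

theorem ae_heightMeasure_pos : ∀ᵐ y ∂heightMeasure, 0 < y :=
  (withDensity_absolutelyContinuous _ _).ae_le (ae_restrict_mem measurableSet_Ioi)

/-- The bound on `h` gives only boundedness as `y → 0`, so convergence of `∫ y^(w-2) dy` at `0` is
what demands `Re w > 1`. -/
theorem integrableOn_unitStrip (hh : IsRapidlyDecreasing h) {w : ℂ} (hw : 1 < w.re) :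
    IntegrableOn (fun z : ℍ => (z.im : ℂ) ^ w * h z) unitStrip := by
  obtain ⟨C, c, hC0, hc, hC⟩ := hh.exists_norm_le
  have hm : Measurable (unitStrip.indicator fun z : ℍ => (z.im : ℂ) ^ w * h z) :=
    ((isModerateFamily_im_cpow.measurable w).mul hh.measurable).indicator measurableSet_unitStrip
  rw [← integrable_indicator_iff measurableSet_unitStrip,
    integrable_halfPlane_iff hm.aestronglyMeasurable]
  have hx : Integrable ((Set.Ioc (0 : ℝ) 1).indicator fun _ => (1 : ℝ)) :=
    (integrable_indicator_iff measurableSet_Ioc).2 (integrableOn_const (by simp))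
  refine ((integrable_rpow_mul_exp hw hc C).mul_prod hx).mono'
    (hm.comp measurable_halfPlanePoint).aestronglyMeasurable ?_
  filter_upwards [Measure.quasiMeasurePreserving_fst.ae ae_heightMeasure_pos] with p hp
  obtain ⟨y, x⟩ := p
  simp only at hp
  by_cases hx : x ∈ Set.Ioc (0 : ℝ) 1
  · have : halfPlanePoint (y, x) ∈ unitStrip := by
      show (halfPlanePoint (y, x)).re ∈ Set.Ioc (0 : ℝ) 1
      rwa [halfPlanePoint_re hp]
    rw [Set.indicator_of_mem this, Set.indicator_of_mem hx, norm_mul, halfPlanePoint_im hp,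
      Complex.norm_cpow_eq_rpow_re_of_pos hp, mul_one]
    have := hC (halfPlanePoint (y, x))
    rw [halfPlanePoint_im hp] at this
    gcongr
  · have : halfPlanePoint (y, x) ∉ unitStrip := by
      show ¬ ((halfPlanePoint (y, x)).re ∈ Set.Ioc (0 : ℝ) 1)
      rwa [halfPlanePoint_re hp]
    rw [Set.indicator_of_notMem this, Set.indicator_of_notMem hx]
    simp

theorem integral_unitStrip (hh : IsRapidlyDecreasing h) {w : ℂ} (hw : 1 < w.re) :
    ∫ z in unitStrip, (z.im : ℂ) ^ w * h z =
      ∫ y in Set.Ioi (0 : ℝ), (y : ℂ) ^ (w - 2) *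
        ∫ x in (0 : ℝ)..1, h (ofComplex (x + y * Complex.I)) := by
  rw [← integral_indicator measurableSet_unitStrip,
    integral_halfPlane ((integrable_indicator_iff measurableSet_unitStrip).2
      (hh.integrableOn_unitStrip hw))]
  refine setIntegral_congr_fun measurableSet_Ioi fun y hy => ?_
  have hy' : 0 < y := hy
  have hyC : (y : ℂ) ≠ 0 := by exact_mod_cast hy'.ne'
  rw [intervalIntegral.integral_of_le zero_le_one, ← integral_indicator measurableSet_Ioc,
    Complex.cpow_sub _ _ hyC, ← integral_const_mul, ← integral_const_mul]
  refine integral_congr_ae (Eventually.of_forall fun x => ?_)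
  simp only
  by_cases hx : x ∈ Set.Ioc (0 : ℝ) 1
  · have : halfPlanePoint (y, x) ∈ unitStrip := by
      show (halfPlanePoint (y, x)).re ∈ Set.Ioc (0 : ℝ) 1
      rwa [halfPlanePoint_re hy']
    rw [Set.indicator_of_mem this, Set.indicator_of_mem hx, halfPlanePoint_im hy']
    norm_cast
    simp only [halfPlanePoint]
    push_cast
    ring
  · have : halfPlanePoint (y, x) ∉ unitStrip := by
      show ¬ ((halfPlanePoint (y, x)).re ∈ Set.Ioc (0 : ℝ) 1)
      rwa [halfPlanePoint_re hy']
    rw [Set.indicator_of_notMem this, Set.indicator_of_notMem hx]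
    simp

theorem eisensteinPairing_eq_integral_unitStrip (hh : IsRapidlyDecreasing h) {w : ℂ}
    (hw : 1 < w.re) : eisensteinPairing h w = ∫ z in unitStrip, (z.im : ℂ) ^ w * h z := by
  rw [← (hh.integral_eisenstein (by linarith) (ne_one_of_one_lt_re hw)).2,
    ← integral_eisensteinSum_mul hh.measurable hh.invariant (hh.integrableOn_unitStrip hw)]
  refine integral_congr_ae (Eventually.of_forall fun z => ?_)
  simp only
  rw [eisenstein_eq (by linarith) (ne_one_of_one_lt_re hw), eisensteinFormula_eq_eisensteinSum hw]

/-- If the unfolded integral vanishes, then `h` is orthogonal to all Eisenstein series and to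
the constants. -/
theorem integral_eq_zero_of_unitStrip (hh : IsRapidlyDecreasing h)
    (h0 : ∀ w : ℂ, 1 < w.re → ∫ z in unitStrip, (z.im : ℂ) ^ w * h z = 0) :
    (∀ w : ℂ, 1 / 2 ≤ w.re → ∫ z in 𝒟, eisenstein w z * h z = 0) ∧ ∫ z in 𝒟, h z = 0 := by
  have hnum : ∀ w : ℂ, 1 < w.re → eisensteinPairingNum h w = 0 := by
    intro w hw
    have h1 := hh.eisensteinPairing_eq_integral_unitStrip hw
    rw [h0 w hw, eisensteinPairing, div_eq_zero_iff] at h1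
    exact h1.resolve_right (sub_ne_zero.2 (ne_one_of_one_lt_re hw))
  have hx := differentiable_xiEntire
  have hM := hh.differentiable_heightIntegral
  have hN := hh.differentiable_tailIntegral
  -- Clearing the denominator `xiEntire` yields an entire function that vanishes on `Re w > 1`,
  -- hence everywhere.
  set L : ℂ → ℂ := fun w => xiEntire w * ((w - 1) * heightIntegral h w) +
    w * xiEntire (1 - w) * heightIntegral h (1 - w) +
    (w - 1) * (2 * w * (2 * w - 1)) * tailIntegral h w with hL
  have hLd : Differentiable ℂ L := by
    simp only [hL]
    fun_prop
  have hLe : ∀ w, xiEntire w ≠ 0 → L w = xiEntire w * eisensteinPairingNum h w := by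
    intro w hw
    simp only [hL, eisensteinPairingNum, scatteringNum, recipXi]
    field_simp
  have hL0 : ∀ w, L w = 0 := by
    have hopen : {w : ℂ | 1 < w.re} ∈ 𝓝 (2 : ℂ) :=
      (isOpen_lt continuous_const Complex.continuous_re).mem_nhds (by simp)
    have := AnalyticOnNhd.eq_of_eventuallyEq (z₀ := (2 : ℂ)) (f := L) (g := 0)
      (fun z _ => hLd.analyticAt z) (fun z _ => analyticAt_const) (by
        filter_upwards [hopen] with w hw
        have hw' : 1 < w.re := hw
        rw [hLe w (xiEntire_ne_zero (by linarith)), hnum w hw', mul_zero]; rfl)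
    exact congrFun this
  have hall : ∀ w, xiEntire w ≠ 0 → eisensteinPairingNum h w = 0 := fun w hw =>
    (mul_eq_zero.1 ((hLe w hw).symm.trans (hL0 w))).resolve_left hw
  have hp : xiEntire 1 ≠ 0 := xiEntire_ne_zero (by norm_num)
  refine ⟨fun w hw => ?_, ?_⟩
  · by_cases h1 : w = 1
    · subst h1
      have e : ∀ z, eisenstein 1 z = eisensteinStar z := fun z => by rw [eisenstein, if_pos rfl]
      simp only [e]
      rw [hh.integral_eisensteinStar.2]
      have : eisensteinPairingNum h =ᶠ[𝓝 1] fun _ => 0 := by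
        filter_upwards [hx.continuous.continuousAt.eventually_ne hp] with w hw using hall w hw
      rw [this.deriv_eq, deriv_const]
    · rw [(hh.integral_eisenstein hw h1).2, eisensteinPairing, hall w (xiEntire_ne_zero hw), zero_div]
  -- At `w = 1` only the residue term survives: a non-zero constant times the integral of `h`.
  · have h1 := hall 1 hp
    have h2 : scatteringNum 1 ≠ 0 := by
      rw [scatteringNum, sub_self, one_mul]
      refine div_ne_zero ?_ hp
      simp [xiEntire]
    simp only [eisensteinPairingNum, sub_self, zero_mul, zero_add, add_zero] at h1
    have h3 := (mul_eq_zero.1 h1).resolve_left h2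
    simpa [heightIntegral] using h3

end IsRapidlyDecreasing

/-! ### The Rankin-Selberg unfolding -/

theorem conj_fourierExp (n : ℤ) (x : ℝ) : conj (fourierExp n x) = fourierExp (-n) x := by
  rw [fourierExp, fourierExp, ← Complex.exp_conj]
  simp only [map_mul, Complex.conj_ofReal, Complex.conj_I, map_intCast, Complex.conj_ofNat]
  congr 1; push_cast; ring

/-- Parseval's identity on a horizontal line, for functions one of which has an absolutely
convergent Fourier series. -/
theorem hasSum_fourierCoeffAt_mul_conj {f g : ℍ → ℂ}
    (hc : ContinuousOn (f ∘ ofComplex) {z : ℂ | 0 < z.im})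
    (hinv : ∀ (γ : SL(2, ℤ)) (z : ℍ), f (γ • z) = f z) {y : ℝ} (hy : 0 < y)
    (hs : Summable fun n : ℤ => ‖fourierCoeffAt f n y‖)
    (hg : IntervalIntegrable (fun x : ℝ => g (ofComplex (x + y * Complex.I))) volume 0 1) :
    HasSum (fun n : ℤ => fourierCoeffAt g n y * conj (fourierCoeffAt f n y))
      (∫ x in (0 : ℝ)..1, g (ofComplex (x + y * Complex.I)) *
        conj (f (ofComplex (x + y * Complex.I)))) := by
  have hgn : ∀ n : ℤ, IntervalIntegrable (fun x : ℝ => conj (fourierCoeffAt f n y) *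
      (g (ofComplex (x + y * Complex.I)) * fourierExp (-n) x)) volume 0 1 := fun n =>
    (hg.mul_continuousOn (continuous_fourierExp (-n)).continuousOn).const_mul _
  have hnorm : ∀ n : ℤ, ∫ x in Set.Ioc (0 : ℝ) 1, ‖conj (fourierCoeffAt f n y) *
      (g (ofComplex (x + y * Complex.I)) * fourierExp (-n) x)‖ = ‖fourierCoeffAt f n y‖ *
      ∫ x in Set.Ioc (0 : ℝ) 1, ‖g (ofComplex (x + y * Complex.I))‖ := by
    intro n
    simp only [norm_mul, norm_fourierExp, mul_one, RCLike.norm_conj]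
    rw [integral_const_mul]
  have h := hasSum_integral_of_summable_integral_norm (μ := volume.restrict (Set.Ioc (0 : ℝ) 1))
    (fun n => (intervalIntegrable_iff_integrableOn_Ioc_of_le zero_le_one).1 (hgn n)) (by
      simp only [hnorm]
      exact hs.mul_right _)
  convert! h using 1
  · funext n
    rw [integral_const_mul, fourierCoeffAt, intervalIntegral.integral_of_le zero_le_one, mul_comm]
  · rw [intervalIntegral.integral_of_le zero_le_one]
    refine setIntegral_congr_fun measurableSet_Ioc fun x _ => ?_
    have hz : (halfPlanePoint (y, x)).im = y := halfPlanePoint_im hy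
    have hr : (halfPlanePoint (y, x)).re = x := halfPlanePoint_re hy
    have h2 := hasSum_fourierCoeffAt hc hinv (halfPlanePoint (y, x)) (by rwa [hz])
    rw [hz, hr] at h2
    have h3 := (h2.map (starRingEnd ℂ) Complex.continuous_conj).mul_left
      (g (ofComplex (x + y * Complex.I)))
    refine (h3.tsum_eq.symm.trans (tsum_congr fun n => ?_))
    simp only [Function.comp_apply, map_mul, conj_fourierExp]
    ring

/-- The Mellin transform of a product of two Bessel functions. -/
def besselMellin (a b w : ℂ) : ℂ :=
  (Real.pi : ℂ) ^ (-w) / 2 * (Complex.Gamma ((w + (a + b)) / 2) *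
    Complex.Gamma ((w - (a + b)) / 2) * Complex.Gamma ((w + (a - b)) / 2) *
    Complex.Gamma ((w - (a - b)) / 2) / Complex.Gamma w)

theorem mellin_besselK_scaled {a b w : ℂ} (hw : |a.re| + |b.re| < w.re) {r : ℝ} (hr : 0 < r) :
    IntegrableOn (fun y : ℝ => (y : ℂ) ^ (w - 1) * (besselK a (r * y) * besselK b (r * y)))
      (Set.Ioi 0) ∧
    ∫ y in Set.Ioi (0 : ℝ), (y : ℂ) ^ (w - 1) * (besselK a (r * y) * besselK b (r * y)) =
      (r : ℂ) ^ (-w) * besselMellin a b w ∧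
    ∫ y in Set.Ioi (0 : ℝ), ‖(y : ℂ) ^ (w - 1) * (besselK a (r * y) * besselK b (r * y))‖ =
      r ^ (-w.re) * ∫ y in Set.Ioi (0 : ℝ), ‖(y : ℂ) ^ (w - 1) * (besselK a y * besselK b y)‖ := by
  obtain ⟨h1, h2⟩ := mellin_besselK_mul_besselK hw
  refine ⟨(MellinConvergent.comp_mul_left (f := fun y => besselK a y * besselK b y) (s := w) hr).2 h1,
    ?_, ?_⟩
  · have := mellin_comp_mul_left (fun y => besselK a y * besselK b y) w hr
    simp only [mellin, smul_eq_mul] at this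
    rw [this, h2, besselMellin]
  · have h3 := integral_comp_mul_left_Ioi
      (fun y : ℝ => ‖(y : ℂ) ^ (w - 1) * (besselK a y * besselK b y)‖) 0 hr
    rw [mul_zero] at h3
    have h4 : ∫ y in Set.Ioi (0 : ℝ), ‖((r * y : ℝ) : ℂ) ^ (w - 1) *
        (besselK a (r * y) * besselK b (r * y))‖ = r ^ (w.re - 1) *
        ∫ y in Set.Ioi (0 : ℝ), ‖(y : ℂ) ^ (w - 1) * (besselK a (r * y) * besselK b (r * y))‖ := by
      rw [← integral_const_mul]
      refine setIntegral_congr_fun measurableSet_Ioi fun y hy => ?_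
      have hy' : 0 < y := hy
      simp only [norm_mul]
      rw [Complex.norm_cpow_eq_rpow_re_of_pos (mul_pos hr hy'),
        Complex.norm_cpow_eq_rpow_re_of_pos hy', Real.mul_rpow hr.le hy'.le]
      simp only [Complex.sub_re, Complex.one_re]
      ring
    rw [h4, smul_eq_mul] at h3
    have h5 : r ^ (w.re - 1) ≠ 0 := (Real.rpow_pos_of_pos hr _).ne'
    have h6 : r ^ (-w.re) = (r ^ (w.re - 1))⁻¹ * r⁻¹ := by
      rw [← Real.rpow_neg hr.le, ← Real.rpow_neg_one r, ← Real.rpow_add hr]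
      congr 1; ring
    rw [h6, mul_assoc, ← h3]
    field_simp

theorem summable_abs_rpow_of_le {t : ℤ → ℂ} {A B σ : ℝ} (hσ : A + 1 < σ)
    (ht : ∀ n : ℤ, n ≠ 0 → ‖t n‖ ≤ B * |(n : ℝ)| ^ A) :
    Summable fun n : {n : ℤ // n ≠ 0} => ‖t n‖ * |((n : ℤ) : ℝ)| ^ (-σ) := by
  have h : Summable fun n : {n : ℤ // n ≠ 0} => B * |((n : ℤ) : ℝ)| ^ (-(σ - A)) :=
    ((Real.summable_abs_int_rpow (b := σ - A) (by linarith)).mul_left B).comp_injective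
      Subtype.val_injective
  refine h.of_nonneg_of_le (fun n => by positivity) fun n => ?_
  have hn : 0 < |((n : ℤ) : ℝ)| := abs_pos.2 (by exact_mod_cast n.2)
  rw [show -(σ - A) = A + -σ by ring, Real.rpow_add hn, ← mul_assoc]
  exact mul_le_mul_of_nonneg_right (ht n n.2) (by positivity)

/-- The Rankin-Selberg unfolding of the pairing of an Eisenstein series with `g * conj f`. -/
theorem IsMaassCuspForm.hasSum_eisensteinPairing {f g : ℍ → ℂ} {s ν w : ℂ} {b c : ℤ → ℂ} {A B : ℝ}
    (hf : IsMaassCuspForm s f)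
    (hc : ∀ n : ℤ, n ≠ 0 → ∀ y : ℝ, 0 < y → fourierCoeffAt f n y =
      c n * ((Real.sqrt y : ℂ) * besselK (s - 1 / 2) (|(n : ℝ)| * y)))
    (hb : ∀ n : ℤ, n ≠ 0 → ∀ y : ℝ, 0 < y → fourierCoeffAt g n y =
      b n * ((Real.sqrt y : ℂ) * besselK ν (|(n : ℝ)| * y)))
    (hg : ∀ y : ℝ, 0 < y →
      IntervalIntegrable (fun x : ℝ => g (ofComplex (x + y * Complex.I))) volume 0 1)
    (hh : IsRapidlyDecreasing fun z => g z * conj (f z))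
    (hbc : ∀ n : ℤ, n ≠ 0 → ‖b n * conj (c n)‖ ≤ B * |(n : ℝ)| ^ A)
    (h1 : 1 < w.re) (hA : A + 1 < w.re) (hw : |ν.re| + |(conj s - 1 / 2).re| < w.re) :
    HasSum (fun n : {n : ℤ // n ≠ 0} => b n * conj (c n) * ((|((n : ℤ) : ℝ)| : ℝ) : ℂ) ^ (-w) *
        besselMellin ν (conj s - 1 / 2) w)
      (eisensteinPairing (fun z => g z * conj (f z)) w) := by
  set μ : ℂ := conj s - 1 / 2 with hμ
  have hpos : ∀ n : {n : ℤ // n ≠ 0}, 0 < |((n : ℤ) : ℝ)| := fun n =>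
    abs_pos.2 (by exact_mod_cast n.2)
  have hS := summable_abs_rpow_of_le (t := fun n => b n * conj (c n)) hA hbc
  -- Scaling `y` by `|n|` extracts `|n|^(-w)` from each Bessel integral, so termwise integration is
  -- justified by absolute convergence of the Dirichlet series.
  have h := hasSum_integral_of_summable_integral_norm (μ := volume.restrict (Set.Ioi (0 : ℝ)))
    (F := fun (n : {n : ℤ // n ≠ 0}) (y : ℝ) => b n * conj (c n) * ((y : ℂ) ^ (w - 1) *
      (besselK ν (|((n : ℤ) : ℝ)| * y) * besselK μ (|((n : ℤ) : ℝ)| * y))))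
    (fun n => ((mellin_besselK_scaled hw (hpos n)).1).const_mul _) (by
      simp only [norm_mul (b _ * conj (c _))]
      simp only [integral_const_mul]
      simp only [(mellin_besselK_scaled hw (hpos _)).2.2]
      simp only [← mul_assoc]
      exact hS.mul_right _)
  simp only [integral_const_mul] at h
  simp only [(mellin_besselK_scaled hw (hpos _)).2.1] at h
  simp only [← mul_assoc] at h
  rw [hh.eisensteinPairing_eq_integral_unitStrip h1, hh.integral_unitStrip h1]
  convert! h using 1
  refine setIntegral_congr_fun measurableSet_Ioi fun y hy => ?_
  have hy' : 0 < y := hy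
  have hP := hasSum_fourierCoeffAt_mul_conj hf.continuousOn hf.invariant hy'
    (hf.summable_norm_fourierCoeffAt hy') (hg y hy')
  rw [← hasSum_subtype_iff_of_support_subset (s := {n : ℤ | n ≠ 0})] at hP
  · refine ((hP.mul_left ((y : ℂ) ^ (w - 2))).tsum_eq.symm.trans (tsum_congr fun n => ?_))
    have hyC : (y : ℂ) ≠ 0 := by exact_mod_cast hy'.ne'
    have hsq : (Real.sqrt y : ℂ) * Real.sqrt y = y := by
      exact_mod_cast Real.mul_self_sqrt hy'.le
    have hconj : conj (besselK (s - 1 / 2) (|((n : ℤ) : ℝ)| * y)) =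
        besselK μ (|((n : ℤ) : ℝ)| * y) := by
      rw [besselK, conj_besselMoment, hμ, besselK]
      simp only [map_sub, map_div₀, map_one, Complex.conj_ofNat]
    have e : (y : ℂ) ^ (w - 1) = (y : ℂ) ^ (w - 2) * (Real.sqrt y * Real.sqrt y) := by
      rw [hsq]
      nth_rewrite 3 [← Complex.cpow_one (y : ℂ)]
      rw [← Complex.cpow_add _ _ hyC]
      congr 1; ring
    simp only [Function.comp_apply]
    rw [hc n n.2 y hy', hb n n.2 y hy', map_mul, map_mul, hconj, Complex.conj_ofReal, e]
    ring
  · intro n hn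
    rw [Function.mem_support] at hn
    rintro rfl
    exact hn (by rw [hf.fourierCoeffAt_zero hy', map_zero, mul_zero])

/-! ### Landau's lemma -/

section

open scoped ComplexOrder

/-- A Dirichlet series with nonnegative coefficients that continues analytically to a closed
half-plane and vanishes at the real point of its boundary line is zero. -/
theorem eq_zero_of_lseriesHasSum {a : ℕ → ℂ} (ha : 0 ≤ a) {R : ℂ → ℂ} {x₀ σ : ℝ}
    (hR : ∀ w : ℂ, x₀ ≤ w.re → AnalyticAt ℂ R w)
    (hs : ∀ w : ℂ, σ < w.re → LSeriesHasSum a w (R w)) (h0 : R x₀ = 0) {N : ℕ} (hN : N ≠ 0) :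
    a N = 0 := by
  classical
  -- Removing the `N`-th term keeps the coefficients non-negative and isolates `a N`.
  set a' : ℕ → ℂ := Function.update a N 0 with ha'
  set x₁ : ℝ := max σ x₀ + 1 with hx₁
  have hσ : σ < x₁ := (le_max_left _ _).trans_lt (lt_add_one _)
  have hx₀ : x₀ < x₁ := (le_max_right _ _).trans_lt (lt_add_one _)
  have hNC : (N : ℂ) ≠ 0 := by exact_mod_cast hN
  set F : ℂ → ℂ := fun w => R w - a N / (N : ℂ) ^ w with hF
  have ha'0 : 0 ≤ a' := by
    intro n
    rcases eq_or_ne n N with rfl | hn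
    · simp [ha']
    · rw [ha', Function.update_of_ne hn]; exact ha n
  have hsum : ∀ w : ℂ, σ < w.re → LSeriesHasSum a' w (F w) := by
    intro w hw
    have h := (hs w hw).update N 0
    have e : LSeries.term a' w = Function.update (LSeries.term a w) N 0 := by
      funext n
      rcases eq_or_ne n N with rfl | hn
      · simp [LSeries.term_def, ha']
      · simp [LSeries.term_def, ha', Function.update_of_ne hn]
    rw [LSeriesHasSum, e]
    convert! h using 1
    rw [hF, LSeries.term_of_ne_zero hN]; ring
  have habs : LSeries.abscissaOfAbsConv a' < x₁ := by
    refine (LSeries.abscissaOfAbsConv_le_of_forall_lt_LSeriesSummable (x := σ) fun y hy => ?_).trans_lt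
      (by exact_mod_cast hσ)
    exact (hsum y (by simpa using hy)).LSeriesSummable
  have hpow : Differentiable ℂ fun w : ℂ => a N / (N : ℂ) ^ w := by
    refine Differentiable.div (differentiable_const _) (differentiable_id.const_cpow (Or.inl hNC))
      fun w => ?_
    rw [Complex.cpow_ne_zero_iff]; exact Or.inl hNC
  have hFan : ∀ w : ℂ, x₀ ≤ w.re → AnalyticAt ℂ F w := fun w hw => (hR w hw).sub (hpow.analyticAt w)
  have hev : F =ᶠ[𝓝 (x₁ : ℂ)] LSeries a' := by
    have : {w : ℂ | σ < w.re} ∈ 𝓝 (x₁ : ℂ) :=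
      (isOpen_lt continuous_const Complex.continuous_re).mem_nhds (by simpa using hσ)
    filter_upwards [this] with w hw
    exact (hsum w hw).LSeries_eq.symm
  -- The disc about `x₁` reaching `x₀` lies in the region of analyticity. The derivatives at `x₁`
  -- alternate in sign because the coefficients are non-negative, so the Taylor series is
  -- non-negative to the left of `x₁`.
  have hpos : ∀ x : ℝ, x₀ < x → x ≤ x₁ → 0 ≤ F x := by
    intro x hx hx'
    have hd : DifferentiableOn ℂ (fun z => F (-z)) (Metric.ball (-x₁ : ℂ) (x₁ - x₀)) := by
      intro z hz
      have h1 := (Complex.abs_re_le_norm (z - -x₁)).trans_lt (by simpa [dist_eq_norm] using hz)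
      rw [abs_lt] at h1
      simp at h1
      exact ((hFan (-z) (by simp; linarith)).differentiableAt.comp z
        differentiable_neg.differentiableAt).differentiableWithinAt
    have h2 := hd.nonneg_of_iteratedDeriv_nonneg (fun n => ?_) (z := (-x : ℂ)) ?_ ?_
    · simpa using h2
    · rw [iteratedDeriv_comp_neg, neg_neg, hev.iteratedDeriv_eq, smul_eq_mul]
      exact LSeries.iteratedDeriv_alternating ha'0 habs n
    · rw [neg_le_neg_iff]; exact_mod_cast hx'
    · rw [Metric.mem_ball, dist_eq_norm, ← Complex.ofReal_neg, ← Complex.ofReal_neg,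
        ← Complex.ofReal_sub, Complex.norm_real, Real.norm_eq_abs, abs_lt]
      constructor <;> linarith
  have hlim : Tendsto (fun x : ℝ => F x) (𝓝[>] x₀) (𝓝 (F x₀)) :=
    ((hFan x₀ (by simp)).continuousAt.tendsto.comp
      (Complex.continuous_ofReal.tendsto x₀)).mono_left nhdsWithin_le_nhds
  have h3 : 0 ≤ F x₀ := by
    refine ge_of_tendsto hlim ?_
    filter_upwards [Ioc_mem_nhdsGT hx₀] with x hx using hpos x hx.1 hx.2
  rw [hF] at h3
  simp only [h0, zero_sub] at h3
  have h4 : (0 : ℂ) < (N : ℂ) ^ (x₀ : ℂ) := by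
    rw [← Complex.ofReal_natCast, ← Complex.ofReal_cpow (Nat.cast_nonneg N)]
    exact_mod_cast Real.rpow_pos_of_pos (by positivity) _
  have h5 : 0 ≤ a N / (N : ℂ) ^ (x₀ : ℂ) := div_nonneg (ha N) h4.le
  -- At `x₀` the remaining series equals `-a N / N ^ x₀`, which is both non-negative and
  -- non-positive.
  have h6 : a N / (N : ℂ) ^ (x₀ : ℂ) = 0 := le_antisymm (neg_nonneg.1 h3) h5
  exact (div_eq_zero_iff.1 h6).resolve_right h4.ne'

end

/-! ### The reciprocal of the Gamma factors -/

/-- The reciprocal of `besselMellin`. -/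
def recipBesselMellin (a b w : ℂ) : ℂ :=
  2 * (Real.pi : ℂ) ^ w * Complex.Gamma w * ((Complex.Gamma ((w + (a + b)) / 2))⁻¹ *
    (Complex.Gamma ((w - (a + b)) / 2))⁻¹ * (Complex.Gamma ((w + (a - b)) / 2))⁻¹ *
    (Complex.Gamma ((w - (a - b)) / 2))⁻¹)

theorem differentiable_pi_cpow : Differentiable ℂ fun w : ℂ => (Real.pi : ℂ) ^ w :=
  differentiable_id.const_cpow (Or.inl (by exact_mod_cast Real.pi_ne_zero))

theorem analyticAt_Gamma {w : ℂ} (hw : 0 < w.re) : AnalyticAt ℂ Complex.Gamma w := by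
  have hopen : IsOpen {w : ℂ | 0 < w.re} := isOpen_lt continuous_const Complex.continuous_re
  refine DifferentiableOn.analyticAt (s := {w : ℂ | 0 < w.re}) (fun z hz => ?_) (hopen.mem_nhds hw)
  refine (Complex.differentiableAt_Gamma _ fun m h => ?_).differentiableWithinAt
  have : 0 < z.re := hz
  rw [h] at this
  simp at this
  linarith [(Nat.cast_nonneg m : (0 : ℝ) ≤ m)]

theorem differentiable_inv_Gamma_comp {u : ℂ → ℂ} (hu : Differentiable ℂ u) :
    Differentiable ℂ fun w => (Complex.Gamma (u w))⁻¹ :=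
  Complex.differentiable_one_div_Gamma.comp hu

/-- The reciprocal Gamma factors are entire; only `Γ(w)` has poles, and those lie in `Re w ≤ 0`. -/
theorem analyticAt_recipBesselMellin (a b : ℂ) {w : ℂ} (hw : 0 < w.re) :
    AnalyticAt ℂ (recipBesselMellin a b) w := by
  have h1 : Differentiable ℂ fun w : ℂ => (w + (a + b)) / 2 := by fun_prop
  have h2 : Differentiable ℂ fun w : ℂ => (w - (a + b)) / 2 := by fun_prop
  have h3 : Differentiable ℂ fun w : ℂ => (w + (a - b)) / 2 := by fun_prop
  have h4 : Differentiable ℂ fun w : ℂ => (w - (a - b)) / 2 := by fun_prop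
  have h5 := (((differentiable_inv_Gamma_comp h1).mul (differentiable_inv_Gamma_comp h2)).mul
    (differentiable_inv_Gamma_comp h3)).mul (differentiable_inv_Gamma_comp h4)
  exact ((analyticAt_const.mul (differentiable_pi_cpow.analyticAt w)).mul (analyticAt_Gamma hw)).mul
    (h5.analyticAt w)

theorem besselMellin_mul_recip {a b w : ℂ} (hw : |a.re| + |b.re| < w.re) :
    besselMellin a b w * recipBesselMellin a b w = 1 := by
  have ha := abs_le.1 (le_refl |a.re|)
  have hb := abs_le.1 (le_refl |b.re|)
  have hw0 : 0 < w.re := by linarith [abs_nonneg a.re, abs_nonneg b.re]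
  have hd : ∀ z : ℂ, 0 < z.re → Complex.Gamma (z / 2) ≠ 0 := fun z hz =>
    Complex.Gamma_ne_zero_of_re_pos (by
      rw [show z / 2 = z / (2 : ℝ) by push_cast; rfl, Complex.div_ofReal_re]; linarith)
  have h1 := hd (w + (a + b)) (by simp; linarith)
  have h2 := hd (w - (a + b)) (by simp; linarith)
  have h3 := hd (w + (a - b)) (by simp; linarith)
  have h4 := hd (w - (a - b)) (by simp; linarith)
  have h5 : Complex.Gamma w ≠ 0 := Complex.Gamma_ne_zero_of_re_pos hw0
  have h6 : (Real.pi : ℂ) ^ w ≠ 0 := by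
    rw [Complex.cpow_ne_zero_iff]; exact Or.inl (by exact_mod_cast Real.pi_ne_zero)
  rw [besselMellin, recipBesselMellin, Complex.cpow_neg]
  field_simp

/-! ### Spectral parameters of cusp forms -/

/-- The eigenvalue is symmetric under `s ↦ 1 - s`, so an upper bound for `Re s` yields a lower one.
-/
theorem IsMaassCuspForm.one_sub {s : ℂ} {f : ℍ → ℂ} (hf : IsMaassCuspForm s f) :
    IsMaassCuspForm (1 - s) f :=
  ⟨hf.smooth, hf.invariant, fun z => by rw [hf.eigen]; ring, hf.memLp, hf.cuspidal, hf.ne_zero⟩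

theorem IsMaassCuspForm.isRapidlyDecreasing {s : ℂ} {f g : ℍ → ℂ} (hf : IsMaassCuspForm s f)
    (hg : Measurable g) (hinv : ∀ (γ : SL(2, ℤ)) (z : ℍ), g (γ • z) = g z) {C : ℝ} (hC0 : 0 ≤ C)
    (hC : ∀ z : ℍ, 1 / 2 ≤ z.im → ‖g z‖ ≤ C * Real.exp z.im) :
    IsRapidlyDecreasing fun z => g z * conj (f z) := by
  obtain ⟨D, hD0, hD⟩ := hf.exists_norm_le_exp
  refine IsRapidlyDecreasing.of_norm_le (C := C * D) (c := 1)
    (hg.mul (Complex.continuous_conj.measurable.comp hf.continuous.measurable))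
    (fun γ z => by rw [hinv, hf.invariant]) (by positivity) one_pos fun z hz => ?_
  rw [norm_mul, RCLike.norm_conj]
  calc ‖g z‖ * ‖f z‖ ≤ (C * Real.exp z.im) * (D * Real.exp (-(Real.pi * z.im))) :=
        mul_le_mul (hC z hz) (hD z) (norm_nonneg _) (by positivity)
    _ = C * D * Real.exp (z.im + -(Real.pi * z.im)) := by rw [Real.exp_add]; ring
    _ ≤ _ := by
        gcongr
        nlinarith [Real.pi_gt_three]

theorem IsMaassCuspForm.eq_zero_of_besselCoeff {s : ℂ} {f : ℍ → ℂ} (hf : IsMaassCuspForm s f)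
    (h0 : ∀ n : ℤ, n ≠ 0 → ∀ y : ℝ, 0 < y → fourierCoeffAt f n y = 0) : f = 0 := by
  funext z
  have h := hasSum_fourierCoeffAt hf.continuousOn hf.invariant z
    (hf.summable_norm_fourierCoeffAt z.im_pos)
  have h1 : ∀ n : ℤ, fourierCoeffAt f n z.im = 0 := fun n => by
    rcases eq_or_ne n 0 with rfl | hn
    · exact hf.fourierCoeffAt_zero z.im_pos
    · exact h0 n hn _ z.im_pos
  simp only [h1, zero_mul] at h
  exact h.unique hasSum_zero

theorem lseriesHasSum_of_hasSum_int {c : ℤ → ℂ} {w R : ℂ}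
    (h : HasSum (fun n : {n : ℤ // n ≠ 0} => c n * ((|((n : ℤ) : ℝ)| : ℝ) : ℂ) ^ (-w)) R) :
    LSeriesHasSum (fun n : ℕ => c n + c (-n)) w R := by
  set F : ℤ → ℂ := fun n => if n = 0 then 0 else c n * ((|(n : ℝ)| : ℝ) : ℂ) ^ (-w) with hF
  have h1 : HasSum F R := by
    rw [← hasSum_subtype_iff_of_support_subset (s := {n : ℤ | n ≠ 0})]
    · convert! h using 1
      funext n
      simp only [hF, Function.comp_apply]
      rw [if_neg n.2]
    · intro n hn
      rw [Function.mem_support] at hn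
      rintro rfl
      exact hn (by simp [hF])
  have h2 := h1.nat_add_neg
  rw [show F 0 = 0 by simp [hF], add_zero] at h2
  rw [LSeriesHasSum]
  convert! h2 using 1
  funext n
  rcases eq_or_ne n 0 with rfl | hn
  · simp [hF]
  · rw [LSeries.term_of_ne_zero hn]
    simp only [hF]
    rw [if_neg (by exact_mod_cast hn), if_neg (by simpa using hn)]
    simp only [Int.cast_natCast, Int.cast_neg, abs_neg, Nat.abs_cast, Complex.ofReal_natCast]
    rw [Complex.cpow_neg]
    ring

/-- This reflects `E_(1/2) = 0`: the two powers of `y` cancel since `c_(1/2) = -1`, and the tail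
drops out because `1/ξ(2s)` vanishes at `s = 1/2`. -/
theorem eisensteinPairingNum_half (h : ℍ → ℂ) : eisensteinPairingNum h (1 / 2) = 0 := by
  have h1 : xiEntire (1 / 2) ≠ 0 := xiEntire_ne_zero (by norm_num)
  have h2 : scatteringNum (1 / 2) = 1 / 2 := by
    rw [scatteringNum, show (1 : ℂ) - 1 / 2 = 1 / 2 by norm_num]
    field_simp
  have h3 : recipXi (1 / 2) = 0 := by rw [recipXi]; norm_num
  rw [eisensteinPairingNum, h2, h3, show (1 : ℂ) - 1 / 2 = 1 / 2 by norm_num]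
  ring

theorem inv_Gamma_eq (z : ℂ) : (Complex.Gamma z)⁻¹ = z * (Complex.Gamma (z + 1))⁻¹ :=
  Complex.one_div_Gamma_eq_self_mul_one_div_Gamma_add_one z

/-- This supplies the zero for Landau's lemma. If `d > 1`, the factor `1/Γ((w-d)/2)` vanishes at `w
= d`, where the pairing is analytic. If `d = 1`, that zero is used up in cancelling the pole of the
pairing at `w = 1`; analyticity then extends to `Re w ≥ 1/2`, and the vanishing at `w = 1/2` serves
instead. -/
theorem exists_analytic_quotient {h : ℍ → ℂ} (hh : IsRapidlyDecreasing h) {a b : ℂ} {d : ℝ}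
    (hab : a + b = d) (hd : 1 ≤ d) : ∃ (R : ℂ → ℂ) (x₀ : ℝ),
      (∀ w : ℂ, x₀ ≤ w.re → AnalyticAt ℂ R w) ∧ R x₀ = 0 ∧
      ∀ w : ℂ, 1 < w.re → R w = eisensteinPairing h w * recipBesselMellin a b w := by
  rcases hd.lt_or_eq with hd | hd
  · refine ⟨fun w => eisensteinPairing h w * recipBesselMellin a b w, d, fun w hw => ?_, ?_,
      fun w _ => rfl⟩
    · exact (hh.analyticAt_eisensteinPairing (xiEntire_ne_zero (by linarith))
        (ne_one_of_one_lt_re (by linarith))).mul (analyticAt_recipBesselMellin a b (by linarith))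
    · simp only [recipBesselMellin, hab, sub_self, zero_div, Complex.Gamma_zero, inv_zero]
      ring
  · subst hd
    rw [Complex.ofReal_one] at hab
    have u1 : Differentiable ℂ fun w : ℂ => (w + 1) / 2 := by fun_prop
    have u3 : Differentiable ℂ fun w : ℂ => (w + (a - b)) / 2 := by fun_prop
    have u4 : Differentiable ℂ fun w : ℂ => (w - (a - b)) / 2 := by fun_prop
    have hG := (((differentiable_inv_Gamma_comp u1).mul (differentiable_inv_Gamma_comp u1)).mul
      (differentiable_inv_Gamma_comp u3)).mul (differentiable_inv_Gamma_comp u4)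
    refine ⟨fun w => eisensteinPairingNum h w * (((Real.pi : ℂ) ^ w * Complex.Gamma w) *
      ((Complex.Gamma ((w + 1) / 2))⁻¹ * (Complex.Gamma ((w + 1) / 2))⁻¹ *
      (Complex.Gamma ((w + (a - b)) / 2))⁻¹ * (Complex.Gamma ((w - (a - b)) / 2))⁻¹)), 1 / 2,
      fun w hw => ?_, ?_, fun w hw => ?_⟩
    · exact (hh.analyticAt_eisensteinPairingNum (xiEntire_ne_zero hw)).mul
        (((differentiable_pi_cpow.analyticAt w).mul (analyticAt_Gamma (by linarith))).mul
          (hG.analyticAt w))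
    · simp only [Complex.ofReal_div, Complex.ofReal_one, Complex.ofReal_ofNat]
      rw [eisensteinPairingNum_half, zero_mul]
    · have h1 : w - 1 ≠ 0 := sub_ne_zero.2 (ne_one_of_one_lt_re hw)
      simp only [recipBesselMellin, hab, eisensteinPairing]
      rw [inv_Gamma_eq ((w - 1) / 2), show (w - 1) / 2 + 1 = (w + 1) / 2 by ring]
      field_simp

/-- The spectral parameter of a cusp form lies in the critical strip. -/
theorem IsMaassCuspForm.re_lt_one {s : ℂ} {f : ℍ → ℂ} (hf : IsMaassCuspForm s f) : s.re < 1 := by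
  by_contra! hs
  obtain ⟨c, hc, C, hC0, hC⟩ := hf.exists_besselCoeff
  obtain ⟨D, hD0, hD⟩ := hf.exists_norm_le_exp
  have hh : IsRapidlyDecreasing fun z => f z * conj (f z) :=
    hf.isRapidlyDecreasing hf.continuous.measurable hf.invariant hD0 fun z _ => (hD z).trans (by
      gcongr
      nlinarith [Real.pi_pos, z.im_pos])
  have hab : (s - 1 / 2) + (conj s - 1 / 2) = ((2 * s.re - 1 : ℝ) : ℂ) := by
    have := Complex.add_conj s
    push_cast at this ⊢
    linear_combination this
  -- Here `d = 2 Re s - 1 ≥ 1`. For large `Re w` the function `R` is the Dirichlet series with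
  -- coefficients `|c_n|² + |c_(-n)|²`, so Landau's lemma forces every coefficient, and therefore
  -- `f`, to vanish.
  obtain ⟨R, x₀, hR, hR0, hRe⟩ := exists_analytic_quotient hh hab (by linarith)
  have hcc : ∀ n : ℤ, n ≠ 0 → ‖c n * conj (c n)‖ ≤ C ^ 2 * |(n : ℝ)| ^ (1 : ℝ) := by
    intro n hn
    rw [norm_mul, RCLike.norm_conj, Real.rpow_one, ← Real.mul_self_sqrt (abs_nonneg (n : ℝ))]
    nlinarith [hC n hn, norm_nonneg (c n), mul_nonneg hC0 (Real.sqrt_nonneg |(n : ℝ)|)]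
  have hre1 : (s - 1 / 2 : ℂ).re = s.re - 1 / 2 := by simp
  have hre2 : (conj s - 1 / 2 : ℂ).re = s.re - 1 / 2 := by simp
  have hsum : ∀ w : ℂ, 2 + 2 * s.re < w.re →
      LSeriesHasSum (fun n : ℕ => c n * conj (c n) + c (-n) * conj (c (-n))) w (R w) := by
    intro w hw
    have hw' : |(s - 1 / 2 : ℂ).re| + |(conj s - 1 / 2 : ℂ).re| < w.re := by
      rw [hre1, hre2, abs_of_nonneg (by linarith)]; linarith
    have h := (hf.hasSum_eisensteinPairing (w := w) hc hc (fun y hy =>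
      ((continuousOn_horizontal hf.continuousOn hy).intervalIntegrable _ _)) hh hcc (by linarith)
      (by linarith) hw').mul_right (recipBesselMellin (s - 1 / 2) (conj s - 1 / 2) w)
    rw [← hRe w (by linarith)] at h
    refine lseriesHasSum_of_hasSum_int (c := fun n => c n * conj (c n)) ?_
    convert! h using 1
    funext n
    linear_combination (-(c n * conj (c n) * ((|((n : ℤ) : ℝ)| : ℝ) : ℂ) ^ (-w))) *
      besselMellin_mul_recip hw'
  have hnn : ∀ n : ℤ, c n * conj (c n) = ((‖c n‖ ^ 2 : ℝ) : ℂ) := fun n => by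
    rw [Complex.mul_conj']; push_cast; rfl
  have hz : ∀ N : ℕ, N ≠ 0 → c N = 0 ∧ c (-N) = 0 := by
    intro N hN
    have h := eq_zero_of_lseriesHasSum (fun n => ?_) hR hsum hR0 hN
    · simp only [hnn] at h
      have h' : ‖c N‖ ^ 2 + ‖c (-N)‖ ^ 2 = 0 := by exact_mod_cast h
      constructor
      · rw [← norm_eq_zero]; nlinarith [sq_nonneg ‖c N‖, sq_nonneg ‖c (-N)‖]
      · rw [← norm_eq_zero]; nlinarith [sq_nonneg ‖c N‖, sq_nonneg ‖c (-N)‖]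
    · simp only [hnn, Pi.zero_apply]
      rw [← Complex.ofReal_add]
      exact Complex.zero_le_real.2 (by positivity)
  refine hf.ne_zero (hf.eq_zero_of_besselCoeff fun n hn y hy => ?_)
  have hcn : c n = 0 := by
    obtain ⟨N, rfl | rfl⟩ := n.eq_nat_or_neg
    · exact (hz N (by exact_mod_cast hn)).1
    · exact (hz N (by simpa using hn)).2
  rw [hc n hn y hy, hcn, zero_mul]

theorem IsMaassCuspForm.re_pos {s : ℂ} {f : ℍ → ℂ} (hf : IsMaassCuspForm s f) : 0 < s.re := by
  have := hf.one_sub.re_lt_one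
  simp at this
  exact this

/-! ### Eisenstein series: growth and Fourier coefficients -/

theorem measurable_eisensteinFormula (s : ℂ) : Measurable (eisensteinFormula s) := by
  unfold eisensteinFormula
  exact ((isModerateFamily_im_cpow.measurable s).add
    ((isModerateFamily_im_cpow.measurable (1 - s)).const_mul _)).add
    ((measurable_eisensteinTail s).const_mul _)

theorem exists_norm_eisensteinFormula_le (s : ℂ) : ∃ C, 0 ≤ C ∧ ∀ z : ℍ, 1 / 2 ≤ z.im →
    ‖eisensteinFormula s z‖ ≤ C * Real.exp z.im := by
  obtain ⟨A, hA0, hA⟩ := isModerateFamily_im_cpow.exists_norm_le ‖s‖ 1 one_pos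
  obtain ⟨B, hB0, hB⟩ := isModerateFamily_im_cpow.exists_norm_le ‖1 - s‖ 1 one_pos
  obtain ⟨D, hD0, hD⟩ := isModerateFamily_eisensteinTail.exists_norm_le ‖s‖ 1 one_pos
  refine ⟨A + ‖scatteringNum s / (s - 1)‖ * B + ‖recipXi s‖ * D, by positivity, fun z hz => ?_⟩
  have h1 := hA s z le_rfl hz
  have h2 := hB (1 - s) z le_rfl hz
  have h3 := hD s z le_rfl hz
  rw [one_mul] at h1 h2 h3
  rw [eisensteinFormula]
  refine (norm_add₃_le).trans ?_
  rw [norm_mul, norm_mul, add_mul, add_mul, mul_assoc, mul_assoc]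
  gcongr

theorem eisensteinFormula_halfPlanePoint (s : ℂ) {y : ℝ} (hy : 0 < y) (x : ℝ) :
    eisensteinFormula s (halfPlanePoint (y, x)) = ((y : ℂ) ^ s + scatteringNum s / (s - 1) *
      (y : ℂ) ^ (1 - s)) + recipXi s * eisensteinTail s (halfPlanePoint (y, x)) := by
  rw [eisensteinFormula, halfPlanePoint_im hy]

theorem exists_norm_eisensteinTail_line_le (s : ℂ) {y : ℝ} (hy : 0 < y) :
    ∃ C, ∀ x : ℝ, ‖eisensteinTail s (halfPlanePoint (y, x))‖ ≤ C := by
  obtain ⟨C, hC0, hC⟩ := exists_norm_eisensteinTail_le |(s - 1 / 2).re| hy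
  exact ⟨_, fun x => (hC s (halfPlanePoint (y, x)) le_rfl (by rw [halfPlanePoint_im hy])).trans
    (by rw [halfPlanePoint_im hy])⟩

theorem intervalIntegrable_of_norm_le {u : ℝ → ℂ} (hu : Measurable u) {C : ℝ}
    (hC : ∀ x, ‖u x‖ ≤ C) (a b : ℝ) : IntervalIntegrable u volume a b :=
  (intervalIntegrable_const (c := C)).mono_fun hu.aestronglyMeasurable
    (Eventually.of_forall fun x => (hC x).trans (le_abs_self C))

theorem intervalIntegrable_eisensteinTail (s : ℂ) {y : ℝ} (hy : 0 < y) :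
    IntervalIntegrable (fun x : ℝ => eisensteinTail s (halfPlanePoint (y, x))) volume 0 1 := by
  obtain ⟨C, hC⟩ := exists_norm_eisensteinTail_line_le s hy
  exact intervalIntegrable_of_norm_le ((measurable_eisensteinTail s).comp
    (measurable_halfPlanePoint.comp measurable_prodMk_left)) hC _ _

theorem intervalIntegrable_eisensteinFormula (s : ℂ) {y : ℝ} (hy : 0 < y) :
    IntervalIntegrable (fun x : ℝ => eisensteinFormula s (ofComplex (x + y * Complex.I)))
      volume 0 1 := by
  have h : (fun x : ℝ => eisensteinFormula s (ofComplex (x + y * Complex.I))) = fun x =>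
      ((y : ℂ) ^ s + scatteringNum s / (s - 1) * (y : ℂ) ^ (1 - s)) +
        recipXi s * eisensteinTail s (halfPlanePoint (y, x)) :=
    funext fun x => eisensteinFormula_halfPlanePoint s hy x
  rw [h]
  exact intervalIntegrable_const.add ((intervalIntegrable_eisensteinTail s hy).const_mul _)

theorem integral_fourierExp {k : ℤ} (hk : k ≠ 0) : ∫ x in (0 : ℝ)..1, fourierExp k x = 0 := by
  have hc : (2 * Real.pi * Complex.I * k : ℂ) ≠ 0 := by
    simp [Real.pi_ne_zero, hk]
  have h := intervalIntegral.integral_eq_sub_of_hasDerivAt (a := 0) (b := 1)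
    (fun x _ => hasDerivAt_fourierExp k x)
    ((continuous_const.mul (continuous_fourierExp k)).intervalIntegrable _ _)
  rw [fourierExp_one, fourierExp_zero_right, sub_self, intervalIntegral.integral_const_mul] at h
  exact (mul_eq_zero.1 h).resolve_left hc

theorem fourierExp_mul (m n : ℤ) (x : ℝ) : fourierExp m x * fourierExp n x = fourierExp (m + n) x := by
  rw [fourierExp, fourierExp, fourierExp, ← Complex.exp_add]
  congr 1; push_cast; ring

theorem integral_eisensteinTail_mul_fourierExp (s : ℂ) (n : ℤ) {y : ℝ} (hy : 0 < y) :
    ∫ x in (0 : ℝ)..1, eisensteinTail s (halfPlanePoint (y, x)) * fourierExp (-n) x =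
      divisorCoeff (s - 1 / 2) n.natAbs * ((Real.sqrt y : ℂ) * besselK (s - 1 / 2) (|(n : ℝ)| * y)) := by
  set t : ℤ → ℂ := fun m => divisorCoeff (s - 1 / 2) m.natAbs *
    ((Real.sqrt y : ℂ) * besselK (s - 1 / 2) (|(m : ℝ)| * y)) with ht
  have hterm : ∀ (m : ℤ) (x : ℝ), besselTerm (s - 1 / 2) (fun n => divisorCoeff (s - 1 / 2) n.natAbs)
      (halfPlanePoint (y, x)) m = t m * fourierExp m x := by
    intro m x
    rw [besselTerm, halfPlanePoint_im hy, halfPlanePoint_re hy]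
  have hsum : Summable fun m => ‖t m‖ := by
    have := summable_eisensteinTail_term (s - 1 / 2) (halfPlanePoint (y, 0))
    simpa only [hterm, norm_mul, norm_fourierExp, mul_one] using this
  have hint : ∀ m : ℤ, IntervalIntegrable (fun x => t m * fourierExp (m + -n) x) volume 0 1 :=
    fun m => (continuous_const.mul (continuous_fourierExp _)).intervalIntegrable _ _
  have h := hasSum_integral_of_summable_integral_norm (μ := volume.restrict (Set.Ioc (0 : ℝ) 1))
    (fun m => (intervalIntegrable_iff_integrableOn_Ioc_of_le zero_le_one).1 (hint m)) (by
      simp only [norm_mul, norm_fourierExp, mul_one]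
      simpa using hsum)
  have e1 : ∀ m : ℤ, ∫ x in Set.Ioc (0 : ℝ) 1, t m * fourierExp (m + -n) x =
      if m = n then t n else 0 := by
    intro m
    rw [← intervalIntegral.integral_of_le zero_le_one, intervalIntegral.integral_const_mul]
    split_ifs with hm
    · subst hm
      simp [fourierExp]
    · rw [integral_fourierExp (by omega), mul_zero]
  simp only [e1] at h
  rw [intervalIntegral.integral_of_le zero_le_one]
  refine Eq.trans ?_ (h.unique (hasSum_ite_eq n (t n)))
  refine setIntegral_congr_fun measurableSet_Ioc fun x _ => ?_
  simp only [eisensteinTail]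
  rw [← tsum_mul_right]
  refine tsum_congr fun m => ?_
  rw [hterm, mul_assoc, fourierExp_mul]

theorem fourierCoeffAt_eisensteinFormula (s : ℂ) {n : ℤ} (hn : n ≠ 0) {y : ℝ} (hy : 0 < y) :
    fourierCoeffAt (eisensteinFormula s) n y = recipXi s * divisorCoeff (s - 1 / 2) n.natAbs *
      ((Real.sqrt y : ℂ) * besselK (s - 1 / 2) (|(n : ℝ)| * y)) := by
  have h : ∀ x : ℝ, eisensteinFormula s (ofComplex (x + y * Complex.I)) * fourierExp (-n) x =
      ((y : ℂ) ^ s + scatteringNum s / (s - 1) * (y : ℂ) ^ (1 - s)) * fourierExp (-n) x +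
        recipXi s * (eisensteinTail s (halfPlanePoint (y, x)) * fourierExp (-n) x) := by
    intro x
    rw [show ofComplex (x + y * Complex.I) = halfPlanePoint (y, x) from rfl,
      eisensteinFormula_halfPlanePoint s hy]
    ring
  rw [fourierCoeffAt]
  simp only [h]
  have i1 : IntervalIntegrable (fun x => ((y : ℂ) ^ s + scatteringNum s / (s - 1) *
      (y : ℂ) ^ (1 - s)) * fourierExp (-n) x) volume 0 1 :=
    (continuous_const.mul (continuous_fourierExp _)).intervalIntegrable _ _
  have i2 : IntervalIntegrable (fun x => recipXi s *
      (eisensteinTail s (halfPlanePoint (y, x)) * fourierExp (-n) x)) volume 0 1 :=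
    ((intervalIntegrable_eisensteinTail s hy).mul_continuousOn
      (continuous_fourierExp _).continuousOn).const_mul _
  rw [intervalIntegral.integral_add i1 i2, intervalIntegral.integral_const_mul, intervalIntegral.integral_const_mul,
    integral_fourierExp (neg_ne_zero.2 hn), integral_eisensteinTail_mul_fourierExp s n hy]
  ring

/-! ### The Fourier-Whittaker coefficients of Eisenstein series -/

theorem meromorphicAt_riemannZeta (s : ℂ) : MeromorphicAt riemannZeta s := by
  have h0 : MeromorphicAt (fun s => completedRiemannZeta₀ s - 1 / s - 1 / (1 - s)) s := by
    have h1 := (differentiable_completedZeta₀.analyticAt s).meromorphicAt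
    have h2 : MeromorphicAt (fun s : ℂ => s) s := analyticAt_id.meromorphicAt
    have h3 : MeromorphicAt (fun s : ℂ => 1 - s) s := (analyticAt_const.sub analyticAt_id).meromorphicAt
    exact (h1.sub ((MeromorphicAt.const 1 s).div h2)).sub ((MeromorphicAt.const 1 s).div h3)
  have h4 := (Complex.differentiable_Gammaℝ_inv.analyticAt s).meromorphicAt
  refine (h0.mul h4).congr ?_
  have : ∀ᶠ w in 𝓝[≠] s, w ≠ 0 := by
    rcases eq_or_ne s 0 with rfl | hs
    · exact self_mem_nhdsWithin
    · exact mem_nhdsWithin_of_mem_nhds (isOpen_ne.mem_nhds hs)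
  filter_upwards [this] with w hw
  rw [riemannZeta_def_of_ne_zero hw, completedRiemannZeta_eq]
  exact (div_eq_mul_inv _ _).symm

/-- For `N = e d` one has `d² / N = d / e`, which symmetrises `σ_(2s-1)(N) / N^s`. -/
theorem sum_divisors_cpow {N : ℕ} (hN : N ≠ 0) (s : ℂ) :
    (∑ d ∈ N.divisors, (d : ℂ) ^ (2 * s - 1)) / (N : ℂ) ^ s =
      divisorCoeff (s - 1 / 2) N / (Real.sqrt N : ℂ) := by
  have hNpos : (0 : ℝ) < N := by positivity
  have hNC : (N : ℂ) ≠ 0 := by exact_mod_cast hN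
  have hs0 : (Real.sqrt N : ℂ) ≠ 0 := by exact_mod_cast (Real.sqrt_pos.2 hNpos).ne'
  have hsq : (Real.sqrt N : ℂ) = (N : ℂ) ^ (1 / 2 : ℂ) := by
    rw [Real.sqrt_eq_rpow, Complex.ofReal_cpow hNpos.le]; push_cast; rfl
  rw [divisorCoeff, ← Nat.sum_divisorsAntidiagonal' (f := fun _ d => (d : ℂ) ^ (2 * s - 1)),
    Finset.sum_div, Finset.sum_div]
  refine Finset.sum_congr rfl fun p hp => ?_
  rw [Nat.mem_divisorsAntidiagonal] at hp
  have h1 : 0 < p.1 := Nat.pos_of_ne_zero fun h => hp.2 (by rw [← hp.1, h, zero_mul])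
  have h2 : 0 < p.2 := Nat.pos_of_ne_zero fun h => hp.2 (by rw [← hp.1, h, mul_zero])
  have h1C : (p.1 : ℂ) ≠ 0 := by exact_mod_cast h1.ne'
  have h2C : (p.2 : ℂ) ≠ 0 := by exact_mod_cast h2.ne'
  have e : (p.2 / p.1 : ℝ) = (p.2 : ℝ) * (p.2 : ℝ) * (N : ℝ)⁻¹ := by
    rw [← hp.1]; push_cast; field_simp
  rw [e, hsq, Complex.ofReal_mul, Complex.mul_cpow_ofReal_nonneg (by positivity) (by positivity),
    Complex.ofReal_mul, Complex.mul_cpow_ofReal_nonneg (by positivity) (by positivity),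
    Complex.ofReal_inv, Complex.inv_cpow _ _ (by
      rw [Complex.arg_ofReal_of_nonneg hNpos.le]; exact Real.pi_ne_zero.symm),
    Complex.ofReal_natCast, Complex.ofReal_natCast, ← Complex.cpow_add _ _ h2C,
    show s - 1 / 2 + (s - 1 / 2) = 2 * s - 1 by ring, ← div_eq_mul_inv, div_div,
    ← Complex.cpow_add _ _ hNC, sub_add_cancel]

/-- The right side is analytic on `Re s ≥ 1/2` and agrees with the quotient near each point except
possibly at the pole of `ζ(2s)`; normal form carries the identity through `s = 1/2`, where both
sides vanish. -/
theorem eisensteinCoeff_eq {n : ℤ} (hn : n ≠ 0) {s : ℂ} (hs : 1 / 2 ≤ s.re) :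
    eisensteinCoeff n s = (Real.pi : ℂ) ^ (-s) * Complex.Gamma s *
      (recipXi s * divisorCoeff (s - 1 / 2) n.natAbs) / (Real.sqrt |(n : ℝ)| : ℂ) := by
  have hN : n.natAbs ≠ 0 := Int.natAbs_ne_zero.2 hn
  have hNC : (n.natAbs : ℂ) ≠ 0 := by exact_mod_cast hN
  have habs : |(n : ℝ)| = (n.natAbs : ℝ) := by rw [Nat.cast_natAbs, Int.cast_abs]
  have hp := xiEntire_ne_zero hs
  have hs0 : 0 < s.re := by linarith
  rw [eisensteinCoeff, habs]
  have hmer : MeromorphicOn (fun s => (∑ d ∈ n.natAbs.divisors, (d : ℂ) ^ (2 * s - 1)) /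
      ((n.natAbs : ℂ) ^ s * riemannZeta (2 * s))) Set.univ := by
    intro z _
    have h1 : Differentiable ℂ fun s : ℂ => ∑ d ∈ n.natAbs.divisors, (d : ℂ) ^ (2 * s - 1) := by
      refine Differentiable.fun_sum fun d hd => ?_
      have hd0 : (d : ℂ) ≠ 0 := by exact_mod_cast (Nat.pos_of_mem_divisors hd).ne'
      exact Differentiable.const_cpow (by fun_prop) (Or.inl hd0)
    have h2 : Differentiable ℂ fun s : ℂ => (n.natAbs : ℂ) ^ s :=
      differentiable_id.const_cpow (Or.inl hNC)
    have hg : AnalyticAt ℂ (fun s : ℂ => 2 * s) z := analyticAt_const.mul analyticAt_id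
    have h3 := MeromorphicAt.comp_analyticAt (meromorphicAt_riemannZeta (2 * z)) hg
    exact (h1.analyticAt z).meromorphicAt.div ((h2.analyticAt z).meromorphicAt.mul h3)
  have han : AnalyticAt ℂ (fun s => (Real.pi : ℂ) ^ (-s) * Complex.Gamma s *
      (recipXi s * divisorCoeff (s - 1 / 2) n.natAbs) / (Real.sqrt (n.natAbs : ℝ) : ℂ)) s := by
    have h1 := (differentiable_pi_cpow.comp differentiable_neg).analyticAt s
    have h2 := ((differentiable_divisorCoeff n.natAbs).comp
      (differentiable_id.sub_const (1 / 2 : ℂ))).analyticAt s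
    exact ((h1.mul (analyticAt_Gamma hs0)).mul ((analyticAt_recipXi hp).mul h2)).div_const
  refine (toMeromorphicNFOn_of_eventuallyEq hmer han ?_).eq_of_nhds
  have e1 : ∀ᶠ w in 𝓝[≠] s, 2 * w ≠ 1 := by
    rcases eq_or_ne (2 * s) 1 with h | h
    · filter_upwards [self_mem_nhdsWithin] with w hw h'
      exact hw (mul_left_cancel₀ two_ne_zero (h'.trans h.symm))
    · have hc : ContinuousAt (fun w : ℂ => 2 * w) s := by fun_prop
      exact (hc.eventually_ne h).filter_mono nhdsWithin_le_nhds
  have e2 : ∀ᶠ w in 𝓝[≠] s, xiEntire w ≠ 0 :=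
    (differentiable_xiEntire.continuous.continuousAt.eventually_ne hp).filter_mono nhdsWithin_le_nhds
  have e3 : ∀ᶠ w : ℂ in 𝓝[≠] s, 0 < w.re :=
    mem_nhdsWithin_of_mem_nhds ((isOpen_lt continuous_const Complex.continuous_re).mem_nhds hs0)
  filter_upwards [e1, e2, e3] with w h1 h2 h3
  have h0 : w ≠ 0 := by rintro rfl; simp at h3
  have hG : Complex.Gamma w ≠ 0 := Complex.Gamma_ne_zero_of_re_pos h3
  have hpi : (Real.pi : ℂ) ^ (-w) ≠ 0 := by
    rw [Complex.cpow_ne_zero_iff]; exact Or.inl (by exact_mod_cast Real.pi_ne_zero)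
  have h21 : 2 * w - 1 ≠ 0 := sub_ne_zero.2 h1
  rw [← div_div, sum_divisors_cpow hN, riemannZeta_def_of_ne_zero (mul_ne_zero two_ne_zero h0),
    Complex.Gammaℝ_def, recipXi, xiEntire_eq h0 h1, mul_div_cancel_left₀ _ two_ne_zero,
    show -(2 * w) / 2 = -w by ring]
  rw [xiEntire_eq h0 h1] at h2
  have h4 := (mul_ne_zero_iff.1 h2).2
  rw [mul_comm 2 w] at h21
  field_simp

/-! ### The Rankin-Selberg `L`-function -/

section

variable {s β : ℂ} {f : ℍ → ℂ}

theorem eisenstein_eq_formula (hβ : 1 / 2 ≤ β.re) (h1 : β ≠ 1) :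
    eisenstein β = eisensteinFormula β := funext fun z => eisenstein_eq hβ h1 z

theorem IsMaassCuspForm.isRapidlyDecreasing_eisenstein_mul (hf : IsMaassCuspForm s f)
    (hβ : 1 / 2 ≤ β.re) (h1 : β ≠ 1) : IsRapidlyDecreasing fun z => eisenstein β z * conj (f z) := by
  obtain ⟨C, hC0, hC⟩ := exists_norm_eisensteinFormula_le β
  refine hf.isRapidlyDecreasing ?_ (eisenstein_smul β) hC0 ?_
  · rw [eisenstein_eq_formula hβ h1]; exact measurable_eisensteinFormula β
  · rw [eisenstein_eq_formula hβ h1]; exact hC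

/-- The constant relating `gammaRatio` to the Mellin transform of two Bessel functions. -/
def rankinSelbergConst (s β : ℂ) : ℂ :=
  (Real.pi : ℂ) ^ (β + conj s) / (Complex.Gamma β * Complex.Gamma (conj s))

theorem pi_cpow_ne_zero (w : ℂ) : (Real.pi : ℂ) ^ w ≠ 0 := by
  rw [Complex.cpow_ne_zero_iff]; exact Or.inl (by exact_mod_cast Real.pi_ne_zero)

theorem rankinSelbergConst_ne_zero (hs : Complex.Gamma s ≠ 0) (hβ : Complex.Gamma β ≠ 0) :
    rankinSelbergConst s β ≠ 0 := by
  refine div_ne_zero (pi_cpow_ne_zero _) (mul_ne_zero hβ ?_)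
  rw [Complex.Gamma_conj]
  exact (map_ne_zero _).2 hs

theorem gammaRatio_eq (s β w : ℂ) :
    gammaRatio s β w = rankinSelbergConst s β * besselMellin (β - 1 / 2) (conj s - 1 / 2) w := by
  rw [gammaRatio, rankinSelbergConst, besselMellin, sub_eq_add_neg (β + conj s) w,
    Complex.cpow_add _ _ (by exact_mod_cast Real.pi_ne_zero : (Real.pi : ℂ) ≠ 0)]
  rw [show (w + (β - 1 / 2 + (conj s - 1 / 2))) / 2 = (w - 1 + β + conj s) / 2 by ring,
    show (w - (β - 1 / 2 + (conj s - 1 / 2))) / 2 = (w + 1 - β - conj s) / 2 by ring,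
    show (w + (β - 1 / 2 - (conj s - 1 / 2))) / 2 = (w + β - conj s) / 2 by ring,
    show (w - (β - 1 / 2 - (conj s - 1 / 2))) / 2 = (w - β + conj s) / 2 by ring]
  ring

/-- Passing from `W_s(|n|y)` to `√y K` costs a factor `√|n|` for each of the two coefficients;
together they turn `|n|^(1-w)` into `|n|^(-w)`. -/
theorem rankinSelbergTerm_eq {c : ℤ → ℂ} (hs : Complex.Gamma s ≠ 0) (hβ : 1 / 2 ≤ β.re)
    (hc : ∀ n : ℤ, n ≠ 0 → ∀ y : ℝ, 0 < y → fourierCoeffAt f n y =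
      c n * ((Real.sqrt y : ℂ) * besselK (s - 1 / 2) (|(n : ℝ)| * y)))
    (w : ℂ) (n : {n : ℤ // n ≠ 0}) :
    rankinSelbergTerm s f β w n = (rankinSelbergConst s β)⁻¹ *
      (recipXi β * divisorCoeff (β - 1 / 2) (n : ℤ).natAbs * conj (c n) *
        ((|((n : ℤ) : ℝ)| : ℝ) : ℂ) ^ (-w)) := by
  have hr : 0 < |((n : ℤ) : ℝ)| := abs_pos.2 (by exact_mod_cast n.2)
  have hrC : ((|((n : ℤ) : ℝ)| : ℝ) : ℂ) ≠ 0 := by exact_mod_cast hr.ne'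
  have hN : (((n : ℤ).natAbs : ℕ) : ℂ) = ((|((n : ℤ) : ℝ)| : ℝ) : ℂ) := by
    have : (((n : ℤ).natAbs : ℕ) : ℝ) = |((n : ℤ) : ℝ)| := by rw [Nat.cast_natAbs, Int.cast_abs]
    rw [← this]; push_cast; rfl
  have hsq : (Real.sqrt |((n : ℤ) : ℝ)| : ℂ) * Real.sqrt |((n : ℤ) : ℝ)| =
      ((|((n : ℤ) : ℝ)| : ℝ) : ℂ) := by
    exact_mod_cast Real.mul_self_sqrt hr.le
  have hs0 : (Real.sqrt |((n : ℤ) : ℝ)| : ℂ) ≠ 0 := by exact_mod_cast (Real.sqrt_pos.2 hr).ne'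
  have hpc : conj ((Real.pi : ℂ) ^ s) = (Real.pi : ℂ) ^ (conj s) := by
    rw [Complex.cpow_conj _ _ (by
      rw [Complex.arg_ofReal_of_nonneg Real.pi_pos.le]; exact Real.pi_ne_zero.symm),
      Complex.conj_ofReal]
  rw [rankinSelbergTerm, eisensteinCoeff_eq n.2 hβ, (whittakerCoeff_eq n.2 hs (hc n n.2)).1, hN,
    map_div₀, map_mul, map_mul, Complex.conj_ofReal, ← Complex.Gamma_conj, hpc,
    rankinSelbergConst, Complex.cpow_sub _ _ hrC, Complex.cpow_one, Complex.cpow_neg,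
    Complex.cpow_neg, Complex.cpow_add _ _ (by exact_mod_cast Real.pi_ne_zero : (Real.pi : ℂ) ≠ 0)]
  have h1 := pi_cpow_ne_zero β
  have h2 := pi_cpow_ne_zero (conj s)
  have h3 : ((|((n : ℤ) : ℝ)| : ℝ) : ℂ) ^ w ≠ 0 := by
    rw [Complex.cpow_ne_zero_iff]; exact Or.inl hrC
  rw [inv_div]
  generalize hR : ((|((n : ℤ) : ℝ)| : ℝ) : ℂ) ^ w = R at *
  rw [← hsq]
  field_simp

/-- For `Re w` large, the Dirichlet series converges and represents the pairing of `E_w` with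
`E_β * conj f`. -/
theorem IsMaassCuspForm.exists_rankinSelbergSeries_eq (hf : IsMaassCuspForm s f)
    (hβ : 1 / 2 ≤ β.re) (h1 : β ≠ 1) : ∃ σ : ℝ, 1 ≤ σ ∧ ∀ w : ℂ, σ < w.re →
      |(β - 1 / 2).re| + |(conj s - 1 / 2).re| < w.re ∧ Summable (rankinSelbergTerm s f β w) ∧
      rankinSelbergSeries s f β w * gammaRatio s β w =
        eisensteinPairing (fun z => eisenstein β z * conj (f z)) w := by
  have hs : Complex.Gamma s ≠ 0 := Complex.Gamma_ne_zero_of_re_pos hf.re_pos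
  have hβΓ : Complex.Gamma β ≠ 0 := Complex.Gamma_ne_zero_of_re_pos (by linarith)
  have hκ := rankinSelbergConst_ne_zero hs hβΓ
  obtain ⟨c, hc, C, hC0, hC⟩ := hf.exists_besselCoeff
  set b : ℤ → ℂ := fun n => recipXi β * divisorCoeff (β - 1 / 2) n.natAbs with hb
  set A : ℝ := |(β - 1 / 2).re| + 1 + 1 / 2 with hA
  have hbc : ∀ n : ℤ, n ≠ 0 → ‖b n * conj (c n)‖ ≤ (‖recipXi β‖ * C) * |(n : ℝ)| ^ A := by
    intro n hn
    have hr : 0 < |(n : ℝ)| := by positivity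
    have hd := norm_divisorCoeff_le (le_refl |(β - 1 / 2).re|) n.natAbs
    rw [Nat.cast_natAbs, Int.cast_abs] at hd
    have hcn := hC n hn
    rw [Real.sqrt_eq_rpow] at hcn
    rw [norm_mul, norm_mul, RCLike.norm_conj, hA, Real.rpow_add hr]
    calc ‖recipXi β‖ * ‖divisorCoeff (β - 1 / 2) n.natAbs‖ * ‖c n‖
        ≤ ‖recipXi β‖ * |(n : ℝ)| ^ (|(β - 1 / 2).re| + 1) * (C * |(n : ℝ)| ^ (1 / 2 : ℝ)) := by
          gcongr
      _ = _ := by ring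
  refine ⟨max (A + 1) (|(β - 1 / 2).re| + |(conj s - 1 / 2).re|), ?_, fun w hw => ?_⟩
  · refine le_max_of_le_left ?_
    rw [hA]; linarith [abs_nonneg (β - 1 / 2).re]
  · rw [max_lt_iff] at hw
    have hw1 : 1 < w.re := by
      have := hw.1
      rw [hA] at this
      linarith [abs_nonneg (β - 1 / 2).re]
    have hfc : ∀ n : ℤ, n ≠ 0 → ∀ y : ℝ, 0 < y → fourierCoeffAt (eisenstein β) n y =
        b n * ((Real.sqrt y : ℂ) * besselK (β - 1 / 2) (|(n : ℝ)| * y)) := by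
      intro n hn y hy
      rw [eisenstein_eq_formula hβ h1]
      exact fourierCoeffAt_eisensteinFormula β hn hy
    have hS := hf.hasSum_eisensteinPairing hc hfc (fun y hy => by
      rw [eisenstein_eq_formula hβ h1]; exact intervalIntegrable_eisensteinFormula β hy)
      (hf.isRapidlyDecreasing_eisenstein_mul hβ h1) hbc hw1 hw.1 hw.2
    have hsum : Summable fun n : {n : ℤ // n ≠ 0} =>
        b n * conj (c n) * ((|((n : ℤ) : ℝ)| : ℝ) : ℂ) ^ (-w) := by
      refine Summable.of_norm ((summable_abs_rpow_of_le hw.1 hbc).congr fun n => ?_)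
      rw [norm_mul (b _ * _), Complex.norm_cpow_eq_rpow_re_of_pos
        (abs_pos.2 (by exact_mod_cast n.2)), Complex.neg_re]
    have hterm : rankinSelbergTerm s f β w = fun n : {n : ℤ // n ≠ 0} => (rankinSelbergConst s β)⁻¹ *
        (b n * conj (c n) * ((|((n : ℤ) : ℝ)| : ℝ) : ℂ) ^ (-w)) :=
      funext fun n => rankinSelbergTerm_eq hs hβ hc w n
    refine ⟨hw.2, by rw [hterm]; exact hsum.mul_left _, ?_⟩
    rw [rankinSelbergSeries, hterm, tsum_mul_left, gammaRatio_eq, ← hS.tsum_eq, tsum_mul_right]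
    field_simp

/-- The meromorphic continuation of the Dirichlet series, in terms of the pairing of Eisenstein
series. -/
def rankinSelbergFormula (s : ℂ) (f : ℍ → ℂ) (β w : ℂ) : ℂ :=
  (rankinSelbergConst s β)⁻¹ * (eisensteinPairing (fun z => eisenstein β z * conj (f z)) w *
    recipBesselMellin (β - 1 / 2) (conj s - 1 / 2) w)

theorem meromorphicAt_recipBesselMellin (a b w : ℂ) : MeromorphicAt (recipBesselMellin a b) w := by
  have h1 : Differentiable ℂ fun w : ℂ => (w + (a + b)) / 2 := by fun_prop
  have h2 : Differentiable ℂ fun w : ℂ => (w - (a + b)) / 2 := by fun_prop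
  have h3 : Differentiable ℂ fun w : ℂ => (w + (a - b)) / 2 := by fun_prop
  have h4 : Differentiable ℂ fun w : ℂ => (w - (a - b)) / 2 := by fun_prop
  have h5 := (((differentiable_inv_Gamma_comp h1).mul (differentiable_inv_Gamma_comp h2)).mul
    (differentiable_inv_Gamma_comp h3)).mul (differentiable_inv_Gamma_comp h4)
  exact (((MeromorphicAt.const 2 w).mul (differentiable_pi_cpow.analyticAt w).meromorphicAt).mul
    (MeromorphicOn.Gamma w (Set.mem_univ w))).mul (h5.analyticAt w).meromorphicAt

theorem IsMaassCuspForm.meromorphicOn_rankinSelbergFormula (hf : IsMaassCuspForm s f)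
    (hβ : 1 / 2 ≤ β.re) (h1 : β ≠ 1) : MeromorphicOn (rankinSelbergFormula s f β) Set.univ :=
  fun w hw => (MeromorphicAt.const _ w).mul
    (((hf.isRapidlyDecreasing_eisenstein_mul hβ h1).meromorphicOn_eisensteinPairing w hw).mul
      (meromorphicAt_recipBesselMellin _ _ w))

theorem IsMaassCuspForm.analyticAt_rankinSelbergFormula (hf : IsMaassCuspForm s f)
    (hβ : 1 / 2 ≤ β.re) (h1 : β ≠ 1) {w : ℂ} (hw : 1 / 2 ≤ w.re) (hw1 : w ≠ 1) :
    AnalyticAt ℂ (rankinSelbergFormula s f β) w :=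
  analyticAt_const.mul (((hf.isRapidlyDecreasing_eisenstein_mul hβ h1).analyticAt_eisensteinPairing
    (xiEntire_ne_zero hw) hw1).mul (analyticAt_recipBesselMellin _ _ (by linarith)))

theorem IsMaassCuspForm.exists_rankinSelbergFormula_eq (hf : IsMaassCuspForm s f)
    (hβ : 1 / 2 ≤ β.re) (h1 : β ≠ 1) : ∃ σ : ℝ, ∀ w : ℂ, σ < w.re →
      AnalyticAt ℂ (rankinSelbergFormula s f β) w ∧
      rankinSelbergFormula s f β w = rankinSelbergSeries s f β w := by
  have hs : Complex.Gamma s ≠ 0 := Complex.Gamma_ne_zero_of_re_pos hf.re_pos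
  have hκ := rankinSelbergConst_ne_zero hs (Complex.Gamma_ne_zero_of_re_pos (s := β) (by linarith))
  obtain ⟨σ, hσ1, hσ⟩ := hf.exists_rankinSelbergSeries_eq hβ h1
  refine ⟨σ, fun w hw => ⟨hf.analyticAt_rankinSelbergFormula hβ h1 (by linarith)
    (ne_one_of_one_lt_re (by linarith)), ?_⟩⟩
  obtain ⟨h2, -, h3⟩ := hσ w hw
  rw [rankinSelbergFormula, ← h3, gammaRatio_eq]
  have h4 := besselMellin_mul_recip h2
  generalize β - 1 / 2 = a at h4 ⊢
  generalize conj s - 1 / 2 = b at h4 ⊢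
  field_simp
  linear_combination (rankinSelbergSeries s f β w) * h4

theorem besselMellin_mul_recip_of_ne_zero {a b w : ℂ} (h0 : Complex.Gamma w ≠ 0)
    (h1 : Complex.Gamma ((w + (a + b)) / 2) ≠ 0) (h2 : Complex.Gamma ((w - (a + b)) / 2) ≠ 0)
    (h3 : Complex.Gamma ((w + (a - b)) / 2) ≠ 0) (h4 : Complex.Gamma ((w - (a - b)) / 2) ≠ 0) :
    besselMellin a b w * recipBesselMellin a b w = 1 := by
  have h6 := pi_cpow_ne_zero w
  rw [besselMellin, recipBesselMellin, Complex.cpow_neg]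
  field_simp

/-! ### Orthogonality of cusp forms and Eisenstein series -/

/-- `φ * conj f` is integrable over the fundamental domain, with vanishing integral. -/
def IsOrthogonalTo (f φ : ℍ → ℂ) : Prop :=
  IntegrableOn (fun z => φ z * conj (f z)) 𝒟 ∧ ∫ z in 𝒟, φ z * conj (f z) = 0

namespace IsOrthogonalTo

variable {φ ψ : ℍ → ℂ}

theorem add (h1 : IsOrthogonalTo f φ) (h2 : IsOrthogonalTo f ψ) :
    IsOrthogonalTo f fun z => φ z + ψ z := by
  simp only [IsOrthogonalTo, add_mul]
  exact ⟨h1.1.add h2.1, by rw [integral_add h1.1 h2.1, h1.2, h2.2, add_zero]⟩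

theorem const_mul (h1 : IsOrthogonalTo f φ) (k : ℂ) : IsOrthogonalTo f fun z => k * φ z := by
  simp only [IsOrthogonalTo, mul_assoc]
  exact ⟨h1.1.const_mul k, by rw [integral_const_mul, h1.2, mul_zero]⟩

theorem sub (h1 : IsOrthogonalTo f φ) (h2 : IsOrthogonalTo f ψ) :
    IsOrthogonalTo f fun z => φ z - ψ z := by
  simp only [IsOrthogonalTo, sub_mul]
  exact ⟨h1.1.sub h2.1, by rw [integral_sub h1.1 h2.1, h1.2, h2.2, sub_zero]⟩

theorem zero (f : ℍ → ℂ) : IsOrthogonalTo f fun _ => 0 := by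
  simp [IsOrthogonalTo]

theorem ite {p : Prop} [Decidable p] (h : p → IsOrthogonalTo f φ) :
    IsOrthogonalTo f fun z => if p then φ z else 0 := by
  split_ifs with hp
  · exact h hp
  · exact zero f

end IsOrthogonalTo

theorem IsMaassCuspForm.isRapidlyDecreasing_conj (hf : IsMaassCuspForm s f) :
    IsRapidlyDecreasing fun z => conj (f z) := by
  have h := hf.isRapidlyDecreasing (g := fun _ => 1) measurable_const (fun _ _ => rfl)
    zero_le_one (fun z _ => by rw [norm_one, one_mul, Real.one_le_exp_iff]; exact z.im_pos.le)
  simpa only [one_mul] using h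

/-- The unfolded integral contains only the zeroth Fourier coefficient of `f̄`, which is zero;
continuation in `w` extends the orthogonality to all `Re w ≥ 1/2`, and the residue at `1` gives the
constants. -/
theorem IsMaassCuspForm.integral_conj_eq_zero (hf : IsMaassCuspForm s f) :
    (∀ w : ℂ, 1 / 2 ≤ w.re → ∫ z in 𝒟, eisenstein w z * conj (f z) = 0) ∧
      ∫ z in 𝒟, conj (f z) = 0 := by
  refine hf.isRapidlyDecreasing_conj.integral_eq_zero_of_unitStrip fun w hw => ?_
  rw [hf.isRapidlyDecreasing_conj.integral_unitStrip hw]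
  refine (setIntegral_congr_fun (g := fun _ => (0 : ℂ)) measurableSet_Ioi fun y hy => ?_).trans
    (by simp)
  have h := hf.cuspidal y hy
  have h2 : ∫ x in (0 : ℝ)..1, conj (f (ofComplex (x + y * Complex.I))) = 0 := by
    rw [intervalIntegral.integral_of_le zero_le_one] at h ⊢
    rw [integral_conj, h, map_zero]
  simp only
  rw [h2, mul_zero]

theorem IsMaassCuspForm.isOrthogonalTo_eisenstein (hf : IsMaassCuspForm s f) {w : ℂ}
    (hw : 1 / 2 ≤ w.re) : IsOrthogonalTo f (eisenstein w) := by
  refine ⟨?_, hf.integral_conj_eq_zero.1 w hw⟩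
  by_cases h1 : w = 1
  · subst h1
    have e : ∀ z, eisenstein 1 z = eisensteinStar z := fun z => by rw [eisenstein, if_pos rfl]
    simp only [e]
    exact hf.isRapidlyDecreasing_conj.integral_eisensteinStar.1
  · exact (hf.isRapidlyDecreasing_conj.integral_eisenstein hw h1).1

theorem IsMaassCuspForm.isOrthogonalTo_const (hf : IsMaassCuspForm s f) (k : ℂ) :
    IsOrthogonalTo f fun _ => k := by
  have h : IsOrthogonalTo f fun _ => 1 := by
    simp only [IsOrthogonalTo, one_mul]
    refine ⟨?_, hf.integral_conj_eq_zero.2⟩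
    have := hf.isRapidlyDecreasing_conj.integrableOn isModerateFamily_im_cpow 0
    simpa only [Complex.cpow_zero, one_mul] using this
  simpa only [mul_one] using h.const_mul k

/-- The point is that every parameter occurring has real part at least `1/2`: for `1 + α - β`
because `Re β ≤ Re α + 1/2` in its regime, and for `2 - α - β` because it occurs only when `Re(α +
β) < 3/2`. A parameter equal to `1` is covered by `E₁*`. -/
theorem IsMaassCuspForm.isOrthogonalTo_subtractedSumOfLe (hf : IsMaassCuspForm s f) {α β : ℂ}
    (hα : 1 / 2 ≤ α.re) (hαβ : α.re ≤ β.re) : IsOrthogonalTo f (subtractedSumOfLe α β) := by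
  have hstar : IsOrthogonalTo f eisensteinStar := by
    have e : eisensteinStar = eisenstein 1 := funext fun z => by rw [eisenstein, if_pos rfl]
    rw [e]
    exact hf.isOrthogonalTo_eisenstein (by norm_num)
  have hsum : IsOrthogonalTo f (eisenstein (α + β)) :=
    hf.isOrthogonalTo_eisenstein (by simp; linarith)
  have hα1 : IsOrthogonalTo f (eisenstein (1 - α + β)) :=
    hf.isOrthogonalTo_eisenstein (by simp; linarith)
  unfold subtractedSumOfLe
  by_cases h1 : α = β
  · simp only [if_pos h1]
    refine IsOrthogonalTo.sub (((hf.isOrthogonalTo_eisenstein (by simp; linarith)).add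
      (hstar.const_mul (2 * scatteringCoeff α))).add (IsOrthogonalTo.ite fun h => ?_))
      (hf.isOrthogonalTo_const _)
    exact (hf.isOrthogonalTo_eisenstein (by simp; linarith)).const_mul _
  · simp only [if_neg h1]
    by_cases h2 : α.re + 1 / 2 < β.re
    · simp only [if_pos h2]
      exact hsum.add (hα1.const_mul _)
    · simp only [if_neg h2]
      refine ((hsum.add ((hf.isOrthogonalTo_eisenstein ?_).const_mul _)).add
        (hα1.const_mul _)).add (IsOrthogonalTo.ite fun h => ?_)
      · simp; linarith
      · refine (hf.isOrthogonalTo_eisenstein ?_).const_mul _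
        simp at h ⊢; linarith

theorem IsMaassCuspForm.isOrthogonalTo_subtractedSum (hf : IsMaassCuspForm s f) {α β : ℂ}
    (hα : 1 / 2 ≤ α.re) (hβ : 1 / 2 ≤ β.re) : IsOrthogonalTo f (subtractedSum α β) := by
  unfold subtractedSum
  by_cases h : α.re ≤ β.re
  · simp only [if_pos h]
    exact hf.isOrthogonalTo_subtractedSumOfLe hα h
  · simp only [if_neg h]
    exact hf.isOrthogonalTo_subtractedSumOfLe hβ (not_le.1 h).le

/-- Both `E_α E_β f̄` and the subtracted part times `f̄` are integrable separately thanks to the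
decay of `f`, so the orthogonal part simply drops out. -/
theorem IsMaassCuspForm.integral_regularizedProduct (hf : IsMaassCuspForm s f) {α β : ℂ}
    (hα : 1 / 2 ≤ α.re) (hα1 : α ≠ 1) (hβ : 1 / 2 ≤ β.re) (hβ1 : β ≠ 1) :
    IntegrableOn (fun z : ℍ => regularizedProduct α β z * conj (f z)) 𝒟 ∧
      ∫ z in 𝒟, regularizedProduct α β z * conj (f z) =
        eisensteinPairing (fun z => eisenstein β z * conj (f z)) α := by
  obtain ⟨i1, v1⟩ := (hf.isRapidlyDecreasing_eisenstein_mul hβ hβ1).integral_eisenstein hα hα1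
  obtain ⟨i2, v2⟩ := hf.isOrthogonalTo_subtractedSum hα hβ
  have e : ∀ z, regularizedProduct α β z * conj (f z) =
      eisenstein α z * (eisenstein β z * conj (f z)) - subtractedSum α β z * conj (f z) := fun z => by
    rw [regularizedProduct]; ring
  simp only [e]
  exact ⟨i1.sub i2, by rw [integral_sub i1 i2, v1, v2, sub_zero]⟩

end

end

theorem mainTheorem7 (f : ℍ → ℂ) (s α β : ℂ) (hf : IsMaassCuspForm s f)
    (hαβ : (α, β) ∈ admissiblePairs) :
    -- the Fourier-Whittaker expansion of `f` that defines the coefficients `c_n`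
    (∀ z : ℍ, HasSum (fun n : {n : ℤ // n ≠ 0} =>
        whittakerCoeff s f n * maassWhittaker s (|((n : ℤ) : ℝ)| * z.im) * fourierExp n z.re)
        (f z)) ∧
    -- the Dirichlet series converges in a half-plane, and `L` and `Λ` are its continuations,
    -- without a pole at `α`
    (∃ σ : ℝ, ∀ w : ℂ, σ < w.re → Summable (rankinSelbergTerm s f β w)) ∧
    IsMeromorphicContinuation (rankinSelbergSeries s f β) (rankinSelbergL s f β) ∧
    IsMeromorphicContinuation (fun w => rankinSelbergSeries s f β w * gammaRatio s β w)
      (completedRankinSelbergL s f β) ∧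
    AnalyticAt ℂ (rankinSelbergL s f β) α ∧
    AnalyticAt ℂ (completedRankinSelbergL s f β) α ∧
    -- the pairing `⟨S, f⟩` converges and equals `Λ(α, f̄ × E_β)`
    IntegrableOn (fun z : ℍ => regularizedProduct α β z * conj (f z)) 𝒟 ∧
    (∫ z in 𝒟, regularizedProduct α β z * conj (f z)) = completedRankinSelbergL s f β α ∧
    -- `Λ` is the product of `L` and the Gamma factors wherever the latter have no pole
    ((∀ k : ℕ, (α - β + conj s) / 2 ≠ -(k : ℂ) ∧ (α + 1 - β - conj s) / 2 ≠ -(k : ℂ)) →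
      (∫ z in 𝒟, regularizedProduct α β z * conj (f z)) =
        rankinSelbergL s f β α * gammaRatio s β α) := by
  obtain ⟨hα1, hβ1, hα, hβ, -⟩ := hαβ
  simp only at hα1 hβ1 hα hβ
  have hs := hf.re_pos
  have hs1 := hf.re_lt_one
  have hsΓ : Complex.Gamma s ≠ 0 := Complex.Gamma_ne_zero_of_re_pos hs
  have hκ := rankinSelbergConst_ne_zero hsΓ
    (Complex.Gamma_ne_zero_of_re_pos (s := β) (by linarith))
  have hh := hf.isRapidlyDecreasing_eisenstein_mul hβ hβ1
  obtain ⟨σ, hσ1, hσ⟩ := hf.exists_rankinSelbergSeries_eq hβ hβ1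
  obtain ⟨τ, hτ⟩ := hf.exists_rankinSelbergFormula_eq hβ hβ1
  have hLm := hf.meromorphicOn_rankinSelbergFormula hβ hβ1
  have hLα := hf.analyticAt_rankinSelbergFormula hβ hβ1 hα hα1
  have hΛm := hh.meromorphicOn_eisensteinPairing
  have hΛα := hh.analyticAt_eisensteinPairing (xiEntire_ne_zero hα) hα1
  have hΛ : ∀ w : ℂ, σ < w.re →
      AnalyticAt ℂ (eisensteinPairing fun z => eisenstein β z * conj (f z)) w ∧
      eisensteinPairing (fun z => eisenstein β z * conj (f z)) w =
        rankinSelbergSeries s f β w * gammaRatio s β w := fun w hw =>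
    ⟨hh.analyticAt_eisensteinPairing (xiEntire_ne_zero (by linarith))
      (ne_one_of_one_lt_re (by linarith)), (hσ w hw).2.2.symm⟩
  have cL := isMeromorphicContinuation_toMeromorphicNFOn hLm hτ
  have cΛ := isMeromorphicContinuation_toMeromorphicNFOn hΛm hΛ
  have eL := meromorphicContinuation_eventuallyEq hLm hτ hLα
  have eΛ := meromorphicContinuation_eventuallyEq hΛm hΛ hΛα
  obtain ⟨hi, hv⟩ := hf.integral_regularizedProduct hα hα1 hβ hβ1
  refine ⟨hf.hasSum_whittakerCoeff hsΓ, ⟨σ, fun w hw => (hσ w hw).2.1⟩, ?_, ?_,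
    hLα.congr eL.symm, hΛα.congr eΛ.symm, hi, hv.trans eΛ.eq_of_nhds.symm, fun hk => ?_⟩
  · rw [rankinSelbergL, cL.eq]; exact cL
  · rw [completedRankinSelbergL, cΛ.eq]; exact cΛ
  -- From `0 < Re s < 1` and `Re α, Re β ≥ 1/2`, the arguments `(α + β - s̄)/2` and `(α - 1 + β +
  -- s̄)/2` have positive real part; the poles of the other two Gamma factors are excluded by
  -- assumption. Hence the Gamma ratio and its reciprocal multiply to one at `α`.
  · have hd : ∀ z : ℂ, 0 < z.re → Complex.Gamma (z / 2) ≠ 0 := fun z hz =>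
      Complex.Gamma_ne_zero_of_re_pos (by
        rw [show z / 2 = z / (2 : ℝ) by push_cast; rfl, Complex.div_ofReal_re]; linarith)
    have hB := besselMellin_mul_recip_of_ne_zero (a := β - 1 / 2) (b := conj s - 1 / 2) (w := α)
      (Complex.Gamma_ne_zero_of_re_pos (by linarith))
      (hd _ (by simp; linarith))
      (Complex.Gamma_ne_zero fun k h => (hk k).2 (by rw [← h]; ring))
      (hd _ (by simp; linarith))
      (Complex.Gamma_ne_zero fun k h => (hk k).1 (by rw [← h]; ring))
    rw [hv, rankinSelbergL, eL.eq_of_nhds, rankinSelbergFormula, gammaRatio_eq]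
    generalize β - 1 / 2 = a at hB ⊢
    generalize conj s - 1 / 2 = b at hB ⊢
    field_simp
    linear_combination (-(eisensteinPairing (fun z => eisenstein β z * conj (f z)) α)) * hB
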